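/- Let $X$ (the previous imputation $X^{(t-1)}$) be a random vector in $\mathbb R^d$ with $\mathbb E\|X\|^2<\infty$ and let $M$ be a random mask in $\{0,1\}^d$ on the same probability space, with an arbitrary joint law. For a mask $m$ and a vector $x$ let $x_m:=m\odot x$ and $x_{1-m}:=(1-m)\odot x$ be the zero-padded observed and missing parts of $x$. Let $(X_0,M_0)$ have the law of $(X,M)$, let $X_1$ have the law of $X$ and be independent of $(X_0,M_0)$, and put $X_\tau=(1-\tau)X_0+\tau X_1$. Let $v^*=v^*(y,u,w,m,\tau)$ be a minimizer, among all measurable velocity fields $v$, of $$\int_0^1\mathbb E\big\|X_1-X_0-v(X_{\tau,1-M_0},X_{0,M_0},X_{1,M_0},M_0,\tau)\big\|^2\,d\tau .$$ Suppose that $v^*$ is continuous in the following sense: for every $m$ with $\mathbb P(M=m)>0$ and for almost every $u$ with respect to the law of $X_m$ given $M=m$, the map $(y,u',w',\tau)\mapsto v^*(y_{1-m},u'_m,w'_m,m,\tau)$ is continuous at $(y,u,u,\tau)$ for all $y\in\mathbb R^d$ and $\tau\in(0,1)$. Let the random vector $Z_0$ be such that its conditional law given $X_M=x_m$, $M=m$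 is the conditional law of $X_{1-m}$ given $X_m=x_m$, $M=m$. Suppose that for almost every realization $(z,x,m)$ of $(Z_0,X,M)$ the imputation ODE $$\frac{dZ_\tau}{d\tau}=(1-m)\odot v^*(Z_\tau,x_m,x_m,m,\tau)\quad(0<\tau<1),\qquad Z_0=z,$$ has exactly one solution that is continuous on $[0,1]$, and let $g^*$ be a measurable map with $g^*(z,x,m)=Z_1$ for almost every such realization (here $Z_1$ depends on $x$ only through $x_m$). Then: 1. for every $m$ with $\mathbb P(M=m)>0$, and for almost every $x_m$ with respect to the law of $X_m$ given $M=m$, the conditional law of $Z_1=g^*(Z_0,X,M)$ given $X_m=x_m$, $M=m$ is the conditional law of $X_{1-m}$ given $X_m=x_m$ (without conditioning on $M$); 2. $g^*$ is an optimal imputer: with $X(g):=M\odot X+(1-M)\odot g(Z_0,X,M)$, it minimizes the Kullback-Leibler divergence $$\mathrm D\big[\mathbb P_{X(g),M}\,\big\|\,\mathbb P_{X}\otimes\mathbb P_M\big]$$ among all measurable imputers $g$, whatever random seed in $\mathbb R^d$ (with whatever joint law with $(X,M)$) the competitor $g$ uses in place of $Z_0$. -/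

import Mathlib

open MeasureTheory ProbabilityTheory Set Filter Topology
open scoped ENNReal

namespace MIRI

/-- Data vectors: `ℝᵈ` with its Euclidean norm. -/
abbrev Vec (d : ℕ) : Type := EuclideanSpace ℝ (Fin d)

/-- Missingness masks in `{0,1}ᵈ`; `m i = true` means that coordinate `i` is observed. -/
abbrev Mask (d : ℕ) : Type := Fin d → Bool

/-- `m ⊙ x`: the observed part of `x`, padded with zeros. -/
noncomputable def obs {d : ℕ} (m : Mask d) (x : Vec d) : Vec d :=
  WithLp.toLp 2 fun i => if m i then x i else 0

/-- `(1 - m) ⊙ x`: the missing part of `x`, padded with zeros. -/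
noncomputable def mis {d : ℕ} (m : Mask d) (x : Vec d) : Vec d :=
  WithLp.toLp 2 fun i => if m i then 0 else x i

/-- Velocity fields `v (y, u, w, m, τ)`. -/
abbrev Velocity (d : ℕ) : Type := Vec d → Vec d → Vec d → Mask d → ℝ → Vec d

/-- Joint (Borel) measurability of a velocity field. -/
def Velocity.IsMeasurable {d : ℕ} (v : Velocity d) : Prop :=
  Measurable fun p : Vec d × Vec d × Vec d × Mask d × ℝ =>
    v p.1 p.2.1 p.2.2.1 p.2.2.2.1 p.2.2.2.2

/-- Imputers `g (z, x, m)` with seed `z`, current data vector `x` and mask `m`. -/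
abbrev Imputer (d : ℕ) : Type := Vec d → Vec d → Mask d → Vec d

/-- Joint (Borel) measurability of an imputer. -/
def Imputer.IsMeasurable {d : ℕ} (g : Imputer d) : Prop :=
  Measurable fun p : Vec d × Vec d × Mask d => g p.1 p.2.1 p.2.2

section Definitions

variable {d : ℕ} {Ω : Type*} [MeasurableSpace Ω]

/-- The rectified-flow training objective
`∫₀¹ E ‖X₁ - X₀ - v (X_{τ,1-M₀}, X_{0,M₀}, X_{1,M₀}, M₀, τ)‖² dτ`, where
`X_τ = (1 - τ) X₀ + τ X₁`, the pair `(X₀, M₀)` has the law of `(X, M)`, and `X₁` has the law of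
`X` and is independent of `(X₀, M₀)`.  It takes values in `[0, ∞]`. -/
noncomputable def objective (P : Measure Ω) (X : Ω → Vec d) (M : Ω → Mask d)
    (v : Velocity d) : ℝ≥0∞ :=
  ∫⁻ τ in Icc (0 : ℝ) 1, ∫⁻ p : (Vec d × Mask d) × Vec d,
    ‖p.2 - p.1.1 - v (mis p.1.2 ((1 - τ) • p.1.1 + τ • p.2)) (obs p.1.2 p.1.1)
      (obs p.1.2 p.2) p.1.2 τ‖ₑ ^ 2
    ∂((P.map fun ω => (X ω, M ω)).prod (P.map X))

/-- `v` minimizes the objective among all measurable velocity fields. -/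
def IsOptimalVelocity (P : Measure Ω) (X : Ω → Vec d) (M : Ω → Mask d) (v : Velocity d) : Prop :=
  v.IsMeasurable ∧ ∀ v' : Velocity d, v'.IsMeasurable → objective P X M v ≤ objective P X M v'

/-- `Z` solves the imputation ODE
`dZ/dτ = (1 - m) ⊙ v (Z, [0, x_m], [0, x_m], m, τ)` on `[0, 1]` with `Z 0 = z`. -/
def IsImputationSolution (v : Velocity d) (m : Mask d) (x z : Vec d) (Z : ℝ → Vec d) : Prop :=
  ContinuousOn Z (Icc 0 1) ∧ Z 0 = z ∧
    ∀ τ ∈ Ioo (0 : ℝ) 1, HasDerivAt Z (mis m (v (Z τ) (obs m x) (obs m x) m τ)) τ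

/-- The imputation ODE started at `z` has exactly one solution on `[0, 1]`, and its value at
time `1` is `z₁`. -/
def HasUniqueTerminalValue (v : Velocity d) (m : Mask d) (x z z₁ : Vec d) : Prop :=
  ∃ Z : ℝ → Vec d, IsImputationSolution v m x z Z ∧ Z 1 = z₁ ∧
    ∀ Z' : ℝ → Vec d, IsImputationSolution v m x z Z' → EqOn Z' Z (Icc 0 1)

/-- The initial condition: given the observed part and the mask, `Z₀` has the conditional
distribution of the missing part of `X`. -/
def IsInitialSeed (P : Measure Ω) [IsFiniteMeasure P] (X : Ω → Vec d) (M : Ω → Mask d)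
    (Z₀ : Ω → Vec d) : Prop :=
  condDistrib Z₀ (fun ω => (obs (M ω) (X ω), M ω)) P
    =ᵐ[P.map fun ω => (obs (M ω) (X ω), M ω)]
  condDistrib (fun ω => mis (M ω) (X ω)) (fun ω => (obs (M ω) (X ω), M ω)) P

/-- The imputed vector `X(g) = M ⊙ X + (1 - M) ⊙ g (Z₀, X, M)`. -/
noncomputable def imputed (X : Ω → Vec d) (M : Ω → Mask d) (Z₀ : Ω → Vec d) (g : Imputer d)
    (ω : Ω) : Vec d :=
  obs (M ω) (X ω) + mis (M ω) (g (Z₀ ω) (X ω) (M ω))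

/-- `D[P_{X(g), M} ‖ P_X ⊗ P_M]`, a Kullback-Leibler divergence in `[0, ∞]`. -/
noncomputable def imputationKL (P : Measure Ω) (X : Ω → Vec d) (M : Ω → Mask d)
    (Z₀ : Ω → Vec d) (g : Imputer d) : ℝ≥0∞ :=
  InformationTheory.klDiv (P.map fun ω => (imputed X M Z₀ g ω, M ω))
    ((P.map X).prod (P.map M))

/-- The imputer `g` with seed `Z₀` minimizes the divergence among all measurable imputers and all
random seeds (of arbitrary joint law with `(X, M)`). -/
def IsOptimalImputer (P : Measure Ω) (X : Ω → Vec d) (M : Ω → Mask d)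
    (Z₀ : Ω → Vec d) (g : Imputer d) : Prop :=
  g.IsMeasurable ∧ ∀ (Z₀' : Ω → Vec d) (g' : Imputer d), Measurable Z₀' → g'.IsMeasurable →
    imputationKL P X M Z₀ g ≤ imputationKL P X M Z₀' g'

/-- The law of the observed part `[0, X_m]` given `M = m`. -/
noncomputable def obsLaw (P : Measure Ω) (X : Ω → Vec d) (M : Ω → Mask d) (m : Mask d) :
    Measure (Vec d) :=
  (P[|M ⁻¹' {m}]).map fun ω => obs m (X ω)

/-- `v (·, ·, ·, m, ·)`, restricted to zero-padded arguments, is continuous at `(y, u, u, τ)` for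
`ρ`-almost every `u`, every `y` and every `τ ∈ (0, 1)`. -/
def Velocity.IsContinuousOnDiagonal (v : Velocity d) (m : Mask d) (ρ : Measure (Vec d)) : Prop :=
  ∀ᵐ u ∂ρ, ∀ (y : Vec d), ∀ τ ∈ Ioo (0 : ℝ) 1,
    ContinuousAt (fun q : Vec d × Vec d × Vec d × ℝ =>
      v (mis m q.1) (obs m q.2.1) (obs m q.2.2.1) m q.2.2.2) (y, u, u, τ)

end Definitions

end MIRI

/-! Fix a mask m and an observed value u. Let μ be the law of X_{1-m} given X_m = u and M = m, and ν
its law given X_m = u alone. The claim is that the flow of b(y,τ) = (1-m) ⊙ v(y,u,u,m,τ) carries μ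
to ν.

The field is a conditional mean. Under μ ⊗ ν, b(y,τ) should be the mean of X₁ - X₀ given X_τ = y.
Minimality of v makes the training residual orthogonal to every bounded field, but the event that
both observed parts equal u is in general null. So both are confined to a small ball around u. As
the ball shrinks, Besicovitch differentiation makes the conditioned laws converge weakly to μ ⊗ ν
for almost every u, and continuity of v on the diagonal lets the field pass to the limit
(`ae_integral_testedResidual_eq_zero`, `integral_velocityKernel_eq`).

The flow transports. Only uniqueness of trajectories from almost every start is given, with no
Lipschitz bound, so the flow is compared with a Markov chain: at time k/N and position y, draw V
from the law of X₁ - X₀ given X_{k/N} = y, then move by V/N. Since X_t + (X₁ - X₀)/N = X_{t+1/N},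
the chain has exactly the marginals of the interpolation, and it ends with law ν. The differences V
- b are martingale increments, so they accumulate to O(N^{-1/2}) in L². The energy ∑|V|² is of order
N with high probability, so the paths are 1/2-Hölder; by Arzelà–Ascoli their limits solve the ODE,
and uniqueness puts the end of the chain near Z₁ (`chainPos_terminal_close`, `map_terminal_eq`).
`condDistrib_terminal_ae_eq` joins the two halves.

Optimality. The pair (X_M, M) is a function of any imputed pair, so data processing bounds every
divergence below by the one between the observed laws. By the first claim, the law imputed by g and
the reference law arise from these two observed laws through one and the same kernel, so g attains
the bound (`isOptimalImputer_of_condDistrib_eq`). -/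

namespace MIRI

/-! ### Time grids: the occupation times of the cells. -/

/-- The time spent before `t` in the `k`-th of `N` equal cells of `[0, 1]`. -/
noncomputable def cellTime (N k : ℕ) (t : ℝ) : ℝ := max 0 (min (t - k / N) (1 / N))

lemma cellTime_monotone (N k : ℕ) : Monotone (cellTime N k) := fun s t hst ↦
  max_le_max le_rfl (min_le_min (by linarith) le_rfl)

lemma cellTime_nonneg (N k : ℕ) (t : ℝ) : 0 ≤ cellTime N k t := le_max_left _ _

lemma cellTime_le (N k : ℕ) (t : ℝ) : cellTime N k t ≤ 1 / N :=
  max_le (by positivity) (min_le_right _ _)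

lemma continuous_cellTime (N k : ℕ) : Continuous (cellTime N k) := by
  unfold cellTime; fun_prop

lemma abs_cellTime_sub_le (N k : ℕ) (s t : ℝ) : |cellTime N k t - cellTime N k s| ≤ 1 / N := by
  rw [abs_le]
  constructor <;>
    linarith [cellTime_nonneg N k s, cellTime_nonneg N k t, cellTime_le N k s, cellTime_le N k t]

lemma cellTime_zero_of_le {N : ℕ} {t : ℝ} (h : 1 / N ≤ t) : cellTime N 0 t = 1 / N := by
  simp only [cellTime, CharP.cast_eq_zero, zero_div, sub_zero]
  rw [min_eq_right h, max_eq_right (by positivity)]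

lemma sum_cellTime_eq_min (N : ℕ) {t : ℝ} (ht : 0 ≤ t) (n : ℕ) :
    ∑ k ∈ Finset.range n, cellTime N k t = min t (n / N) := by
  induction n with
  | zero => simp [ht]
  | succ n ih =>
    have hN : (0 : ℝ) ≤ 1 / N := by positivity
    have h1 : ((n + 1 : ℕ) : ℝ) / N = n / N + 1 / N := by push_cast; ring
    rw [Finset.sum_range_succ, ih, cellTime, h1]
    rcases le_total t (n / N) with h | h
    · rw [min_eq_left h, min_eq_left (by linarith : t - n / N ≤ 1 / N), max_eq_left (by linarith),
        min_eq_left (by linarith), add_zero]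
    · rw [min_eq_right h]
      rcases le_total (t - n / N) (1 / N) with h' | h'
      · rw [min_eq_left h', max_eq_right (by linarith), min_eq_left (by linarith)]; ring
      · rw [min_eq_right h', max_eq_right hN, min_eq_right (by linarith)]

lemma sum_cellTime {N : ℕ} (hN : N ≠ 0) {t : ℝ} (ht : t ∈ Icc (0 : ℝ) 1) :
    ∑ k ∈ Finset.range N, cellTime N k t = t := by
  rw [sum_cellTime_eq_min N ht.1, div_self (by exact_mod_cast hN), min_eq_left ht.2]

lemma cellTime_node (N k j : ℕ) :
    cellTime N k (j / N) = if k < j then 1 / (N : ℝ) else 0 := by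
  have hN : (0 : ℝ) ≤ 1 / N := by positivity
  have h0 : ((j : ℝ) / N - k / N) = ((j : ℝ) - k) * (1 / N) := by ring
  rw [cellTime, h0]
  split_ifs with h
  · have : (1 : ℝ) ≤ j - k := by
      have : ((k + 1 : ℕ) : ℝ) ≤ j := by exact_mod_cast h
      push_cast at this; linarith
    rw [min_eq_right (by nlinarith), max_eq_right hN]
  · have : (j : ℝ) - k ≤ 0 := by
      have : (j : ℝ) ≤ k := by exact_mod_cast not_lt.mp h
      linarith
    rw [max_eq_left]
    exact (min_le_left _ _).trans (by nlinarith)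

/-- This turns weighted sums over cells into integrals of step functions. -/
lemma integral_indicator_cell (N k : ℕ) (s t : ℝ) :
    ∫ τ in s..t, (Ioc ((k : ℝ) / N) (k / N + 1 / N)).indicator (fun _ ↦ (1 : ℝ)) τ
      = cellTime N k t - cellTime N k s := by
  have hN : (0 : ℝ) ≤ 1 / N := by positivity
  wlog hst : s ≤ t generalizing s t
  · rw [intervalIntegral.integral_symm, this t s (le_of_not_ge hst)]; ring
  rw [intervalIntegral.integral_of_le hst, integral_indicator measurableSet_Ioc,
    Measure.restrict_restrict measurableSet_Ioc, Ioc_inter_Ioc]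
  simp only [integral_const, smul_eq_mul, mul_one, measureReal_restrict_apply MeasurableSet.univ,
    univ_inter, Real.volume_real_Ioc, cellTime]
  generalize (1 : ℝ) / N = h at *
  generalize (k : ℝ) / N = a at *
  rcases max_cases a s with ⟨h1, h1'⟩ | ⟨h1, h1'⟩ <;>
  rcases min_cases (a + h) t with ⟨h2, h2'⟩ | ⟨h2, h2'⟩ <;>
  rcases min_cases (t - a) h with ⟨h3, h3'⟩ | ⟨h3, h3'⟩ <;>
  rcases min_cases (s - a) h with ⟨h4, h4'⟩ | ⟨h4, h4'⟩ <;>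
  rw [h1, h2, h3, h4] <;>
  · simp only [max_def]; split_ifs <;> linarith

/-! ### Polygonal paths of a chain. -/

section Path

variable {E : Type*} [NormedAddCommGroup E] [NormedSpace ℝ E]

/-- The position after `k` steps of length `1 / N` with velocities `V` from `z`. -/
noncomputable def chainPos (N : ℕ) (z : E) (V : ℕ → E) (k : ℕ) : E :=
  z + ∑ j ∈ Finset.range k, (1 / N : ℝ) • V j

/-- The polygonal path through the positions `chainPos`. -/
noncomputable def chainPath (N : ℕ) (z : E) (V : ℕ → E) (t : ℝ) : E :=
  z + ∑ k ∈ Finset.range N, cellTime N k t • V k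

/-- The accumulated difference, between the times `1 / 2` and `t`, of the velocities of a chain and
of a velocity field. -/
noncomputable def chainDefect (b : E → ℝ → E) (N : ℕ) (z : E) (V : ℕ → E) (t : ℝ) : E :=
  ∑ k ∈ Finset.range N,
    (cellTime N k t - cellTime N k (1 / 2)) • (V k - b (chainPos N z V k) (k / N))

lemma chainPath_node {N j : ℕ} (hj : j ≤ N) (z : E) (V : ℕ → E) :
    chainPath N z V (j / N) = chainPos N z V j := by
  simp only [chainPath, chainPos, cellTime_node, ite_smul, zero_smul]
  rw [← Finset.sum_filter]
  congr 2
  ext k; simp; omega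

lemma continuous_chainPath (N : ℕ) (z : E) (V : ℕ → E) : Continuous (chainPath N z V) := by
  unfold chainPath
  exact continuous_const.add (continuous_finsetSum _ fun k _ ↦
    (continuous_cellTime N k).smul continuous_const)

lemma chainPath_zero (N : ℕ) (z : E) (V : ℕ → E) : chainPath N z V 0 = z := by
  simpa [chainPos] using chainPath_node (Nat.zero_le N) z V

lemma chainPath_sub (N : ℕ) (z : E) (V : ℕ → E) (s t : ℝ) :
    chainPath N z V t - chainPath N z V s =
      ∑ k ∈ Finset.range N, (cellTime N k t - cellTime N k s) • V k := by
  simp [chainPath, sub_smul, Finset.sum_sub_distrib]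

/-- Cauchy–Schwarz with the cell weights between s and t: they sum to t - s and each is at most 1/N,
which cancels the N in the energy bound. -/
lemma norm_chainPath_sub_le {N : ℕ} (hN : N ≠ 0) {z : E} {V : ℕ → E} {K : ℝ} (hK : 0 ≤ K)
    (hV : ∑ k ∈ Finset.range N, ‖V k‖ ^ 2 ≤ N * K ^ 2) {s t : ℝ}
    (hs : s ∈ Icc (0 : ℝ) 1) (ht : t ∈ Icc (0 : ℝ) 1) :
    ‖chainPath N z V t - chainPath N z V s‖ ≤ K * √|t - s| := by
  wlog hst : s ≤ t generalizing s t
  · rw [norm_sub_rev, abs_sub_comm]; exact this ht hs (le_of_not_ge hst)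
  have hN' : (0 : ℝ) < N := by positivity
  set w : ℕ → ℝ := fun k ↦ cellTime N k t - cellTime N k s
  have hw0 : ∀ k, 0 ≤ w k := fun k ↦ sub_nonneg.2 (cellTime_monotone N k hst)
  have hw1 : ∀ k, w k ≤ 1 / N := fun k ↦ (le_abs_self _).trans (abs_cellTime_sub_le N k s t)
  have hws : ∑ k ∈ Finset.range N, w k = t - s := by
    simp only [w, Finset.sum_sub_distrib, sum_cellTime hN ht, sum_cellTime hN hs]
  rw [chainPath_sub, abs_of_nonneg (by linarith)]
  have h1 : ‖∑ k ∈ Finset.range N, w k • V k‖ ≤ ∑ k ∈ Finset.range N, w k * ‖V k‖ := by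
    refine (norm_sum_le _ _).trans_eq (Finset.sum_congr rfl fun k _ ↦ ?_)
    rw [norm_smul, Real.norm_of_nonneg (hw0 k)]
  refine h1.trans (abs_le_of_sq_le_sq' ?_ (by positivity)).2
  have h2 : (∑ k ∈ Finset.range N, w k * ‖V k‖) ^ 2 ≤
      (∑ k ∈ Finset.range N, w k) * ∑ k ∈ Finset.range N, w k * ‖V k‖ ^ 2 :=
    Finset.sum_sq_le_sum_mul_sum_of_sq_le_mul _ (fun k _ ↦ hw0 k)
      (fun k _ ↦ mul_nonneg (hw0 k) (by positivity)) (fun k _ ↦ le_of_eq (by ring))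
  have h3 : ∑ k ∈ Finset.range N, w k * ‖V k‖ ^ 2 ≤ K ^ 2 := by
    calc ∑ k ∈ Finset.range N, w k * ‖V k‖ ^ 2
        ≤ ∑ k ∈ Finset.range N, 1 / N * ‖V k‖ ^ 2 :=
          Finset.sum_le_sum fun k _ ↦ mul_le_mul_of_nonneg_right (hw1 k) (by positivity)
      _ = 1 / N * ∑ k ∈ Finset.range N, ‖V k‖ ^ 2 := by rw [Finset.mul_sum]
      _ ≤ 1 / N * (N * K ^ 2) := by gcongr
      _ = K ^ 2 := by field_simp
  rw [mul_pow, Real.sq_sqrt (by linarith)]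
  rw [hws] at h2
  nlinarith

end Path

/-! ### Limits of approximate chains solve the ODE. -/

section Path

variable {E : Type*} [NormedAddCommGroup E] [NormedSpace ℝ E]

/-- The half-open cells partition (0, 1], and the one containing τ has index ⌈τN⌉ - 1. -/
lemma exists_cell {N : ℕ} (hN : N ≠ 0) {τ : ℝ} (hτ : τ ∈ Ioc (0 : ℝ) 1) :
    ∃ k < N, τ ∈ Ioc ((k : ℝ) / N) (k / N + 1 / N) ∧ ∀ f : ℕ → E,
      ∑ j ∈ Finset.range N,
        (Ioc ((j : ℝ) / N) (j / N + 1 / N)).indicator (fun _ ↦ (1 : ℝ)) τ • f j = f k := by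
  have hN' : (0 : ℝ) < N := by positivity
  have hmem : ∀ j : ℕ, τ ∈ Ioc ((j : ℝ) / N) (j / N + 1 / N) ↔ ⌈τ * N⌉₊ = j + 1 := by
    intro j
    rw [Nat.ceil_eq_iff (by omega), mem_Ioc, ← add_div, div_lt_iff₀ hN', le_div_iff₀ hN']
    push_cast
    simp
  have hpos : 0 < ⌈τ * N⌉₊ := Nat.ceil_pos.2 (mul_pos hτ.1 hN')
  have hle : ⌈τ * N⌉₊ ≤ N := Nat.ceil_le.2 (mul_le_of_le_one_left hN'.le hτ.2)
  refine ⟨⌈τ * N⌉₊ - 1, by omega, (hmem _).2 (by omega), fun f ↦ ?_⟩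
  rw [Finset.sum_eq_single (⌈τ * N⌉₊ - 1)]
  · rw [indicator_of_mem ((hmem _).2 (by omega)), one_smul]
  · intro j _ hj
    rw [indicator_of_notMem (fun h ↦ hj (by have := (hmem j).1 h; omega)), zero_smul]
  · intro h
    exact absurd (Finset.mem_range.2 (by omega)) h

lemma intervalIntegrable_indicator_cell (N k : ℕ) (c : E) (s t : ℝ) :
    IntervalIntegrable (fun τ ↦
      (Ioc ((k : ℝ) / N) (k / N + 1 / N)).indicator (fun _ ↦ (1 : ℝ)) τ • c) volume s t :=
  (((integrable_indicator_iff measurableSet_Ioc).2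
    (integrableOn_const measure_Ioc_lt_top.ne)).smul_const c).intervalIntegrable

lemma sum_cellTime_smul [CompleteSpace E] (N : ℕ) (f : ℕ → E) (s t : ℝ) :
    ∑ k ∈ Finset.range N, (cellTime N k t - cellTime N k s) • f k =
      ∫ τ in s..t, ∑ k ∈ Finset.range N,
        (Ioc ((k : ℝ) / N) (k / N + 1 / N)).indicator (fun _ ↦ (1 : ℝ)) τ • f k := by
  rw [intervalIntegral.integral_finsetSum fun k _ ↦ intervalIntegrable_indicator_cell N k (f k) s t]
  refine Finset.sum_congr rfl fun k _ ↦ ?_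
  rw [intervalIntegral.integral_smul_const, integral_indicator_cell]

/-- Continuous solutions on `[0, 1]` of the equation `Z' = b (Z, τ)` with `Z 0 = z`. -/
def IsODESolution (b : E → ℝ → E) (z : E) (Z : ℝ → E) : Prop :=
  ContinuousOn Z (Icc 0 1) ∧ Z 0 = z ∧ ∀ τ ∈ Ioo (0 : ℝ) 1, HasDerivAt Z (b (Z τ) τ) τ

variable {b : E → ℝ → E}

lemma continuousAt_field {E : Type*} [NormedAddCommGroup E] {b : E → ℝ → E}
    (hb : ContinuousOn (fun p : E × ℝ ↦ b p.1 p.2) (univ ×ˢ Ioo 0 1))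
    {p : E × ℝ} (hp : p.2 ∈ Ioo (0 : ℝ) 1) : ContinuousAt (fun p : E × ℝ ↦ b p.1 p.2) p :=
  hb.continuousAt ((isOpen_univ.prod isOpen_Ioo).mem_nhds ⟨mem_univ _, hp⟩)

/-- A Riemann sum with left endpoints, along paths that themselves vary. It converges because the
field is uniformly continuous near the compact graph of the limit over [s, t], which stays away from
the times 0 and 1. -/
lemma tendsto_sum_cellTime_smul [CompleteSpace E]
    (hb : ContinuousOn (fun p : E × ℝ ↦ b p.1 p.2) (univ ×ˢ Ioo 0 1))
    {N : ℕ → ℕ} (hN : Tendsto N atTop atTop) {y : ℕ → ℝ → E} {Y : ℝ → E} (hY : Continuous Y)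
    (hyY : TendstoUniformlyOn y Y atTop (Icc 0 1)) {s t : ℝ} (hs : s ∈ Ioo (0 : ℝ) 1)
    (ht : t ∈ Ioo (0 : ℝ) 1) :
    Tendsto (fun n ↦ ∑ k ∈ Finset.range (N n), (cellTime (N n) k t - cellTime (N n) k s) •
      b (y n (k / N n)) (k / N n)) atTop (𝓝 (∫ τ in s..t, b (Y τ) τ)) := by
  have hsub : uIcc s t ⊆ Ioo 0 1 := fun τ hτ ↦
    ⟨(lt_min hs.1 ht.1).trans_le hτ.1, hτ.2.trans_lt (max_lt hs.2 ht.2)⟩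
  have hcont : ContinuousOn (fun τ ↦ b (Y τ) τ) (uIcc s t) := fun τ hτ ↦
    ((continuousAt_field hb (p := (Y τ, τ)) (hsub hτ)).comp
      (f := fun τ ↦ (Y τ, τ)) (hY.prodMk continuous_id).continuousAt).continuousWithinAt
  rw [Metric.tendsto_atTop']
  intro ε hε
  set η : ℝ := ε / (|t - s| + 1) with hη
  have hηpos : 0 < η := by positivity
  have hK : IsCompact ((fun τ ↦ (Y τ, τ)) '' uIcc s t) :=
    isCompact_uIcc.image (hY.prodMk continuous_id)
  have hunif := hK.uniformContinuousAt_of_continuousAt (fun p : E × ℝ ↦ b p.1 p.2)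
    (r := {q | dist q.1 q.2 < η}) (by
      rintro _ ⟨τ, hτ, rfl⟩
      exact continuousAt_field hb (hsub hτ)) (Metric.dist_mem_uniformity hηpos)
  obtain ⟨δ, hδ, hδ'⟩ := Metric.mem_uniformity_dist.1 hunif
  obtain ⟨δ₁, hδ₁, hYu⟩ := Metric.uniformContinuousOn_iff.1
    (isCompact_Icc.uniformContinuousOn_of_continuous hY.continuousOn : UniformContinuousOn Y (Icc 0 1))
    (δ / 2) (by positivity)
  have hNt : Tendsto (fun n ↦ 1 / (N n : ℝ)) atTop (𝓝 0) :=
    tendsto_one_div_atTop_nhds_zero_nat.comp hN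
  have h1 := hNt.eventually (gt_mem_nhds (lt_min hδ hδ₁))
  have h2 := Metric.tendstoUniformlyOn_iff.1 hyY (δ / 2) (by positivity)
  have h3 := hN.eventually (eventually_ne_atTop 0)
  obtain ⟨n₀, hn₀⟩ := eventually_atTop.1 (h1.and (h2.and h3))
  refine ⟨n₀, fun n hn ↦ ?_⟩
  obtain ⟨hN1, hyY', hN0⟩ := hn₀ n hn.le
  have hN' : (0 : ℝ) < N n := by positivity
  rw [sum_cellTime_smul, dist_eq_norm, ← intervalIntegral.integral_sub _ hcont.intervalIntegrable]
  · have hbound : ∀ τ ∈ uIoc s t, ‖(∑ k ∈ Finset.range (N n),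
        (Ioc ((k : ℝ) / N n) (k / N n + 1 / N n)).indicator (fun _ ↦ (1 : ℝ)) τ •
          b (y n (k / N n)) (k / N n)) - b (Y τ) τ‖ ≤ η := by
      intro τ hτ
      have hτ' := hsub (uIoc_subset_uIcc hτ)
      obtain ⟨k, hk, hkτ, hsum⟩ := exists_cell (E := E) hN0 (τ := τ) ⟨hτ'.1, hτ'.2.le⟩
      rw [hsum fun k ↦ b (y n (k / N n)) (k / N n)]
      have hkmem : (k / N n : ℝ) ∈ Icc (0 : ℝ) 1 :=
        ⟨by positivity, hkτ.1.le.trans hτ'.2.le⟩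
      have hd : dist τ (k / N n : ℝ) < min δ δ₁ := by
        rw [Real.dist_eq, abs_of_pos (sub_pos.2 hkτ.1)]
        linarith only [hkτ.2, hN1]
      have hd1 : dist (Y τ) (y n (k / N n)) < δ := by
        have e1 := hYu τ ⟨hτ'.1.le, hτ'.2.le⟩ _ hkmem (hd.trans_le (min_le_right _ _))
        have e2 := hyY' _ hkmem
        exact (dist_triangle _ _ _).trans_lt (by linarith only [e1, e2])
      have := @hδ' (Y τ, τ) (y n (k / N n), (k / N n : ℝ))
        (max_lt hd1 (hd.trans_le (min_le_left _ _))) ⟨τ, uIoc_subset_uIcc hτ, rfl⟩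
      rw [← dist_eq_norm, dist_comm]
      exact (show dist _ _ < η from this).le
    refine (intervalIntegral.norm_integral_le_of_norm_le_const hbound).trans_lt ?_
    rw [hη, div_mul_eq_mul_div, div_lt_iff₀ (by positivity)]
    rw [mul_add, mul_one]
    exact lt_add_of_pos_right _ hε
  · have := IntervalIntegrable.sum (Finset.range (N n)) fun k _ ↦
      intervalIntegrable_indicator_cell (N n) k (b (y n (k / N n)) (k / N n)) s t
    simpa only [Finset.sum_fn] using this

/-- Both sides of the integral equation are continuous in time, so countably many times suffice. The
base time is 1/2 because the field is controlled only on the open interval and need not be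
integrable up to an endpoint. -/
lemma isODESolution_of_integral [CompleteSpace E]
    (hb : ContinuousOn (fun p : E × ℝ ↦ b p.1 p.2) (univ ×ˢ Ioo 0 1)) {Y : ℝ → E}
    (hY : Continuous Y) {q : ℕ → ℝ}
    (hqd : Ioo (0 : ℝ) 1 ⊆ closure (range q))
    (h : ∀ i, Y (q i) - Y (1 / 2) = ∫ τ in (1 / 2 : ℝ)..q i, b (Y τ) τ) :
    IsODESolution b (Y 0) Y := by
  have hg : ContinuousOn (fun τ ↦ b (Y τ) τ) (Ioo 0 1) := fun τ hτ ↦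
    ((continuousAt_field hb (p := (Y τ, τ)) hτ).comp
      (f := fun τ ↦ (Y τ, τ)) (hY.prodMk continuous_id).continuousAt).continuousWithinAt
  have hderiv : ∀ t ∈ Ioo (0 : ℝ) 1,
      HasDerivAt (fun t ↦ ∫ τ in (1 / 2 : ℝ)..t, b (Y τ) τ) (b (Y t) t) t := by
    intro t ht
    have hsub : uIcc (1 / 2 : ℝ) t ⊆ Ioo 0 1 := fun τ hτ ↦
      ⟨(lt_min (by norm_num) ht.1).trans_le hτ.1, hτ.2.trans_lt (max_lt (by norm_num) ht.2)⟩
    exact intervalIntegral.integral_hasDerivAt_right (hg.mono hsub).intervalIntegrable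
      (hg.stronglyMeasurableAtFilter isOpen_Ioo t ht) (hg.continuousAt (isOpen_Ioo.mem_nhds ht))
  have heq : ∀ t ∈ Ioo (0 : ℝ) 1, Y t - Y (1 / 2) = ∫ τ in (1 / 2 : ℝ)..t, b (Y τ) τ := by
    have hcl : EqOn (fun t ↦ Y t - Y (1 / 2)) (fun t ↦ ∫ τ in (1 / 2 : ℝ)..t, b (Y τ) τ)
        (Ioo 0 1 ∩ closure (range q)) := by
      intro t ht
      have hd : Tendsto (fun t ↦ (Y t - Y (1 / 2)) - ∫ τ in (1 / 2 : ℝ)..t, b (Y τ) τ)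
          (𝓝[range q] t) (𝓝 ((Y t - Y (1 / 2)) - ∫ τ in (1 / 2 : ℝ)..t, b (Y τ) τ)) :=
        (((hY.sub continuous_const).continuousAt).sub
          (hderiv t ht.1).continuousAt).continuousWithinAt
      have : (𝓝[range q] t).NeBot := mem_closure_iff_nhdsWithin_neBot.1 ht.2
      have h0 : Tendsto (fun t ↦ (Y t - Y (1 / 2)) - ∫ τ in (1 / 2 : ℝ)..t, b (Y τ) τ)
          (𝓝[range q] t) (𝓝 0) := by
        refine tendsto_const_nhds.congr' ?_
        filter_upwards [self_mem_nhdsWithin] with s hs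
        obtain ⟨i, rfl⟩ := hs
        rw [h i, sub_self]
      exact sub_eq_zero.1 (tendsto_nhds_unique hd h0)
    exact fun t ht ↦ hcl ⟨ht, hqd ht⟩
  refine ⟨hY.continuousOn, rfl, fun t ht ↦ ?_⟩
  have := (hderiv t ht).add_const (Y (1 / 2))
  refine this.congr_of_eventuallyEq ?_
  filter_upwards [isOpen_Ioo.mem_nhds ht] with s hs
  rw [← heq s hs]; abel

/-- The chain with velocities `V` has bounded energy and small defects at the first `n` times. -/
def IsApproxChain (b : E → ℝ → E) (q : ℕ → ℝ) (K : ℝ) (N n : ℕ) (z : E) (V : ℕ → E) : Prop :=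
  ∑ k ∈ Finset.range N, ‖V k‖ ^ 2 < N * K ^ 2 ∧
    ∀ i < n, 1 / (N : ℝ) ≤ q i → ‖chainDefect b N z V (q i)‖ < 1 / (n + 1)

/-- An increment of the path is the defect plus a Riemann sum of the field. The defect vanishes at
each fixed q i, which is eventually among the first n times and beyond the first cell. -/
lemma isODESolution_of_tendsto_chainPath [CompleteSpace E]
    (hb : ContinuousOn (fun p : E × ℝ ↦ b p.1 p.2) (univ ×ˢ Ioo 0 1)) {q : ℕ → ℝ}
    (hq : ∀ i, q i ∈ Ioo (0 : ℝ) 1) (hqd : Ioo (0 : ℝ) 1 ⊆ closure (range q))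
    {N n : ℕ → ℕ} (hN : Tendsto N atTop atTop) (hn : Tendsto n atTop atTop) {z : E} {K : ℝ}
    {V : ℕ → ℕ → E} (hV : ∀ j, IsApproxChain b q K (N j) (n j) z (V j)) {Y : ℝ → E}
    (hY : Continuous Y)
    (hlim : TendstoUniformlyOn (fun j ↦ chainPath (N j) z (V j)) Y atTop (Icc 0 1)) :
    IsODESolution b z Y := by
  have hpt : ∀ t ∈ Icc (0 : ℝ) 1, Tendsto (fun j ↦ chainPath (N j) z (V j) t) atTop (𝓝 (Y t)) :=
    fun t ht ↦ hlim.tendsto_at ht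
  have hY0 : Y 0 = z := by
    refine tendsto_nhds_unique (hpt 0 (by simp)) ?_
    simp only [chainPath_zero, tendsto_const_nhds]
  rw [← hY0]
  refine isODESolution_of_integral hb hY hqd fun i ↦ ?_
  have hhalf : (1 / 2 : ℝ) ∈ Ioo (0 : ℝ) 1 := by norm_num
  have h1 := (hpt _ ⟨(hq i).1.le, (hq i).2.le⟩).sub (hpt _ ⟨hhalf.1.le, hhalf.2.le⟩)
  have h2 := tendsto_sum_cellTime_smul hb hN hY hlim hhalf (hq i)
  have h3 : Tendsto (fun j ↦ chainDefect b (N j) z (V j) (q i)) atTop (𝓝 0) := by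
    refine squeeze_zero_norm' (a := fun j ↦ 1 / ((n j : ℝ) + 1)) ?_
      (tendsto_one_div_add_atTop_nhds_zero_nat.comp hn)
    have hNt : Tendsto (fun n ↦ 1 / (N n : ℝ)) atTop (𝓝 0) :=
      tendsto_one_div_atTop_nhds_zero_nat.comp hN
    filter_upwards [hn.eventually (eventually_gt_atTop i),
      hNt.eventually (gt_mem_nhds (hq i).1)] with j hj hj'
    exact ((hV j).2 i hj hj'.le).le
  refine tendsto_nhds_unique h1 ?_
  have h4 := h3.add h2
  rw [zero_add] at h4
  refine h4.congr fun j ↦ ?_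
  rw [chainPath_sub, chainDefect, ← Finset.sum_add_distrib]
  refine Finset.sum_congr rfl fun k hk ↦ ?_
  rw [chainPath_node (Finset.mem_range.1 hk).le, ← smul_add, sub_add_cancel]

/-- Compactness argument: chains ending far from z₁ for arbitrarily large n would have a uniformly
convergent subsequence, whose limit is an ODE solution not ending at z₁. The statement is
deterministic and uniform in the velocities. -/
theorem chainPos_terminal_close [FiniteDimensional ℝ E]
    (hb : ContinuousOn (fun p : E × ℝ ↦ b p.1 p.2) (univ ×ˢ Ioo 0 1)) {q : ℕ → ℝ}
    (hq : ∀ i, q i ∈ Ioo (0 : ℝ) 1) (hqd : Ioo (0 : ℝ) 1 ⊆ closure (range q))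
    {N : ℕ → ℕ} (hN : Tendsto N atTop atTop) (hN0 : ∀ n, N n ≠ 0) {z z₁ : E}
    (h : ∀ Z, IsODESolution b z Z → Z 1 = z₁) {K : ℝ} (hK : 0 ≤ K) {ε : ℝ} (hε : 0 < ε) :
    ∃ n₀, ∀ n ≥ n₀, ∀ V : ℕ → E, IsApproxChain b q K (N n) n z V →
      ‖chainPos (N n) z V (N n) - z₁‖ < ε := by
  have := FiniteDimensional.complete ℝ E
  have := FiniteDimensional.proper ℝ E
  by_contra! hcon
  choose n hn V hV hfar using hcon
  have hnt : Tendsto n atTop atTop := tendsto_atTop_mono hn tendsto_id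
  let f : ℕ → BoundedContinuousFunction (Icc (0 : ℝ) 1) E := fun j ↦
    BoundedContinuousFunction.mkOfCompact
      ⟨fun t ↦ chainPath (N (n j)) z (V j) t,
        (continuous_chainPath _ _ _).comp continuous_subtype_val⟩
  have hholder : ∀ j (s t : Icc (0 : ℝ) 1), ‖f j t - f j s‖ ≤ K * √|(t : ℝ) - s| :=
    fun j s t ↦ norm_chainPath_sub_le (hN0 _) hK (hV j).1.le s.2 t.2
  -- Arzelà–Ascoli: the common Hölder bound gives equicontinuity and, all paths starting at z,
  -- confines them to the ball of radius K.
  have hcomp : IsCompact (closure (range f)) := by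
    refine BoundedContinuousFunction.arzela_ascoli (Metric.closedBall z K)
      (isCompact_closedBall z K) (range f) ?_ ?_
    · rintro _ t ⟨j, rfl⟩
      have h0 : f j ⟨0, by simp⟩ = z := chainPath_zero _ _ _
      have := hholder j ⟨0, by simp⟩ t
      rw [h0] at this
      rw [mem_closedBall_iff_norm]
      refine this.trans (mul_le_of_le_one_right hK ?_)
      rw [sub_zero, abs_of_nonneg t.2.1]
      exact Real.sqrt_le_one.2 t.2.2
    · refine fun t₀ ↦ Metric.equicontinuousAt_iff_pair.2 fun η hη ↦ ?_
      have hc : Tendsto (fun p : Icc (0 : ℝ) 1 × Icc (0 : ℝ) 1 ↦ K * √|(p.2 : ℝ) - p.1|)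
          (𝓝 (t₀, t₀)) (𝓝 0) := by
        have : Continuous (fun p : Icc (0 : ℝ) 1 × Icc (0 : ℝ) 1 ↦ K * √|(p.2 : ℝ) - p.1|) := by
          fun_prop
        simpa using this.tendsto (t₀, t₀)
      have := hc.eventually (gt_mem_nhds hη)
      rw [nhds_prod_eq, eventually_prod_self_iff'] at this
      obtain ⟨U, hU, hU'⟩ := this
      refine ⟨U, hU, fun x hx x' hx' i ↦ ?_⟩
      obtain ⟨_, j, rfl⟩ := i
      rw [dist_comm, dist_eq_norm]
      exact (hholder j x x').trans_lt (hU' x hx x' hx')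
  obtain ⟨F, -, φ, hφ, hF⟩ := hcomp.tendsto_subseq (x := f) fun j ↦ subset_closure ⟨j, rfl⟩
  set Y : ℝ → E := IccExtend (zero_le_one' ℝ) F
  have hYc : Continuous Y := F.continuous.Icc_extend'
  have hlim : TendstoUniformlyOn (fun j ↦ chainPath (N (n (φ j))) z (V (φ j))) Y atTop
      (Icc 0 1) := by
    rw [Metric.tendstoUniformlyOn_iff]
    intro η hη
    filter_upwards [Metric.tendsto_atTop'.1 hF η hη |>.elim fun n₀ h ↦
      eventually_atTop.2 ⟨n₀ + 1, fun n hn ↦ h n hn⟩] with j hj t ht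
    rw [show Y t = F ⟨t, ht⟩ from IccExtend_of_mem _ _ ht, dist_comm]
    exact (BoundedContinuousFunction.dist_coe_le_dist (f := f (φ j)) ⟨t, ht⟩).trans_lt hj
  have hsol := isODESolution_of_tendsto_chainPath hb hq hqd
    ((hN.comp hnt).comp hφ.tendsto_atTop) (hnt.comp hφ.tendsto_atTop)
    (fun j ↦ hV (φ j)) hYc hlim
  have h1 : Tendsto (fun j ↦ chainPath (N (n (φ j))) z (V (φ j)) 1) atTop (𝓝 (Y 1)) :=
    hlim.tendsto_at (by simp)
  rw [h Y hsol, tendsto_iff_norm_sub_tendsto_zero] at h1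
  obtain ⟨j, hj⟩ := (h1.eventually (gt_mem_nhds hε)).exists
  have hnode := chainPath_node (le_refl (N (n (φ j)))) z (V (φ j))
  rw [div_self (by exact_mod_cast hN0 _)] at hnode
  rw [hnode] at hj
  exact absurd (hfar (φ j)) (not_le.2 hj)

end Path

/-! ### The Markov chain of conditional velocities. -/

lemma ofReal_sq_eq_enorm_sq (w : ℝ) : ENNReal.ofReal (w ^ 2) = ‖w‖ₑ ^ 2 := by
  rw [← sq_abs, ENNReal.ofReal_pow (abs_nonneg w), ← Real.enorm_eq_ofReal_abs]

/-- One martingale step: the cross term has mean zero, and the variance is at most the second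
moment. -/
lemma lintegral_enorm_sq_add_smul_sub_mean_le {E : Type*} [NormedAddCommGroup E]
    [InnerProductSpace ℝ E] [CompleteSpace E] [MeasurableSpace E] [BorelSpace E]
    [SecondCountableTopology E] (κ : Measure E) [IsProbabilityMeasure κ] (a : E) (w : ℝ) :
    ∫⁻ v, ‖a + w • (v - ∫ v', v' ∂κ)‖ₑ ^ 2 ∂κ ≤
      ‖a‖ₑ ^ 2 + ‖w‖ₑ ^ 2 * ∫⁻ v, ‖v‖ₑ ^ 2 ∂κ := by
  rcases eq_or_ne w 0 with rfl | hw
  · simp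
  -- Without a second moment the right-hand side is infinite, so no integrability need be assumed.
  rcases eq_or_ne (∫⁻ v, ‖v‖ₑ ^ 2 ∂κ) ∞ with htop | hfin
  · rw [htop, ENNReal.mul_top (by simpa using hw)]; simp
  have hL2 : MemLp (fun v : E ↦ v) 2 κ := by
    refine ⟨by fun_prop, ?_⟩
    rw [eLpNorm_lt_top_iff_lintegral_rpow_enorm_lt_top (by norm_num) (by norm_num)]
    simpa using hfin.lt_top
  have hL1 : Integrable (fun v : E ↦ v) κ := hL2.integrable (by norm_num)
  set c := ∫ v', v' ∂κ with hc
  have hsq : Integrable (fun v : E ↦ ‖v‖ ^ 2) κ := hL2.integrable_norm_pow (by norm_num)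
  have hexp : ∀ v : E, ‖a + w • (v - c)‖ ^ 2 =
      (‖a‖ ^ 2 - 2 * w * inner ℝ a c + w ^ 2 * ‖c‖ ^ 2) +
        inner ℝ ((2 * w) • a - (2 * w ^ 2) • c) v + w ^ 2 * ‖v‖ ^ 2 := by
    intro v
    rw [norm_add_sq_real, norm_smul, mul_pow, norm_sub_sq_real, inner_smul_right, inner_sub_right,
      inner_sub_left, real_inner_smul_left, real_inner_smul_left, real_inner_comm c v,
      Real.norm_eq_abs, sq_abs]
    ring
  have hint2 : Integrable (fun v : E ↦ inner ℝ ((2 * w) • a - (2 * w ^ 2) • c) v) κ :=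
    hL1.const_inner _
  have hI : Integrable (fun v : E ↦ ‖a + w • (v - c)‖ ^ 2) κ := by
    simp_rw [hexp]
    exact ((integrable_const _).add hint2).add (hsq.const_mul _)
  have hval : ∫ v, ‖a + w • (v - c)‖ ^ 2 ∂κ ≤ ‖a‖ ^ 2 + w ^ 2 * ∫ v, ‖v‖ ^ 2 ∂κ := by
    simp_rw [hexp]
    rw [integral_add (f := fun v ↦ (‖a‖ ^ 2 - 2 * w * inner ℝ a c + w ^ 2 * ‖c‖ ^ 2) +
        inner ℝ ((2 * w) • a - (2 * w ^ 2) • c) v)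
        ((integrable_const _).add hint2) (hsq.const_mul _),
      integral_add (integrable_const _) hint2, integral_const_mul, integral_inner hL1, ← hc,
      inner_sub_left, real_inner_smul_left, real_inner_smul_left, real_inner_self_eq_norm_sq]
    simp
    nlinarith [mul_nonneg (sq_nonneg w) (sq_nonneg ‖c‖)]
  have henorm : ∀ x : E, ‖x‖ₑ ^ 2 = ENNReal.ofReal (‖x‖ ^ 2) := fun x ↦ by
    rw [ENNReal.ofReal_pow (norm_nonneg x), ofReal_norm]
  simp_rw [henorm]
  rw [← ofReal_integral_eq_lintegral_ofReal hI (ae_of_all _ fun _ ↦ by positivity),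
    ← ofReal_integral_eq_lintegral_ofReal hsq (ae_of_all _ fun _ ↦ by positivity),
    ← ofReal_sq_eq_enorm_sq, ← ENNReal.ofReal_mul (by positivity),
    ← ENNReal.ofReal_add (by positivity) (by positivity)]
  exact ENNReal.ofReal_le_ofReal hval

section Chain

variable {d : ℕ}

/-- The point at time `t` of the segment between the two components. -/
noncomputable def interp (t : ℝ) (p : Vec d × Vec d) : Vec d := (1 - t) • p.1 + t • p.2

@[fun_prop]
lemma continuous_interp (t : ℝ) : Continuous (interp (d := d) t) := by
  unfold interp; fun_prop

lemma measurable_interp (t : ℝ) : Measurable (interp (d := d) t) :=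
  (continuous_interp t).measurable

/-- The conditional law of the velocity given the position at time `t`. -/
noncomputable def velocityKernel (μ ν : Measure (Vec d)) [IsProbabilityMeasure μ]
    [IsProbabilityMeasure ν] (t : ℝ) : Kernel (Vec d) (Vec d) :=
  condDistrib (fun p : Vec d × Vec d ↦ p.2 - p.1) (interp t) (μ.prod ν)

instance (μ ν : Measure (Vec d)) [IsProbabilityMeasure μ] [IsProbabilityMeasure ν] (t : ℝ) :
    IsMarkovKernel (velocityKernel μ ν t) := by
  unfold velocityKernel; infer_instance

variable {B : Type*} [MeasurableSpace B]

lemma measurable_chainPos {z₀ : B → Vec d} (hz : Measurable z₀) (N k : ℕ) :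
    Measurable fun ω : B × (ℕ → Vec d) ↦ chainPos N (z₀ ω.1) ω.2 k := by
  unfold chainPos
  refine (hz.comp measurable_fst).add (Finset.measurable_fun_sum _ fun j _ ↦ ?_)
  exact ((measurable_pi_apply j).comp measurable_snd).const_smul (1 / N : ℝ)

lemma measurable_update_chain (k : ℕ) :
    Measurable fun r : (B × (ℕ → Vec d)) × Vec d ↦ (r.1.1, Function.update r.1.2 k r.2) := by
  refine (measurable_fst.comp measurable_fst).prodMk (measurable_pi_iff.2 fun j ↦ ?_)
  rcases eq_or_ne j k with rfl | h
  · simpa using measurable_snd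
  · simp only [Function.update_of_ne h]
    exact (measurable_pi_apply j).comp (measurable_snd.comp measurable_fst)

/-- The law, after `k` steps of length `1 / N`, of the Markov chain whose velocities are drawn from
the conditional law given the current position. -/
noncomputable def chainLaw (μ ν : Measure (Vec d)) [IsProbabilityMeasure μ]
    [IsProbabilityMeasure ν] (Γ : Measure B) {z₀ : B → Vec d} (hz : Measurable z₀) (N : ℕ) :
    ℕ → Measure (B × (ℕ → Vec d))
  | 0 => Γ.map fun x ↦ (x, 0)
  | k + 1 => ((chainLaw μ ν Γ hz N k) ⊗ₘ
      ((velocityKernel μ ν (k / N)).comap _ (measurable_chainPos hz N k))).map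
        fun r ↦ (r.1.1, Function.update r.1.2 k r.2)

lemma chainPos_congr {N k : ℕ} {z : Vec d} {V V' : ℕ → Vec d} (h : ∀ j < k, V j = V' j) :
    chainPos N z V k = chainPos N z V' k := by
  unfold chainPos
  congr 1
  exact Finset.sum_congr rfl fun j hj ↦ by rw [h j (Finset.mem_range.1 hj)]

variable (μ ν : Measure (Vec d)) [IsProbabilityMeasure μ] [IsProbabilityMeasure ν]
  (Γ : Measure B) [IsProbabilityMeasure Γ] {z₀ : B → Vec d} (hz : Measurable z₀) (N : ℕ)

instance (k : ℕ) : IsProbabilityMeasure (chainLaw μ ν Γ hz N k) := by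
  induction k with
  | zero => exact Measure.isProbabilityMeasure_map (by fun_prop)
  | succ k ih => exact Measure.isProbabilityMeasure_map (measurable_update_chain k).aemeasurable

lemma lintegral_chainLaw_succ (k : ℕ) {F : B × (ℕ → Vec d) → ℝ≥0∞} (hF : Measurable F) :
    ∫⁻ ω, F ω ∂chainLaw μ ν Γ hz N (k + 1) =
      ∫⁻ ω, ∫⁻ v, F (ω.1, Function.update ω.2 k v)
        ∂velocityKernel μ ν (k / N) (chainPos N (z₀ ω.1) ω.2 k) ∂chainLaw μ ν Γ hz N k := by
  rw [chainLaw, lintegral_map hF (measurable_update_chain k),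
    Measure.lintegral_compProd
      (f := fun r : (B × (ℕ → Vec d)) × Vec d ↦ F (r.1.1, Function.update r.1.2 k r.2))
      (hF.comp (measurable_update_chain k))]
  rfl

lemma chainLaw_map_fst (k : ℕ) : (chainLaw μ ν Γ hz N k).map Prod.fst = Γ := by
  induction k with
  | zero =>
    rw [chainLaw, Measure.map_map measurable_fst (by fun_prop)]
    exact Measure.map_id
  | succ k ih =>
    refine Measure.ext_of_lintegral _ fun f hf ↦ ?_
    rw [lintegral_map hf measurable_fst, lintegral_chainLaw_succ _ _ _ _ _ _ (by fun_prop)]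
    simp only [lintegral_const, measure_univ, mul_one]
    rw [← lintegral_map hf measurable_fst, ih]

lemma lintegral_velocityKernel (t : ℝ) {f : Vec d × Vec d → ℝ≥0∞} (hf : Measurable f) :
    ∫⁻ y, ∫⁻ v, f (y, v) ∂velocityKernel μ ν t y ∂(μ.prod ν).map (interp t) =
      ∫⁻ p, f (interp t p, p.2 - p.1) ∂μ.prod ν := by
  rw [← Measure.lintegral_compProd hf, velocityKernel, compProd_map_condDistrib (by fun_prop),
    lintegral_map hf (by fun_prop)]

variable {Γ}

/-- The key exactness: one step sends (X_t, X₁ - X₀) to X_t + (X₁ - X₀)/N = X_{t+1/N}, so the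
marginals agree with those of the interpolation without discretization error. -/
lemma chainLaw_map_chainPos (hΓ : Γ.map z₀ = μ) (k : ℕ) :
    (chainLaw μ ν Γ hz N k).map (fun ω ↦ chainPos N (z₀ ω.1) ω.2 k) =
      (μ.prod ν).map (interp (k / N)) := by
  induction k with
  | zero =>
    rw [chainLaw, Measure.map_map (measurable_chainPos hz N 0) (by fun_prop)]
    have h1 : (fun ω : B × (ℕ → Vec d) ↦ chainPos N (z₀ ω.1) ω.2 0) ∘ (fun x ↦ (x, 0)) = z₀ := by
      ext; simp [chainPos]
    have h2 : interp (d := d) ((0 : ℕ) / N : ℝ) = Prod.fst := by ext; simp [interp]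
    rw [h1, h2, hΓ, Measure.map_fst_prod]; simp
  | succ k ih =>
    refine Measure.ext_of_lintegral _ fun f hf ↦ ?_
    rw [lintegral_map hf (measurable_chainPos hz N (k + 1)),
      lintegral_chainLaw_succ _ _ _ _ _ _
        (F := fun ω ↦ f (chainPos N (z₀ ω.1) ω.2 (k + 1)))
        (hf.comp (measurable_chainPos hz N (k + 1))),
      lintegral_map hf (measurable_interp _)]
    have h1 : ∀ (ω : B × (ℕ → Vec d)) (v : Vec d),
        chainPos N (z₀ ω.1) (Function.update ω.2 k v) (k + 1) =
          chainPos N (z₀ ω.1) ω.2 k + (1 / N : ℝ) • v := by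
      intro ω v
      rw [chainPos, Finset.sum_range_succ, ← add_assoc, Function.update_self]
      congr 1
      exact chainPos_congr fun j hj ↦ by rw [Function.update_of_ne hj.ne]
    simp only [h1]
    have hm : Measurable fun r : Vec d × Vec d ↦ f (r.1 + (1 / N : ℝ) • r.2) := by fun_prop
    have h2 := lintegral_map (μ := chainLaw μ ν Γ hz N k)
      (f := fun y ↦ ∫⁻ v, f (y + (1 / N : ℝ) • v) ∂velocityKernel μ ν (k / N) y)
      (hm.lintegral_kernel_prod_right') (measurable_chainPos hz N k)
    rw [← h2, ih, lintegral_velocityKernel μ ν (k / N) hm]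
    refine lintegral_congr fun p ↦ ?_
    congr 1
    simp only [interp]
    push_cast
    module

/-- By exactness of the marginals, each velocity has the law of X₁ - X₀. -/
lemma lintegral_enorm_velocity_sq (hΓ : Γ.map z₀ = μ) (k : ℕ) :
    ∫⁻ ω, ∫⁻ v, ‖v‖ₑ ^ 2 ∂velocityKernel μ ν (k / N) (chainPos N (z₀ ω.1) ω.2 k)
      ∂chainLaw μ ν Γ hz N k = ∫⁻ p, ‖p.2 - p.1‖ₑ ^ 2 ∂μ.prod ν := by
  have hm : Measurable fun r : Vec d × Vec d ↦ ‖r.2‖ₑ ^ 2 := by fun_prop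
  have h2 := lintegral_map (μ := chainLaw μ ν Γ hz N k)
    (f := fun y ↦ ∫⁻ v, ‖v‖ₑ ^ 2 ∂velocityKernel μ ν (k / N) y)
    (hm.lintegral_kernel_prod_right') (measurable_chainPos hz N k)
  rw [← h2, chainLaw_map_chainPos μ ν hz N hΓ, lintegral_velocityKernel μ ν (k / N) hm]

lemma lintegral_chainLaw_energy (hΓ : Γ.map z₀ = μ) (k : ℕ) :
    ∫⁻ ω, ∑ j ∈ Finset.range k, ‖ω.2 j‖ₑ ^ 2 ∂chainLaw μ ν Γ hz N k =
      k * ∫⁻ p, ‖p.2 - p.1‖ₑ ^ 2 ∂μ.prod ν := by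
  have hme : ∀ j, Measurable fun ω : B × (ℕ → Vec d) ↦ ‖ω.2 j‖ₑ ^ 2 := fun j ↦
    (((measurable_pi_apply j).comp measurable_snd).enorm).pow_const 2
  induction k with
  | zero => simp
  | succ k ih =>
    rw [lintegral_chainLaw_succ _ _ _ _ _ _ (Finset.measurable_fun_sum _ fun j _ ↦ hme j)]
    have h1 : ∀ (ω : B × (ℕ → Vec d)) (v : Vec d),
        ∑ j ∈ Finset.range (k + 1), ‖Function.update ω.2 k v j‖ₑ ^ 2 =
          ∑ j ∈ Finset.range k, ‖ω.2 j‖ₑ ^ 2 + ‖v‖ₑ ^ 2 := by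
      intro ω v
      rw [Finset.sum_range_succ, Function.update_self]
      congr 1
      exact Finset.sum_congr rfl fun j hj ↦ by
        rw [Function.update_of_ne (Finset.mem_range.1 hj).ne]
    simp only [h1]
    simp_rw [lintegral_add_left (measurable_const)]
    rw [lintegral_add_left (by simpa using Finset.measurable_fun_sum _ fun j _ ↦ hme j),
      lintegral_enorm_velocity_sq μ ν hz N hΓ]
    simp only [lintegral_const, measure_univ, mul_one]
    rw [ih]
    push_cast
    ring

/-- Orthogonality of martingale increments, by induction on the number of steps. The field is the
conditional mean only at interior times, hence the restriction to nonzero weights. -/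
lemma lintegral_chainLaw_defect_le (hΓ : Γ.map z₀ = μ) {b : Vec d → ℝ → Vec d} {w : ℕ → ℝ}
    (hbm : ∀ k, w k ≠ 0 → Measurable fun y ↦ b y (k / N))
    (hb : ∀ k, w k ≠ 0 → ∀ᵐ y ∂(μ.prod ν).map (interp (k / N)),
      ∫ v, v ∂velocityKernel μ ν (k / N) y = b y (k / N)) (k : ℕ) :
    ∫⁻ ω, ‖∑ j ∈ Finset.range k, w j • (ω.2 j - b (chainPos N (z₀ ω.1) ω.2 j) (j / N))‖ₑ ^ 2
      ∂chainLaw μ ν Γ hz N k ≤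
    (∑ j ∈ Finset.range k, ‖w j‖ₑ ^ 2) * ∫⁻ p, ‖p.2 - p.1‖ₑ ^ 2 ∂μ.prod ν := by
  have hterm : ∀ j, Measurable fun ω : B × (ℕ → Vec d) ↦
      w j • (ω.2 j - b (chainPos N (z₀ ω.1) ω.2 j) (j / N)) := by
    intro j
    rcases eq_or_ne (w j) 0 with h | h
    · simp only [h, zero_smul]; exact measurable_const
    · exact (((measurable_pi_apply j).comp measurable_snd).sub
        ((hbm j h).comp (measurable_chainPos hz N j))).const_smul (w j)
  have hsum : ∀ k, Measurable fun ω : B × (ℕ → Vec d) ↦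
      ‖∑ j ∈ Finset.range k, w j • (ω.2 j - b (chainPos N (z₀ ω.1) ω.2 j) (j / N))‖ₑ ^ 2 :=
    fun k ↦ ((Finset.measurable_fun_sum _ fun j _ ↦ hterm j).enorm).pow_const 2
  induction k with
  | zero => simp
  | succ k ih =>
    rw [lintegral_chainLaw_succ _ _ _ _ _ _ (hsum (k + 1))]
    have h1 : ∀ (ω : B × (ℕ → Vec d)) (v : Vec d),
        ∑ j ∈ Finset.range (k + 1), w j • (Function.update ω.2 k v j -
          b (chainPos N (z₀ ω.1) (Function.update ω.2 k v) j) (j / N)) =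
        ∑ j ∈ Finset.range k, w j • (ω.2 j - b (chainPos N (z₀ ω.1) ω.2 j) (j / N)) +
          w k • (v - b (chainPos N (z₀ ω.1) ω.2 k) (k / N)) := by
      intro ω v
      have hpos : ∀ j ≤ k, chainPos N (z₀ ω.1) (Function.update ω.2 k v) j =
          chainPos N (z₀ ω.1) ω.2 j := fun j hj ↦
        chainPos_congr fun i hi ↦ by rw [Function.update_of_ne (by omega)]
      rw [Finset.sum_range_succ, Function.update_self, hpos k le_rfl]
      congr 1
      refine Finset.sum_congr rfl fun j hj ↦ ?_
      have hj' := Finset.mem_range.1 hj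
      rw [Function.update_of_ne hj'.ne, hpos j hj'.le]
    simp only [h1]
    have hmean : ∀ᵐ ω ∂chainLaw μ ν Γ hz N k, w k ≠ 0 →
        ∫ v, v ∂velocityKernel μ ν (k / N) (chainPos N (z₀ ω.1) ω.2 k) =
          b (chainPos N (z₀ ω.1) ω.2 k) (k / N) := by
      rcases eq_or_ne (w k) 0 with h | h
      · exact ae_of_all _ fun ω h' ↦ absurd h h'
      · have := hb k h
        rw [← chainLaw_map_chainPos μ ν hz N hΓ] at this
        filter_upwards [ae_of_ae_map (measurable_chainPos hz N k).aemeasurable this] with ω hω _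
          using hω
    calc _ ≤ ∫⁻ ω, (‖∑ j ∈ Finset.range k,
              w j • (ω.2 j - b (chainPos N (z₀ ω.1) ω.2 j) (j / N))‖ₑ ^ 2 +
            ‖w k‖ₑ ^ 2 * ∫⁻ v, ‖v‖ₑ ^ 2
              ∂velocityKernel μ ν (k / N) (chainPos N (z₀ ω.1) ω.2 k))
            ∂chainLaw μ ν Γ hz N k := by
          refine lintegral_mono_ae ?_
          filter_upwards [hmean] with ω hω
          rcases eq_or_ne (w k) 0 with h | h
          · simp [h]
          · rw [← hω h]
            exact lintegral_enorm_sq_add_smul_sub_mean_le _ _ _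
      _ ≤ _ := by
          rw [lintegral_add_left (hsum k), lintegral_const_mul' _ _ (by simp),
            lintegral_enorm_velocity_sq μ ν hz N hΓ, Finset.sum_range_succ, add_mul]
          exact add_le_add_left ih _

end Chain

/-! ### From approximate chains to the law of the endpoint. -/

lemma eq_of_forall_isClosed_le {α : Type*} [MeasurableSpace α] [PseudoEMetricSpace α]
    [BorelSpace α] {μ ν : Measure α} [IsProbabilityMeasure μ] [IsProbabilityMeasure ν]
    (h : ∀ F, IsClosed F → μ F ≤ ν F) : μ = ν := by
  refine Measure.eq_of_le_of_isProbabilityMeasure (Measure.le_iff.2 fun s hs ↦ ?_)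
  rw [hs.measure_eq_iSup_isClosed_of_ne_top (measure_ne_top μ s)]
  exact iSup₂_le fun F hF ↦ iSup_le fun hFc ↦ (h F hFc).trans (measure_mono hF)

lemma exists_dense_seq_Ioo :
    ∃ q : ℕ → ℝ, (∀ i, q i ∈ Ioo (0 : ℝ) 1) ∧ Ioo (0 : ℝ) 1 ⊆ closure (range q) := by
  have : Nonempty (Ioo (0 : ℝ) 1) := ⟨⟨1 / 2, by norm_num⟩⟩
  obtain ⟨u, hu⟩ := TopologicalSpace.exists_dense_seq (Ioo (0 : ℝ) 1)
  refine ⟨fun i ↦ u i, fun i ↦ (u i).2, fun t ht ↦ ?_⟩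
  have h1 : (⟨t, ht⟩ : Ioo (0 : ℝ) 1) ∈ closure (range u) := hu _
  have h2 := image_closure_subset_closure_image continuous_subtype_val
    (mem_image_of_mem Subtype.val h1)
  rwa [← range_comp] at h2

lemma measure_le_norm_le {α E : Type*} [MeasurableSpace α] [NormedAddCommGroup E]
    (m : Measure α) {f : α → E} (hf : AEMeasurable (fun x ↦ ‖f x‖ₑ ^ 2) m) {δ : ℝ} (hδ : 0 < δ) :
    m {x | δ ≤ ‖f x‖} ≤ (∫⁻ x, ‖f x‖ₑ ^ 2 ∂m) / ENNReal.ofReal (δ ^ 2) := by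
  refine le_trans (measure_mono fun x hx ↦ ?_) (meas_ge_le_lintegral_div hf
    (ENNReal.ofReal_pos.2 (by positivity)).ne' ENNReal.ofReal_ne_top)
  rw [mem_ofPred_eq, ← ofReal_norm, ← ENNReal.ofReal_pow (norm_nonneg _)]
  exact ENNReal.ofReal_le_ofReal (by have : δ ≤ ‖f x‖ := hx; gcongr)

section Transport

variable {d : ℕ} {B : Type*} [MeasurableSpace B] {μ ν : Measure (Vec d)} [IsProbabilityMeasure μ]
  [IsProbabilityMeasure ν] {Γ : Measure B} [IsProbabilityMeasure Γ] {z₀ z₁ : B → Vec d}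
  {b : Vec d → ℝ → Vec d}

/-- The node of cell 0 is the time 0, where the field is not controlled. That cell drops out once s
and t both lie beyond it, its two occupation times then being equal. -/
lemma chainWeight_ne_zero {N k : ℕ} {s t : ℝ} (hs : s ∈ Ioo (0 : ℝ) 1) (ht : t ∈ Ioo (0 : ℝ) 1)
    (hNs : 1 / (N : ℝ) ≤ s) (hNt : 1 / (N : ℝ) ≤ t) (h : cellTime N k t - cellTime N k s ≠ 0) :
    (k / N : ℝ) ∈ Ioo (0 : ℝ) 1 := by
  have hk : k ≠ 0 := by
    rintro rfl
    rw [cellTime_zero_of_le hNs, cellTime_zero_of_le hNt, sub_self] at h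
    exact h rfl
  have hN : N ≠ 0 := by
    rintro rfl
    simp [cellTime] at h
  refine ⟨by positivity, ?_⟩
  by_contra! hle
  refine h ?_
  rw [cellTime, cellTime, max_eq_left, max_eq_left, sub_self]
  · exact (min_le_left _ _).trans (by linarith [hs.2])
  · exact (min_le_left _ _).trans (by linarith [ht.2])

lemma measurable_field (hb : ContinuousOn (fun p : Vec d × ℝ ↦ b p.1 p.2) (univ ×ˢ Ioo 0 1))
    {t : ℝ} (ht : t ∈ Ioo (0 : ℝ) 1) : Measurable fun y ↦ b y t :=
  (continuous_iff_continuousAt.2 fun y ↦ (continuousAt_field hb (p := (y, t)) ht).comp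
    (f := fun y ↦ (y, t)) (by fun_prop)).measurable

lemma measurable_chainDefect
    (hb : ContinuousOn (fun p : Vec d × ℝ ↦ b p.1 p.2) (univ ×ˢ Ioo 0 1)) (hz : Measurable z₀)
    {N : ℕ} {t : ℝ} (ht : t ∈ Ioo (0 : ℝ) 1) (hN : 1 / (N : ℝ) ≤ 1 / 2) (hNt : 1 / (N : ℝ) ≤ t) :
    Measurable fun ω : B × (ℕ → Vec d) ↦ chainDefect b N (z₀ ω.1) ω.2 t := by
  unfold chainDefect
  refine Finset.measurable_fun_sum _ fun k _ ↦ ?_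
  rcases eq_or_ne (cellTime N k t - cellTime N k (1 / 2)) 0 with h | h
  · simp only [h, zero_smul]; exact measurable_const
  · exact (((measurable_pi_apply k).comp measurable_snd).sub
      ((measurable_field hb (chainWeight_ne_zero (by norm_num) ht hN hNt h)).comp
        (measurable_chainPos hz N k))).const_smul (cellTime N k t - cellTime N k (1 / 2))

lemma measurableSet_isApproxChain
    (hb : ContinuousOn (fun p : Vec d × ℝ ↦ b p.1 p.2) (univ ×ˢ Ioo 0 1)) (hz : Measurable z₀)
    {q : ℕ → ℝ} (hq : ∀ i, q i ∈ Ioo (0 : ℝ) 1) (K : ℝ) {N : ℕ} (hN : 1 / (N : ℝ) ≤ 1 / 2) (n : ℕ) :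
    MeasurableSet {ω : B × (ℕ → Vec d) | IsApproxChain b q K N n (z₀ ω.1) ω.2} := by
  unfold IsApproxChain
  simp only [ofPred_and, ofPred_forall]
  refine MeasurableSet.inter (measurableSet_lt (Finset.measurable_fun_sum _ fun j _ ↦
    (((measurable_pi_apply j).comp measurable_snd).norm).pow_const 2) measurable_const) ?_
  refine MeasurableSet.iInter fun i ↦ MeasurableSet.iInter fun _ ↦ MeasurableSet.iInter fun hi ↦ ?_
  exact measurableSet_lt (measurable_chainDefect hb hz (hq i) hN hi).norm measurable_const

lemma chainLaw_energy_le (hz : Measurable z₀) (hΓ : Γ.map z₀ = μ) {N : ℕ} (hN : N ≠ 0) {K : ℝ}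
    (hK : 0 < K) :
    chainLaw μ ν Γ hz N N {ω | ¬ ∑ k ∈ Finset.range N, ‖ω.2 k‖ ^ 2 < N * K ^ 2} ≤
      (∫⁻ p, ‖p.2 - p.1‖ₑ ^ 2 ∂μ.prod ν) / ENNReal.ofReal (K ^ 2) := by
  have hN' : (0 : ℝ) < N := by positivity
  have hm : Measurable fun ω : B × (ℕ → Vec d) ↦ ∑ j ∈ Finset.range N, ‖ω.2 j‖ₑ ^ 2 :=
    Finset.measurable_fun_sum _ fun j _ ↦
      (((measurable_pi_apply j).comp measurable_snd).enorm).pow_const 2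
  have hε : ENNReal.ofReal (N * K ^ 2) ≠ 0 := (ENNReal.ofReal_pos.2 (by positivity)).ne'
  refine (measure_mono fun ω hω ↦ ?_).trans
    ((meas_ge_le_lintegral_div hm.aemeasurable hε ENNReal.ofReal_ne_top).trans_eq ?_)
  · rw [mem_ofPred_eq, not_lt] at hω
    rw [mem_ofPred_eq]
    have : ∑ j ∈ Finset.range N, ‖ω.2 j‖ₑ ^ 2 =
        ENNReal.ofReal (∑ j ∈ Finset.range N, ‖ω.2 j‖ ^ 2) := by
      rw [ENNReal.ofReal_sum_of_nonneg fun _ _ ↦ by positivity]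
      refine Finset.sum_congr rfl fun j _ ↦ ?_
      rw [ENNReal.ofReal_pow (norm_nonneg _), ofReal_norm]
    rw [this]
    exact ENNReal.ofReal_le_ofReal hω
  · rw [lintegral_chainLaw_energy μ ν hz N hΓ, ENNReal.ofReal_mul hN'.le, ENNReal.ofReal_natCast,
      ENNReal.mul_div_mul_left _ _ (by simpa using hN) (by simp)]

lemma sum_enorm_chainWeight_sq_le {N : ℕ} (hN : N ≠ 0) (s t : ℝ) :
    ∑ j ∈ Finset.range N, ‖cellTime N j t - cellTime N j s‖ₑ ^ 2 ≤ ENNReal.ofReal (1 / N) := by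
  have hN' : (0 : ℝ) < N := by positivity
  calc ∑ j ∈ Finset.range N, ‖cellTime N j t - cellTime N j s‖ₑ ^ 2
      ≤ ∑ j ∈ Finset.range N, ENNReal.ofReal ((1 / N) ^ 2) := by
        refine Finset.sum_le_sum fun j _ ↦ ?_
        rw [← ofReal_sq_eq_enorm_sq, ← sq_abs]
        exact ENNReal.ofReal_le_ofReal
          (pow_le_pow_left₀ (abs_nonneg _) (abs_cellTime_sub_le N j s t) 2)
    _ = ENNReal.ofReal (1 / N) := by
        rw [Finset.sum_const, Finset.card_range, nsmul_eq_mul, ← ENNReal.ofReal_natCast,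
          ← ENNReal.ofReal_mul hN'.le]
        congr 1
        field_simp

/-- Chebyshev's inequality: N squared weights, each at most 1/N², contribute 1/N. -/
lemma chainLaw_defect_le (hb : ContinuousOn (fun p : Vec d × ℝ ↦ b p.1 p.2) (univ ×ˢ Ioo 0 1))
    (hmean : ∀ t ∈ Ioo (0 : ℝ) 1, ∀ᵐ y ∂(μ.prod ν).map (interp t),
      ∫ v, v ∂velocityKernel μ ν t y = b y t)
    (hz : Measurable z₀) (hΓ : Γ.map z₀ = μ) {N : ℕ} (hN0 : N ≠ 0) (hN : 1 / (N : ℝ) ≤ 1 / 2) {t δ : ℝ}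
    (ht : t ∈ Ioo (0 : ℝ) 1) (hNt : 1 / (N : ℝ) ≤ t) (hδ : 0 < δ) :
    chainLaw μ ν Γ hz N N {ω | δ ≤ ‖chainDefect b N (z₀ ω.1) ω.2 t‖} ≤
      (∫⁻ p, ‖p.2 - p.1‖ₑ ^ 2 ∂μ.prod ν) * ENNReal.ofReal (1 / N / δ ^ 2) := by
  refine (measure_le_norm_le _
    ((measurable_chainDefect hb hz ht hN hNt).enorm.pow_const 2).aemeasurable hδ).trans ?_
  rw [ENNReal.ofReal_div_of_pos (by positivity), ← mul_div_assoc]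
  gcongr
  rw [mul_comm]
  have hw := fun k ↦ chainWeight_ne_zero (N := N) (k := k) (s := 1 / 2) (by norm_num) ht hN hNt
  refine (lintegral_chainLaw_defect_le μ ν hz N hΓ (fun k hk ↦ measurable_field hb (hw k hk))
    (fun k hk ↦ hmean _ (hw k hk)) N).trans ?_
  gcongr
  exact sum_enorm_chainWeight_sq_le hN0 _ _

/-- Only the first marginal is common to the measures. Disintegrating over it, the fibres of D n are
eventually empty whatever the n-th kernel is, and dominated convergence applies. -/
lemma tendsto_measure_of_forall_eventually_notMem {S : Type*} [MeasurableSpace S]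
    [StandardBorelSpace S] [Nonempty S] {m : ℕ → Measure (B × S)} [∀ n, IsFiniteMeasure (m n)]
    (hm : ∀ n, (m n).map Prod.fst = Γ) {D : ℕ → Set (B × S)} (hD : ∀ n, MeasurableSet (D n))
    (h : ∀ᵐ x ∂Γ, ∀ᶠ n in atTop, ∀ V, (x, V) ∉ D n) :
    Tendsto (fun n ↦ m n (D n)) atTop (𝓝 0) := by
  have hfst : ∀ n, (m n).fst = Γ := hm
  have hval : ∀ n, m n (D n) = ∫⁻ x, (m n).condKernel x (Prod.mk x ⁻¹' D n) ∂Γ := by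
    intro n
    conv_lhs => rw [← (m n).disintegrate (m n).condKernel]
    rw [Measure.compProd_apply (hD n), hfst]
  simp_rw [hval]
  have : ∫⁻ _ : B, (0 : ℝ≥0∞) ∂Γ = 0 := by simp
  rw [← this]
  refine tendsto_lintegral_of_dominated_convergence (fun _ ↦ 1)
    (fun n ↦ Kernel.measurable_kernel_prodMk_left (hD n)) (fun n ↦ ae_of_all _ fun x ↦ prob_le_one)
    (by simp) ?_
  filter_upwards [h] with x hx
  refine tendsto_const_nhds.congr' ?_
  filter_upwards [hx] with n hn
  have : Prod.mk x ⁻¹' D n = ∅ := eq_empty_of_forall_notMem hn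
  rw [this, measure_empty]

/-- The number of steps of the `n`-th chain. -/
def gridSize (n : ℕ) : ℕ := (n + 2) ^ 4

lemma gridSize_ne_zero (n : ℕ) : gridSize n ≠ 0 := by unfold gridSize; positivity

lemma le_gridSize (n : ℕ) : n + 2 ≤ gridSize n := Nat.le_self_pow (by norm_num) _

lemma one_div_gridSize_le (n : ℕ) : 1 / (gridSize n : ℝ) ≤ 1 / 2 := by
  have : (2 : ℝ) ≤ gridSize n := by exact_mod_cast (by have := le_gridSize n; omega)
  gcongr

lemma tendsto_gridSize : Tendsto gridSize atTop atTop :=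
  tendsto_atTop_mono (fun n ↦ (Nat.le_add_right n 2).trans (le_gridSize n)) tendsto_id

/-- The chain ends with law exactly ν and, outside an event of small probability, ends near z₁. So
ν(F) is at most the mass of a thickening of F under the law of z₁, plus errors that vanish as n → ∞
and then K → ∞; letting ε → 0 gives the inequality for closed F, which forces equality of
probability measures. -/
theorem map_terminal_eq (hC : ∫⁻ p, ‖p.2 - p.1‖ₑ ^ 2 ∂μ.prod ν ≠ ∞)
    (hb : ContinuousOn (fun p : Vec d × ℝ ↦ b p.1 p.2) (univ ×ˢ Ioo 0 1))
    (hmean : ∀ t ∈ Ioo (0 : ℝ) 1, ∀ᵐ y ∂(μ.prod ν).map (interp t),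
      ∫ v, v ∂velocityKernel μ ν t y = b y t)
    (hz₀ : Measurable z₀) (hz₁ : Measurable z₁) (hΓ : Γ.map z₀ = μ)
    {q : ℕ → ℝ} (hq : ∀ i, q i ∈ Ioo (0 : ℝ) 1)
    (hclose : ∀ ε > 0, ∀ K > 0, ∀ᵐ x ∂Γ, ∃ n₀, ∀ n ≥ n₀, ∀ V : ℕ → Vec d,
      IsApproxChain b q K (gridSize n) n (z₀ x) V →
        ‖chainPos (gridSize n) (z₀ x) V (gridSize n) - z₁ x‖ < ε) :
    Γ.map z₁ = ν := by
  set C := ∫⁻ p, ‖p.2 - p.1‖ₑ ^ 2 ∂μ.prod ν with hCdef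
  let N : ℕ → ℕ := gridSize
  have hN0 : ∀ n, N n ≠ 0 := gridSize_ne_zero
  have hN2 : ∀ n, 1 / (N n : ℝ) ≤ 1 / 2 := one_div_gridSize_le
  let m : ∀ n, Measure (B × (ℕ → Vec d)) := fun n ↦ chainLaw μ ν Γ hz₀ (N n) (N n)
  have hmpos : ∀ n, Measurable fun ω : B × (ℕ → Vec d) ↦ chainPos (N n) (z₀ ω.1) ω.2 (N n) :=
    fun n ↦ measurable_chainPos hz₀ _ _
  have hlaw : ∀ n, (m n).map (fun ω ↦ chainPos (N n) (z₀ ω.1) ω.2 (N n)) = ν := by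
    intro n
    rw [chainLaw_map_chainPos μ ν hz₀ (N n) hΓ, div_self (by exact_mod_cast hN0 n)]
    have : interp (d := d) 1 = Prod.snd := by ext; simp [interp]
    rw [this, Measure.map_snd_prod]; simp
  have hfar : ∀ ε > 0, ∀ K > (0 : ℝ), ∀ F : Set (Vec d), IsClosed F →
      ν F ≤ (Γ.map z₁) (Metric.thickening ε F) + C / ENNReal.ofReal (K ^ 2) := by
    intro ε hε K hK F hF
    let G : ℕ → Set (B × (ℕ → Vec d)) := fun n ↦
      {ω | IsApproxChain b q K (N n) n (z₀ ω.1) ω.2}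
    let D : ℕ → Set (B × (ℕ → Vec d)) := fun n ↦
      G n ∩ {ω | ε ≤ ‖chainPos (N n) (z₀ ω.1) ω.2 (N n) - z₁ ω.1‖}
    have hD : ∀ n, MeasurableSet (D n) := fun n ↦
      (measurableSet_isApproxChain hb hz₀ hq K (hN2 n) n).inter
        (measurableSet_le measurable_const ((hmpos n).sub (hz₁.comp measurable_fst)).norm)
    have hDlim : Tendsto (fun n ↦ m n (D n)) atTop (𝓝 0) := by
      refine tendsto_measure_of_forall_eventually_notMem (Γ := Γ)
        (fun n ↦ chainLaw_map_fst μ ν Γ hz₀ _ _) hD ?_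
      filter_upwards [hclose ε hε K hK] with x ⟨n₀, hn₀⟩
      filter_upwards [eventually_ge_atTop n₀] with n hn V hV
      exact absurd (hn₀ n hn V hV.1) (not_lt.2 hV.2)
    have hGc : ∀ n, m n (G n)ᶜ ≤ C / ENNReal.ofReal (K ^ 2) +
        C * ENNReal.ofReal (1 / ((n : ℝ) + 1)) := by
      intro n
      -- An approximate chain can fail through its energy or through one of at most n defects.
      have hsub : (G n)ᶜ ⊆ {ω | ¬ ∑ k ∈ Finset.range (N n), ‖ω.2 k‖ ^ 2 < N n * K ^ 2} ∪
          ⋃ i ∈ (Finset.range n).filter (fun i ↦ 1 / (N n : ℝ) ≤ q i),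
            {ω | 1 / ((n : ℝ) + 1) ≤ ‖chainDefect b (N n) (z₀ ω.1) ω.2 (q i)‖} := by
        intro ω hω
        by_contra hcon
        simp only [mem_union, mem_ofPred_eq, not_or, not_not, mem_iUnion, not_exists, not_le,
          Finset.mem_filter, Finset.mem_range] at hcon
        exact hω ⟨hcon.1, fun i hi hqi ↦ hcon.2 i ⟨hi, hqi⟩⟩
      refine (measure_mono hsub).trans ((measure_union_le _ _).trans (add_le_add
        (chainLaw_energy_le hz₀ hΓ (hN0 n) hK) ?_))
      refine (measure_biUnion_finset_le _ _).trans ?_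
      calc _ ≤ ∑ i ∈ (Finset.range n).filter (fun i ↦ 1 / (N n : ℝ) ≤ q i),
              C * ENNReal.ofReal (1 / N n / (1 / ((n : ℝ) + 1)) ^ 2) := by
            refine Finset.sum_le_sum fun i hi ↦ ?_
            exact chainLaw_defect_le hb hmean hz₀ hΓ (hN0 n) (hN2 n) (hq i)
              (Finset.mem_filter.1 hi).2 (by positivity)
        _ ≤ n * (C * ENNReal.ofReal (1 / N n / (1 / ((n : ℝ) + 1)) ^ 2)) := by
            rw [Finset.sum_const, nsmul_eq_mul]
            gcongr
            exact (Finset.card_filter_le _ _).trans_eq (Finset.card_range n)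
        _ = C * ENNReal.ofReal (n * (1 / N n / (1 / ((n : ℝ) + 1)) ^ 2)) := by
            rw [ENNReal.ofReal_mul (by positivity), ENNReal.ofReal_natCast]; ring
        _ ≤ C * ENNReal.ofReal (1 / ((n : ℝ) + 1)) := by
            gcongr
            -- The fourth power absorbs the n events of the union bound and the squared threshold
            -- 1/(n+1), and leaves a factor that tends to 0.
            have h1 : (N n : ℝ) = ((n : ℝ) + 2) ^ 4 := by simp [N, gridSize]
            rw [h1]
            rw [show (n : ℝ) * (1 / (n + 2) ^ 4 / (1 / (n + 1)) ^ 2) =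
              n * (n + 1) ^ 2 / (n + 2) ^ 4 by field_simp, div_le_div_iff₀ (by positivity)
              (by positivity)]
            have hn : (0 : ℝ) ≤ n := by positivity
            calc (n : ℝ) * ((n : ℝ) + 1) ^ 2 * ((n : ℝ) + 1)
                ≤ ((n : ℝ) + 2) * ((n : ℝ) + 2) ^ 2 * ((n : ℝ) + 2) := by gcongr <;> linarith
              _ = 1 * ((n : ℝ) + 2) ^ 4 := by ring
    have hbound : ∀ n, ν F ≤ (Γ.map z₁) (Metric.thickening ε F) +
        (m n (D n) + (C / ENNReal.ofReal (K ^ 2) + C * ENNReal.ofReal (1 / ((n : ℝ) + 1)))) := by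
      intro n
      rw [← hlaw n, Measure.map_apply (hmpos n) hF.measurableSet,
        ← chainLaw_map_fst μ ν Γ hz₀ (N n) (N n), Measure.map_map hz₁ measurable_fst,
        Measure.map_apply (hz₁.comp measurable_fst) Metric.isOpen_thickening.measurableSet]
      refine (measure_mono (?_ : _ ⊆ (z₁ ∘ Prod.fst) ⁻¹' Metric.thickening ε F ∪
        (D n ∪ (G n)ᶜ))).trans ((measure_union_le _ _).trans (add_le_add le_rfl
          ((measure_union_le _ _).trans (add_le_add le_rfl (hGc n)))))
      intro ω hω
      by_cases hfar : ε ≤ ‖chainPos (N n) (z₀ ω.1) ω.2 (N n) - z₁ ω.1‖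
      · by_cases hG : ω ∈ G n
        · exact Or.inr (Or.inl ⟨hG, hfar⟩)
        · exact Or.inr (Or.inr hG)
      · refine Or.inl (Metric.mem_thickening_iff.2 ⟨_, hω, ?_⟩)
        rw [dist_comm, dist_eq_norm]
        exact not_le.1 hfar
    have hlim : Tendsto (fun n : ℕ ↦ (Γ.map z₁) (Metric.thickening ε F) +
        (m n (D n) + (C / ENNReal.ofReal (K ^ 2) + C * ENNReal.ofReal (1 / ((n : ℝ) + 1)))))
        atTop (𝓝 ((Γ.map z₁) (Metric.thickening ε F) +
          (0 + (C / ENNReal.ofReal (K ^ 2) + C * ENNReal.ofReal 0)))) :=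
      tendsto_const_nhds.add (hDlim.add (tendsto_const_nhds.add (ENNReal.Tendsto.const_mul
        (ENNReal.tendsto_ofReal tendsto_one_div_add_atTop_nhds_zero_nat) (Or.inr hC))))
    refine (ge_of_tendsto' hlim hbound).trans_eq ?_
    simp
  have hclosed : ∀ F : Set (Vec d), IsClosed F → ν F ≤ (Γ.map z₁) F := by
    intro F hF
    have hΓ1 : IsProbabilityMeasure (Γ.map z₁) := Measure.isProbabilityMeasure_map hz₁.aemeasurable
    have h1 : ∀ ε > 0, ν F ≤ (Γ.map z₁) (Metric.thickening ε F) := by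
      intro ε hε
      have hK : Tendsto (fun K : ℕ ↦ (Γ.map z₁) (Metric.thickening ε F) +
          C / ENNReal.ofReal (((K : ℝ) + 1) ^ 2)) atTop
          (𝓝 ((Γ.map z₁) (Metric.thickening ε F) + 0)) := by
        refine tendsto_const_nhds.add ?_
        have h2 : Tendsto (fun K : ℕ ↦ ENNReal.ofReal (((K : ℝ) + 1) ^ 2)) atTop (𝓝 ∞) := by
          refine ENNReal.tendsto_ofReal_atTop.comp ?_
          exact (tendsto_pow_atTop two_ne_zero).comp
            (tendsto_atTop_add_const_right _ _ tendsto_natCast_atTop_atTop)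
        exact ENNReal.Tendsto.const_div h2 (Or.inr hC) |>.trans (by simp)
      rw [add_zero] at hK
      exact ge_of_tendsto' hK fun K ↦ hfar ε hε (K + 1) (by positivity) F hF
    refine ge_of_tendsto (tendsto_measure_thickening_of_isClosed (μ := Γ.map z₁)
      ⟨1, one_pos, measure_ne_top _ _⟩ hF) ?_
    filter_upwards [self_mem_nhdsWithin] with ε hε using h1 ε hε
  have hΓ1 : IsProbabilityMeasure (Γ.map z₁) := Measure.isProbabilityMeasure_map hz₁.aemeasurable
  exact (eq_of_forall_isClosed_le hclosed).symm

end Transport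

/-! ### Disintegration as a weak limit over shrinking balls. -/

/-- Finite intersections from a countable basis. Countability puts convergence on all these sets
into one almost-sure event, and stability under intersection makes them determine weak convergence.
-/
lemma exists_countable_isPiSystem_basis (α : Type*) [TopologicalSpace α]
    [SecondCountableTopology α] :
    ∃ S : Set (Set α), S.Countable ∧ IsPiSystem S ∧ (∀ s ∈ S, IsOpen s) ∧
      ∀ u : Set α, IsOpen u → ∀ x ∈ u, ∃ s ∈ S, s ∈ 𝓝 x ∧ s ⊆ u := by
  set C := TopologicalSpace.countableBasis α
  refine ⟨(fun T ↦ ⋂₀ T) '' {T | T.Finite ∧ T ⊆ C},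
    (countable_ofPred_finite_subset (TopologicalSpace.countable_countableBasis α)).image _, ?_, ?_, ?_⟩
  · rintro _ ⟨T, hT, rfl⟩ _ ⟨T', hT', rfl⟩ -
    exact ⟨T ∪ T', ⟨hT.1.union hT'.1, union_subset hT.2 hT'.2⟩, sInter_union _ _⟩
  · rintro _ ⟨T, hT, rfl⟩
    exact hT.1.isOpen_sInter fun s hs ↦ TopologicalSpace.isOpen_of_mem_countableBasis (hT.2 hs)
  · intro u hu x hx
    obtain ⟨s, hs, hxs, hsu⟩ :=
      (TopologicalSpace.isBasis_countableBasis α).exists_subset_of_mem_open hx hu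
    exact ⟨s, ⟨{s}, ⟨finite_singleton s, singleton_subset_iff.2 hs⟩, sInter_singleton s⟩,
      (TopologicalSpace.isOpen_of_mem_countableBasis hs).mem_nhds hxs, hsu⟩

lemma snd_cond_prod_univ_apply {U E : Type*} [MeasurableSpace U] [MeasurableSpace E]
    (θ : Measure (U × E)) {A : Set U} (hA : MeasurableSet A) {V : Set E}
    (hV : MeasurableSet V) :
    (θ[|A ×ˢ univ]).snd V = (θ.restrict (univ ×ˢ V)).fst A / θ.fst A := by
  rw [Measure.snd_apply hV, cond_apply (hA.prod MeasurableSet.univ), Measure.fst_apply hA,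
    Measure.restrict_apply (measurable_fst hA), Measure.fst_apply hA, ENNReal.div_eq_inv_mul]
  congr 3 <;> ext <;> simp

lemma tendsto_probabilityMeasure_apply {α ι : Type*} [MeasurableSpace α] {l : Filter ι}
    {μ : ι → ProbabilityMeasure α} {ν : ProbabilityMeasure α} {V : Set α}
    (h : Tendsto (fun i ↦ (μ i : Measure α) V) l (𝓝 ((ν : Measure α) V))) :
    Tendsto (fun i ↦ μ i V) l (𝓝 (ν V)) := by
  rw [← ENNReal.tendsto_coe]
  simpa only [ProbabilityMeasure.ennreal_coeFn_eq_coeFn_toMeasure] using h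

section Disintegration

variable {U E : Type*} [MeasurableSpace U] [MeasurableSpace E] [StandardBorelSpace E] [Nonempty E]

lemma fst_restrict_univ_prod (θ : Measure (U × E)) [IsFiniteMeasure θ] {V : Set E}
    (hV : MeasurableSet V) :
    (θ.restrict (univ ×ˢ V)).fst = θ.fst.withDensity fun u ↦ θ.condKernel u V := by
  ext A hA
  rw [Measure.fst_apply hA, Measure.restrict_apply (measurable_fst hA), withDensity_apply _ hA]
  have : Prod.fst ⁻¹' A ∩ (univ : Set U) ×ˢ V = A ×ˢ V := by ext; simp
  rw [this]
  conv_lhs => rw [← θ.disintegrate θ.condKernel]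
  exact Measure.compProd_apply_prod hA hV

variable [MetricSpace U] [BorelSpace U] [SecondCountableTopology U] [HasBesicovitchCovering U]
  [TopologicalSpace E] [SecondCountableTopology E] [BorelSpace E]

/-- Conditioning a finite measure on small balls of the first factor converges weakly to its
disintegration. -/
lemma ae_tendsto_snd_cond_closedBall (θ : Measure (U × E)) [IsFiniteMeasure θ] :
    ∀ᵐ u ∂θ.fst, ∃ α : ℕ → ProbabilityMeasure E,
      (∀ n : ℕ, IsProbabilityMeasure (θ[|Metric.closedBall u (1 / ((n : ℝ) + 1)) ×ˢ univ])) ∧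
      (∀ n : ℕ, (α n : Measure E) = (θ[|Metric.closedBall u (1 / ((n : ℝ) + 1)) ×ˢ univ]).snd) ∧
      Tendsto α atTop (𝓝 ⟨θ.condKernel u, inferInstance⟩) := by
  obtain ⟨S, hSc, hSpi, hSo, hSb⟩ := exists_countable_isPiSystem_basis E
  have h1 : ∀ V ∈ S, ∀ᵐ u ∂θ.fst, Tendsto (fun r ↦ (θ.restrict (univ ×ˢ V)).fst
      (Metric.closedBall u r) / θ.fst (Metric.closedBall u r)) (𝓝[>] 0)
      (𝓝 (θ.condKernel u V)) := by
    intro V hV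
    have hVm := (hSo V hV).measurableSet
    -- The function u ↦ condKernel u V is a density of the restricted marginal, so it is the limit
    -- of the ratios over balls for almost every u.
    filter_upwards [Besicovitch.ae_tendsto_rnDeriv (θ.restrict (univ ×ˢ V)).fst θ.fst,
      (fst_restrict_univ_prod θ hVm) ▸ Measure.rnDeriv_withDensity θ.fst
        (Kernel.measurable_coe _ hVm)] with u hu hu'
    rwa [hu'] at hu
  filter_upwards [(ae_ball_iff hSc).2 h1, θ.fst.support_mem_ae] with u hu hsupp
  have hr : ∀ n : ℕ, (0 : ℝ) < 1 / ((n : ℝ) + 1) := fun n ↦ by positivity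
  have hpos : ∀ n : ℕ, θ (Metric.closedBall u (1 / ((n : ℝ) + 1)) ×ˢ univ) ≠ 0 := by
    intro n
    have := (Measure.mem_support_iff_forall u).1 hsupp _ (Metric.closedBall_mem_nhds u (hr n))
    rw [Measure.fst_apply Metric.isClosed_closedBall.measurableSet] at this
    rw [prod_univ]
    exact this.ne'
  have hprob : ∀ n : ℕ, IsProbabilityMeasure
      (θ[|Metric.closedBall u (1 / ((n : ℝ) + 1)) ×ˢ univ]) := fun n ↦
    cond_isProbabilityMeasure (hpos n)
  refine ⟨fun n ↦ ⟨(θ[|Metric.closedBall u (1 / ((n : ℝ) + 1)) ×ˢ univ]).snd, inferInstance⟩,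
    hprob, fun n ↦ rfl, ?_⟩
  refine hSpi.tendsto_probabilityMeasure_of_tendsto_of_mem (fun s hs ↦ (hSo s hs).measurableSet)
    hSb fun V hV ↦ ?_
  have hVm := (hSo V hV).measurableSet
  have hlim : Tendsto (fun n : ℕ ↦ 1 / ((n : ℝ) + 1)) atTop (𝓝[>] 0) :=
    tendsto_nhdsWithin_iff.2 ⟨tendsto_one_div_add_atTop_nhds_zero_nat, .of_forall hr⟩
  refine tendsto_probabilityMeasure_apply (((hu V hV).comp hlim).congr fun n ↦ ?_)
  exact (snd_cond_prod_univ_apply θ Metric.isClosed_closedBall.measurableSet hVm).symm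

/-- Weak limits pass to products. Absolute continuity makes the exceptional set of θ' negligible for
θ as well. -/
lemma tendsto_integral_prod_cond_closedBall [TopologicalSpace.PseudoMetrizableSpace E]
    (θ θ' : Measure (U × E)) [IsFiniteMeasure θ] [IsFiniteMeasure θ'] (hac : θ.fst ≪ θ'.fst) :
    ∀ᵐ u ∂θ.fst,
      (∀ n : ℕ, IsProbabilityMeasure (θ[|Metric.closedBall u (1 / ((n : ℝ) + 1)) ×ˢ univ])) ∧
      (∀ n : ℕ, IsProbabilityMeasure (θ'[|Metric.closedBall u (1 / ((n : ℝ) + 1)) ×ˢ univ])) ∧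
      ∀ h : BoundedContinuousFunction (E × E) ℝ,
      Tendsto (fun n : ℕ ↦ ∫ q, h (q.1.2, q.2.2)
        ∂(θ[|Metric.closedBall u (1 / ((n : ℝ) + 1)) ×ˢ univ]).prod
          (θ'[|Metric.closedBall u (1 / ((n : ℝ) + 1)) ×ˢ univ])) atTop
        (𝓝 (∫ q, h q ∂(θ.condKernel u).prod (θ'.condKernel u))) := by
  filter_upwards [ae_tendsto_snd_cond_closedBall θ, hac.ae_le (ae_tendsto_snd_cond_closedBall θ')]
    with u ⟨α, hα1, hα, hαlim⟩ ⟨β, hβ1, hβ, hβlim⟩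
  refine ⟨hα1, hβ1, fun h ↦ ?_⟩
  have hprod : Tendsto (fun n ↦ (α n).prod (β n)) atTop (𝓝 (ProbabilityMeasure.prod
      ⟨θ.condKernel u, inferInstance⟩ ⟨θ'.condKernel u, inferInstance⟩)) :=
    (ProbabilityMeasure.continuous_prod.tendsto _).comp (hαlim.prodMk_nhds hβlim)
  refine ((ProbabilityMeasure.tendsto_iff_forall_integral_tendsto.1 hprod) h).congr fun n ↦ ?_
  have := hα1 n
  have := hβ1 n
  rw [ProbabilityMeasure.toMeasure_prod, hα n, hβ n, Measure.snd, Measure.snd,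
    Measure.map_prod_map _ _ measurable_snd measurable_snd, integral_map (by fun_prop)]
  · rfl
  · exact h.continuous.aestronglyMeasurable

end Disintegration

/-! ### The orthogonality relation on the diagonal. -/

section DiagonalLimit

variable {d : ℕ}

/-- The continuous weight `1 / (1 + ‖x‖)`. -/
noncomputable def decay (x : Vec d) : ℝ := (1 + ‖x‖)⁻¹

lemma continuous_decay : Continuous (decay (d := d)) :=
  (continuous_const.add continuous_norm).inv₀ fun x ↦
    (add_pos_of_pos_of_nonneg one_pos (norm_nonneg x)).ne'

lemma decay_pos (x : Vec d) : 0 < decay x := by unfold decay; positivity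

lemma decay_le_one (x : Vec d) : decay x ≤ 1 :=
  inv_le_one_of_one_le₀ (by linarith [norm_nonneg x])

/-- Continuous test functions of space and time with compact support in `(0, 1)` in time. -/
structure IsTestFunction (ψ : Vec d × ℝ → ℝ) : Prop where
  continuous : Continuous ψ
  hasCompactSupport : HasCompactSupport ψ
  tsupport_subset : tsupport ψ ⊆ univ ×ˢ Ioo 0 1

/-- The difference between the velocity of the straight path and the field `b`, tested against
`ψ` and `e`. -/
noncomputable def testedResidual (b : Vec d → ℝ → Vec d) (ψ : Vec d × ℝ → ℝ) (e : Vec d)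
    (x : Vec d × Vec d) (τ : ℝ) : ℝ :=
  ψ (interp τ x, τ) * inner ℝ (x.2 - x.1 - b (interp τ x) τ) e

variable {b : Vec d → ℝ → Vec d} {ψ : Vec d × ℝ → ℝ}

/-- The support of ψ avoids the end times, where the field may be singular, so extension by zero is
continuous. -/
lemma IsTestFunction.continuous_mul_inner (hψ : IsTestFunction ψ)
    (hb : ContinuousOn (fun p : Vec d × ℝ ↦ b p.1 p.2) (univ ×ˢ Ioo 0 1)) (e : Vec d) :
    Continuous fun p : Vec d × ℝ ↦ ψ p * inner ℝ (b p.1 p.2) e := by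
  refine ContinuousOn.continuous_of_tsupport_subset
    (s := univ ×ˢ Ioo 0 1) (hψ.continuous.continuousOn.mul (hb.inner continuousOn_const))
    (isOpen_univ.prod isOpen_Ioo) ?_
  exact (closure_mono (Function.support_mul_subset_left _ _)).trans hψ.tsupport_subset

lemma continuous_interp_time : Continuous fun q : (Vec d × Vec d) × ℝ ↦ interp q.2 q.1 := by
  unfold interp; fun_prop

lemma IsTestFunction.continuous_testedResidual (hψ : IsTestFunction ψ)
    (hb : ContinuousOn (fun p : Vec d × ℝ ↦ b p.1 p.2) (univ ×ˢ Ioo 0 1)) (e : Vec d) :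
    Continuous fun q : (Vec d × Vec d) × ℝ ↦ testedResidual b ψ e q.1 q.2 := by
  have h1 : Continuous fun q : (Vec d × Vec d) × ℝ ↦ (interp q.2 q.1, q.2) :=
    continuous_interp_time.prodMk continuous_snd
  have h2 := (hψ.continuous_mul_inner hb e).comp h1
  have h3 := hψ.continuous.comp h1
  have h4 : Continuous fun q : (Vec d × Vec d) × ℝ ↦ inner ℝ (q.1.2 - q.1.1) e := by fun_prop
  refine ((h3.mul h4).sub h2).congr fun q ↦ ?_
  have : testedResidual b ψ e q.1 q.2 = ψ (interp q.2 q.1, q.2) * inner ℝ (q.1.2 - q.1.1) e -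
      ψ (interp q.2 q.1, q.2) * inner ℝ (b (interp q.2 q.1) q.2) e := by
    rw [testedResidual, inner_sub_left]; ring
  rw [this]
  rfl

/-- The field contributes a bounded term, being multiplied by ψ; the linear growth comes only from
the difference of the endpoints. -/
lemma IsTestFunction.exists_bound_testedResidual (hψ : IsTestFunction ψ)
    (hb : ContinuousOn (fun p : Vec d × ℝ ↦ b p.1 p.2) (univ ×ˢ Ioo 0 1)) (e : Vec d) :
    ∃ C, 0 ≤ C ∧ ∀ x τ, |testedResidual b ψ e x τ| ≤ C * (1 + ‖x.1‖ + ‖x.2‖) := by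
  obtain ⟨C₁, hC₁⟩ := hψ.hasCompactSupport.exists_bound_of_continuous hψ.continuous
  obtain ⟨C₂, hC₂⟩ := HasCompactSupport.exists_bound_of_continuous
    (f := fun p : Vec d × ℝ ↦ ψ p * inner ℝ (b p.1 p.2) e)
    hψ.hasCompactSupport.mul_right (hψ.continuous_mul_inner hb e)
  have hC₁0 : 0 ≤ C₁ := (norm_nonneg _).trans (hC₁ 0)
  have hC₂0 : 0 ≤ C₂ := (norm_nonneg _).trans (hC₂ 0)
  refine ⟨C₁ * ‖e‖ + C₂, by positivity, fun x τ ↦ ?_⟩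
  have h1 : testedResidual b ψ e x τ = ψ (interp τ x, τ) * inner ℝ (x.2 - x.1) e -
      ψ (interp τ x, τ) * inner ℝ (b (interp τ x) τ) e := by
    rw [testedResidual, inner_sub_left]; ring
  have h2 : |ψ (interp τ x, τ) * inner ℝ (x.2 - x.1) e| ≤ C₁ * ((‖x.1‖ + ‖x.2‖) * ‖e‖) := by
    rw [abs_mul]
    refine mul_le_mul (hC₁ _) ((abs_real_inner_le_norm _ _).trans ?_) (abs_nonneg _) hC₁0
    gcongr
    rw [add_comm]
    exact norm_sub_le _ _
  have h3 : |ψ (interp τ x, τ) * inner ℝ (b (interp τ x) τ) e| ≤ C₂ := hC₂ (interp τ x, τ)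
  rw [h1]
  refine (abs_sub _ _).trans ((add_le_add h2 h3).trans ?_)
  nlinarith [norm_nonneg x.1, norm_nonneg x.2, mul_nonneg hC₁0 (norm_nonneg e),
    mul_nonneg hC₂0 (norm_nonneg x.1), mul_nonneg hC₂0 (norm_nonneg x.2)]

/-- The restriction of Lebesgue measure to the unit interval. -/
noncomputable abbrev unitVolume : Measure ℝ := volume.restrict (Icc 0 1)

instance : IsProbabilityMeasure unitVolume := ⟨by simp⟩

lemma continuousOn_diagonal {v : Vec d → Vec d → Vec d → ℝ → Vec d} {u : Vec d}
    (hv : ∀ y, ∀ τ ∈ Ioo (0 : ℝ) 1, ContinuousAt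
      (fun q : Vec d × Vec d × Vec d × ℝ ↦ v q.1 q.2.1 q.2.2.1 q.2.2.2) (y, u, u, τ)) :
    ContinuousOn (fun p : Vec d × ℝ ↦ v p.1 u u p.2) (univ ×ˢ Ioo 0 1) := by
  rintro ⟨y, τ⟩ ⟨-, hτ⟩
  exact ((hv y τ hτ).comp (f := fun p : Vec d × ℝ ↦ (p.1, u, u, p.2))
    (x := (y, τ)) (by fun_prop)).continuousWithinAt

/-- A tube lemma: pointwise continuity at the diagonal becomes uniform over a compact set of
positions and times. -/
lemma eventually_dist_diagonal_lt {v : Vec d → Vec d → Vec d → ℝ → Vec d} {u : Vec d}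
    (hv : ∀ y, ∀ τ ∈ Ioo (0 : ℝ) 1, ContinuousAt
      (fun q : Vec d × Vec d × Vec d × ℝ ↦ v q.1 q.2.1 q.2.2.1 q.2.2.2) (y, u, u, τ))
    {K : Set (Vec d × ℝ)} (hK : IsCompact K) (hKs : K ⊆ univ ×ˢ Ioo 0 1) {ε : ℝ} (hε : 0 < ε) :
    ∃ r > 0, ∀ u' ∈ Metric.closedBall u r, ∀ w' ∈ Metric.closedBall u r, ∀ p ∈ K,
      ‖v p.1 u' w' p.2 - v p.1 u u p.2‖ ≤ ε := by
  have h1 : ∀ᶠ s : Vec d × Vec d in 𝓝 (u, u), ∀ p ∈ K,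
      ‖v p.1 s.1 s.2 p.2 - v p.1 u u p.2‖ ≤ ε := by
    refine hK.eventually_forall_of_forall_eventually fun p hp ↦ ?_
    have hp' := hv p.1 p.2 (hKs hp).2
    have c1 : ContinuousAt (fun z : (Vec d × Vec d) × (Vec d × ℝ) ↦
        v z.2.1 z.1.1 z.1.2 z.2.2) ((u, u), p) :=
      hp'.comp (f := fun z : (Vec d × Vec d) × (Vec d × ℝ) ↦ (z.2.1, z.1.1, z.1.2, z.2.2))
        (x := ((u, u), p)) (by fun_prop)
    have c2 : ContinuousAt (fun z : (Vec d × Vec d) × (Vec d × ℝ) ↦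
        v z.2.1 u u z.2.2) ((u, u), p) :=
      hp'.comp (f := fun z : (Vec d × Vec d) × (Vec d × ℝ) ↦ (z.2.1, u, u, z.2.2))
        (x := ((u, u), p)) (by fun_prop)
    have c3 := (c1.sub c2).norm
    have : ‖v p.1 u u p.2 - v p.1 u u p.2‖ < ε := by simpa using hε
    filter_upwards [c3.eventually (gt_mem_nhds this)] with z hz using hz.le
  obtain ⟨r, hr, hr'⟩ := Metric.eventually_nhds_iff_ball.1 h1
  refine ⟨r / 2, by positivity, fun u' hu' w' hw' p hp ↦ hr' (u', w') ?_ p hp⟩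
  rw [← ball_prod_same]
  exact ⟨(Metric.closedBall_subset_ball (by linarith)) hu',
    (Metric.closedBall_subset_ball (by linarith)) hw'⟩

end DiagonalLimit

section DiagonalLimit

variable {d : ℕ} {ψ : Vec d × ℝ → ℝ}

/-- The weighted residual of the field `v`, for data `q = ((u, x₀), (w, x₁))`. -/
noncomputable def weightedResidual (v : Vec d → Vec d → Vec d → ℝ → Vec d) (ψ : Vec d × ℝ → ℝ)
    (e : Vec d) (z : ((Vec d × Vec d) × Vec d × Vec d) × ℝ) : ℝ :=
  decay z.1.1.2 * decay z.1.2.2 *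
    testedResidual (fun y τ ↦ v y z.1.1.1 z.1.2.1 τ) ψ e (z.1.1.2, z.1.2.2) z.2

lemma decay_mul_abs_le {C a : ℝ} {x : Vec d × Vec d} (hC : 0 ≤ C)
    (h : |a| ≤ C * (1 + ‖x.1‖ + ‖x.2‖)) : |decay x.1 * decay x.2 * a| ≤ C := by
  rw [abs_mul, abs_of_pos (mul_pos (decay_pos _) (decay_pos _)), decay, decay, ← mul_inv,
    inv_mul_le_iff₀ (by positivity)]
  refine h.trans ?_
  nlinarith [mul_nonneg hC (mul_nonneg (norm_nonneg x.1) (norm_nonneg x.2))]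

lemma norm_decay_mul_testedResidual_sub_le {b b' : Vec d → ℝ → Vec d} {C ε : ℝ}
    (hC : ∀ p, ‖ψ p‖ ≤ C) (hε : 0 ≤ ε) {e : Vec d} {x : Vec d × Vec d} {τ : ℝ}
    (h : (interp τ x, τ) ∈ tsupport ψ → ‖b' (interp τ x) τ - b (interp τ x) τ‖ ≤ ε) :
    ‖decay x.1 * decay x.2 * testedResidual b ψ e x τ -
      decay x.1 * decay x.2 * testedResidual b' ψ e x τ‖ ≤ C * (ε * ‖e‖) := by
  have hC0 : 0 ≤ C := (norm_nonneg _).trans (hC 0)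
  have hrw : decay x.1 * decay x.2 * testedResidual b ψ e x τ -
      decay x.1 * decay x.2 * testedResidual b' ψ e x τ = decay x.1 * decay x.2 *
        (ψ (interp τ x, τ) * inner ℝ (b' (interp τ x) τ - b (interp τ x) τ) e) := by
    simp only [testedResidual, inner_sub_left]
    ring
  rw [hrw, norm_mul, Real.norm_of_nonneg (mul_pos (decay_pos _) (decay_pos _)).le]
  refine (mul_le_of_le_one_left (norm_nonneg _)
    (mul_le_one₀ (decay_le_one _) (decay_pos _).le (decay_le_one _))).trans ?_
  by_cases hsupp : (interp τ x, τ) ∈ tsupport ψ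
  · rw [norm_mul]
    exact mul_le_mul (hC _) ((norm_inner_le_norm _ _).trans
      (mul_le_mul_of_nonneg_right (h hsupp) (norm_nonneg _))) (norm_nonneg _) hC0
  · rw [image_eq_zero_of_notMem_tsupport hsupp, zero_mul, norm_zero]
    positivity

lemma integral_cond_eq_zero {α β : Type*} [MeasurableSpace α] [MeasurableSpace β]
    {θ : Measure α} {θ' : Measure β} [IsFiniteMeasure θ] [IsFiniteMeasure θ'] {s : Set α} {t : Set β}
    {f : (α × β) × ℝ → ℝ}
    (h : ∫ z, f z ∂((θ.restrict s).prod (θ'.restrict t)).prod unitVolume = 0) :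
    ∫ z, f z ∂((θ[|s]).prod (θ'[|t])).prod unitVolume = 0 := by
  rw [ProbabilityTheory.cond, ProbabilityTheory.cond, Measure.prod_smul_left,
    Measure.prod_smul_right, Measure.prod_smul_left,
    Measure.prod_smul_left, integral_smul_measure, integral_smul_measure, h, smul_zero, smul_zero]

lemma measure_ne_zero_of_cond {α : Type*} [MeasurableSpace α] {θ : Measure α} {s : Set α}
    (h : IsProbabilityMeasure (θ[|s])) : θ s ≠ 0 := fun h0 ↦
  IsProbabilityMeasure.ne_zero (θ[|s]) (cond_eq_zero_of_meas_eq_zero h0)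

lemma integrable_cond_prod {α β : Type*} [MeasurableSpace α] [MeasurableSpace β]
    {θ : Measure α} {θ' : Measure β} [IsFiniteMeasure θ] [IsFiniteMeasure θ'] {s : Set α} {t : Set β}
    {f : (α × β) × ℝ → ℝ} (hs : θ s ≠ 0) (ht : θ' t ≠ 0)
    (h : Integrable f ((θ.prod θ').prod unitVolume)) :
    Integrable f (((θ[|s]).prod (θ'[|t])).prod unitVolume) := by
  rw [ProbabilityTheory.cond, ProbabilityTheory.cond, Measure.prod_smul_left,
    Measure.prod_smul_right, Measure.prod_smul_left,
    Measure.prod_smul_left]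
  refine Integrable.smul_measure (Integrable.smul_measure ?_ (by simpa using ht)) (by simpa using hs)
  refine h.mono_measure ?_
  rw [Measure.prod_restrict]
  exact Measure.prod_mono Measure.restrict_le_self le_rfl

/-- With A a small ball around u, the residual of v has integral zero and is uniformly close to that
of the field frozen at (u, u). The frozen residual, damped by `decay`, is bounded and continuous, so
its integrals converge to the one under the product of disintegrations. -/
theorem ae_integral_testedResidual_diagonal_eq_zero {θ θ' : Measure (Vec d × Vec d)}
    [IsFiniteMeasure θ] [IsFiniteMeasure θ'] (hac : θ.fst ≪ θ'.fst)
    {v : Vec d → Vec d → Vec d → ℝ → Vec d}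
    (hint : ∀ ψ, IsTestFunction ψ → ∀ e,
      Integrable (weightedResidual v ψ e) ((θ.prod θ').prod unitVolume))
    (horth : ∀ ψ, IsTestFunction ψ → ∀ e, ∀ A, MeasurableSet A →
      ∫ z, weightedResidual v ψ e z
        ∂((θ.restrict (A ×ˢ univ)).prod (θ'.restrict (A ×ˢ univ))).prod unitVolume = 0) :
    ∀ᵐ u ∂θ.fst, (∀ y, ∀ τ ∈ Ioo (0 : ℝ) 1, ContinuousAt
        (fun q : Vec d × Vec d × Vec d × ℝ ↦ v q.1 q.2.1 q.2.2.1 q.2.2.2) (y, u, u, τ)) →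
      ∀ ψ, IsTestFunction ψ → ∀ e,
        ∫ x, decay x.1 * decay x.2 *
          (∫ τ in Icc (0 : ℝ) 1, testedResidual (fun y τ ↦ v y u u τ) ψ e x τ)
          ∂(θ.condKernel u).prod (θ'.condKernel u) = 0 := by
  filter_upwards [tendsto_integral_prod_cond_closedBall θ θ' hac] with u ⟨hp, hp', hu⟩ hv ψ hψ e
  have hb := continuousOn_diagonal hv
  obtain ⟨C, hC0, hC⟩ := hψ.exists_bound_testedResidual (b := fun y τ ↦ v y u u τ) hb e
  have hTc := hψ.continuous_testedResidual (b := fun y τ ↦ v y u u τ) hb e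
  have hGc : Continuous fun x : Vec d × Vec d ↦
      ∫ τ in Icc (0 : ℝ) 1, testedResidual (fun y τ ↦ v y u u τ) ψ e x τ :=
    continuous_parametric_integral_of_continuous
      (f := fun x τ ↦ testedResidual (fun y τ ↦ v y u u τ) ψ e x τ) hTc isCompact_Icc
  have hGb : ∀ x : Vec d × Vec d, |∫ τ in Icc (0 : ℝ) 1, testedResidual (fun y τ ↦ v y u u τ) ψ e x τ| ≤
      C * (1 + ‖x.1‖ + ‖x.2‖) := by
    intro x
    have := norm_integral_le_of_norm_le_const (μ := unitVolume)
      (f := fun τ ↦ testedResidual (fun y τ ↦ v y u u τ) ψ e x τ) (ae_of_all _ fun τ ↦ hC x τ)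
    simpa using this
  let h : BoundedContinuousFunction (Vec d × Vec d) ℝ := BoundedContinuousFunction.ofNormedAddCommGroup
    (fun x ↦ decay x.1 * decay x.2 *
      ∫ τ in Icc (0 : ℝ) 1, testedResidual (fun y τ ↦ v y u u τ) ψ e x τ)
    (((continuous_decay.comp continuous_fst).mul (continuous_decay.comp continuous_snd)).mul hGc) C
    (fun x ↦ decay_mul_abs_le hC0 (hGb x))
  obtain ⟨C₁, hC₁⟩ := hψ.hasCompactSupport.exists_bound_of_continuous hψ.continuous
  have hC₁0 : 0 ≤ C₁ := (norm_nonneg _).trans (hC₁ 0)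
  have hlim := hu h
  refine abs_nonpos_iff.1 (le_of_forall_pos_le_add fun η hη ↦ ?_)
  rw [zero_add]
  refine le_of_tendsto hlim.abs ?_
  -- The added 1 keeps the quotient meaningful when C₁ or e vanishes.
  set ε := η / (C₁ * ‖e‖ + 1) with hε
  have hεpos : 0 < ε := by positivity
  obtain ⟨r, hr, hclose⟩ := eventually_dist_diagonal_lt hv hψ.hasCompactSupport.isCompact
    hψ.tsupport_subset hεpos
  filter_upwards [tendsto_one_div_add_atTop_nhds_zero_nat.eventually (gt_mem_nhds hr)] with n hn
  have := hp n
  have := hp' n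
  set A : Set (Vec d) := Metric.closedBall u (1 / ((n : ℝ) + 1)) with hA
  have hAm : MeasurableSet A := Metric.isClosed_closedBall.measurableSet
  have hAm' : MeasurableSet (A ×ˢ (univ : Set (Vec d))) := hAm.prod MeasurableSet.univ
  set f₀ : ((Vec d × Vec d) × Vec d × Vec d) × ℝ → ℝ := fun z ↦ decay z.1.1.2 * decay z.1.2.2 *
    testedResidual (fun y τ ↦ v y u u τ) ψ e (z.1.1.2, z.1.2.2) z.2 with hf₀
  have hf₀c : Continuous f₀ := by
    have h1 : Continuous fun z : ((Vec d × Vec d) × Vec d × Vec d) × ℝ ↦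
      ((z.1.1.2, z.1.2.2), z.2) := by fun_prop
    exact ((continuous_decay.comp (by fun_prop)).mul (continuous_decay.comp (by fun_prop))).mul
      (hTc.comp h1)
  have hf₀i : Integrable f₀ (((θ[|A ×ˢ univ]).prod (θ'[|A ×ˢ univ])).prod unitVolume) :=
    Integrable.of_bound hf₀c.aestronglyMeasurable C (ae_of_all _ fun z ↦
      decay_mul_abs_le (x := (z.1.1.2, z.1.2.2)) hC0 (hC _ _))
  have hval : ∫ q, h (q.1.2, q.2.2) ∂(θ[|A ×ˢ univ]).prod (θ'[|A ×ˢ univ]) =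
      ∫ z, f₀ z ∂((θ[|A ×ˢ univ]).prod (θ'[|A ×ˢ univ])).prod unitVolume := by
    rw [integral_prod _ hf₀i]
    refine integral_congr_ae (ae_of_all _ fun q ↦ ?_)
    simp only [hf₀, integral_const_mul]
    rfl
  have hfi := integrable_cond_prod (measure_ne_zero_of_cond (hp n))
    (measure_ne_zero_of_cond (hp' n)) (hint ψ hψ e)
  have hzero := integral_cond_eq_zero (horth ψ hψ e A hAm)
  rw [hval, ← sub_zero (∫ z, f₀ z ∂_), ← hzero, ← integral_sub hf₀i hfi]
  have hmem : ∀ᵐ z ∂((θ[|A ×ˢ univ]).prod (θ'[|A ×ˢ univ])).prod unitVolume,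
      z.1.1.1 ∈ A ∧ z.1.2.1 ∈ A := by
    have e1 := ae_cond_mem (μ := θ) hAm'
    have e2 := ae_cond_mem (μ := θ') hAm'
    have e3 : ∀ᵐ q ∂(θ[|A ×ˢ univ]).prod (θ'[|A ×ˢ univ]), q.1.1 ∈ A ∧ q.2.1 ∈ A := by
      filter_upwards [Measure.quasiMeasurePreserving_fst.ae e1,
        Measure.quasiMeasurePreserving_snd.ae e2] with q h1 h2 using ⟨h1.1, h2.1⟩
    exact Measure.quasiMeasurePreserving_fst.ae e3
  have hbd : ∀ᵐ z ∂((θ[|A ×ˢ univ]).prod (θ'[|A ×ˢ univ])).prod unitVolume,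
      ‖f₀ z - weightedResidual v ψ e z‖ ≤ C₁ * (ε * ‖e‖) := by
    filter_upwards [hmem] with z hz
    have hsub : Metric.closedBall u (1 / ((n : ℝ) + 1)) ⊆ Metric.closedBall u r :=
      Metric.closedBall_subset_closedBall hn.le
    have key := norm_decay_mul_testedResidual_sub_le hC₁ hεpos.le (e := e)
      (x := (z.1.1.2, z.1.2.2)) (τ := z.2)
      (b := fun y τ ↦ v y u u τ) (b' := fun y τ ↦ v y z.1.1.1 z.1.2.1 τ)
      fun hs ↦ hclose z.1.1.1 (hsub hz.1) z.1.2.1 (hsub hz.2)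
        (interp z.2 (z.1.1.2, z.1.2.2), z.2) hs
    exact key
  have hfin := norm_integral_le_of_norm_le_const hbd
  rw [probReal_univ, mul_one, Real.norm_eq_abs] at hfin
  refine hfin.trans ?_
  rw [hε, ← mul_assoc, mul_comm C₁, mul_assoc, div_mul_eq_mul_div, div_le_iff₀ (by positivity)]
  nlinarith

end DiagonalLimit

/-! ### Removal of the damping by reweighting the laws. -/

section Reweight

variable {U E : Type*} [MeasurableSpace U] [MeasurableSpace E] [StandardBorelSpace E] [Nonempty E]

/-- A density in the second variable multiplies the disintegration by that density, up to
normalization. Dividing the reweighted disintegration by W and normalizing again recovers the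
original one, by almost sure uniqueness. -/
lemma condKernel_withDensity_snd
    (θ : Measure (U × E)) [IsFiniteMeasure θ] {W : E → ℝ≥0∞} (hW : Measurable W)
    (hW1 : ∀ x, 1 ≤ W x) (hWt : ∀ x, W x ≠ ∞) [IsFiniteMeasure (θ.withDensity fun p ↦ W p.2)] :
    ∀ᵐ u ∂θ.fst, ∃ c : ℝ≥0∞, c ≠ ∞ ∧ θ.condKernel u =
      c • ((θ.withDensity fun p ↦ W p.2).condKernel u).withDensity fun x ↦ (W x)⁻¹ := by
  set θW := θ.withDensity fun p ↦ W p.2 with hθW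
  have hWi : Measurable fun x ↦ (W x)⁻¹ := hW.inv
  have hW0 : ∀ x, W x ≠ 0 := fun x ↦ (zero_lt_one.trans_le (hW1 x)).ne'
  have hWsnd : Measurable fun p : U × E ↦ W p.2 := hW.comp measurable_snd
  have hunc : Measurable (Function.uncurry fun (_ : U) x ↦ (W x)⁻¹) := hWi.comp measurable_snd
  let η : Kernel U E := θW.condKernel.withDensity fun _ x ↦ (W x)⁻¹
  have hη : ∀ u, η u = (θW.condKernel u).withDensity fun x ↦ (W x)⁻¹ := fun u ↦
    Kernel.withDensity_apply _ hunc u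
  have hηle : ∀ u, η u univ ≤ 1 := by
    intro u
    rw [hη, withDensity_apply _ MeasurableSet.univ, Measure.restrict_univ]
    calc ∫⁻ x, (W x)⁻¹ ∂θW.condKernel u ≤ ∫⁻ _, 1 ∂θW.condKernel u :=
          lintegral_mono fun x ↦ ENNReal.inv_le_one.2 (hW1 x)
      _ = 1 := by simp
  have : IsFiniteKernel η := ⟨1, ENNReal.one_lt_top, hηle⟩
  have hηtop : ∀ u, η u univ ≠ ∞ := fun u ↦ measure_ne_top _ _
  have hη0 : ∀ u, η u univ ≠ 0 := by
    intro u h0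
    rw [hη, withDensity_apply _ MeasurableSet.univ, Measure.restrict_univ,
      lintegral_eq_zero_iff hWi] at h0
    have : ∀ᵐ _ ∂θW.condKernel u, False := by
      filter_upwards [h0] with x hx
      exact hWt x (by simpa using hx)
    exact IsProbabilityMeasure.ne_zero (θW.condKernel u) (by simpa using this)
  have hcomp : θW.fst ⊗ₘ η = θ := by
    rw [Measure.compProd_withDensity hunc, θW.disintegrate θW.condKernel, hθW,
      withDensity_inv_same hWsnd (ae_of_all _ fun p ↦ hW0 _) (ae_of_all _ fun p ↦ hWt _)]
  have hfst : θ.fst = θW.fst.withDensity fun u ↦ η u univ := by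
    ext A hA
    rw [withDensity_apply _ hA, ← Measure.compProd_apply_prod hA MeasurableSet.univ, hcomp,
      Measure.fst_apply hA, prod_univ]
  have hmeas : Measurable fun u ↦ (η u univ)⁻¹ := (Kernel.measurable_coe η MeasurableSet.univ).inv
  have hunc2 : Measurable (Function.uncurry fun u (_ : E) ↦ (η u univ)⁻¹) :=
    hmeas.comp measurable_fst
  let κ : Kernel U E := η.withDensity fun u _ ↦ (η u univ)⁻¹
  have hκ : ∀ u, κ u = (η u univ)⁻¹ • η u := fun u ↦ by
    rw [Kernel.withDensity_apply _ hunc2, withDensity_const]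
  have : IsFiniteKernel κ := by
    refine ⟨1, ENNReal.one_lt_top, fun u ↦ ?_⟩
    rw [hκ, Measure.smul_apply, smul_eq_mul, ENNReal.inv_mul_cancel (hη0 u) (hηtop u)]
  have hθκ : θ = θ.fst ⊗ₘ κ := by
    ext s hs
    rw [Measure.compProd_apply hs, hfst, lintegral_withDensity_eq_lintegral_mul _
      (Kernel.measurable_coe η MeasurableSet.univ) (Kernel.measurable_kernel_prodMk_left hs)]
    conv_lhs => rw [← hcomp]
    rw [Measure.compProd_apply hs]
    refine lintegral_congr fun u ↦ ?_
    rw [Pi.mul_apply, hκ, Measure.smul_apply, smul_eq_mul, ← mul_assoc,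
      ENNReal.mul_inv_cancel (hη0 u) (hηtop u), one_mul]
  filter_upwards [eq_condKernel_of_measure_eq_compProd κ hθκ] with u hu
  exact ⟨(η u univ)⁻¹, ENNReal.inv_ne_top.2 (hη0 u), by rw [← hu, hκ, hη]⟩

end Reweight

section DiagonalLimit

variable {d : ℕ}

/-- The weight `1 + ‖x‖`. -/
noncomputable def growth (x : Vec d) : ℝ≥0∞ := ENNReal.ofReal (1 + ‖x‖)

lemma measurable_growth : Measurable (growth (d := d)) := by unfold growth; fun_prop

lemma growth_toReal_mul_decay (x : Vec d) : (growth x).toReal * decay x = 1 := by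
  have : (0 : ℝ) < 1 + ‖x‖ := by positivity
  rw [growth, decay, ENNReal.toReal_ofReal this.le, mul_inv_cancel₀ this.ne']

lemma growth_ne_top (x : Vec d) : growth x ≠ ∞ := ENNReal.ofReal_ne_top

lemma one_le_growth (x : Vec d) : 1 ≤ growth x := by
  rw [growth, ← ENNReal.ofReal_one]
  exact ENNReal.ofReal_le_ofReal (by linarith [norm_nonneg x])

lemma growth_inv_toReal (x : Vec d) : ((growth x)⁻¹).toReal = decay x := by
  rw [ENNReal.toReal_inv, growth, decay, ENNReal.toReal_ofReal (by positivity)]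

lemma isFiniteMeasure_withDensity_growth {θ : Measure (Vec d × Vec d)} [IsFiniteMeasure θ]
    (h : ∫⁻ p, ‖p.2‖ₑ ∂θ ≠ ∞) : IsFiniteMeasure (θ.withDensity fun p ↦ growth p.2) := by
  refine isFiniteMeasure_withDensity ?_
  have : ∀ p : Vec d × Vec d, growth p.2 = 1 + ‖p.2‖ₑ := fun p ↦ by
    rw [growth, ENNReal.ofReal_add zero_le_one (norm_nonneg _), ENNReal.ofReal_one, ofReal_norm]
  simp_rw [this]
  rw [lintegral_add_left measurable_const]
  simp [h, measure_ne_top]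

lemma withDensity_growth_prod (θ θ' : Measure (Vec d × Vec d)) [IsFiniteMeasure θ]
    [IsFiniteMeasure θ'] {S S' : Set (Vec d × Vec d)} (hS : MeasurableSet S)
    (hS' : MeasurableSet S') :
    (((θ.withDensity fun p ↦ growth p.2).restrict S).prod
      ((θ'.withDensity fun p ↦ growth p.2).restrict S')).prod unitVolume =
    (((θ.restrict S).prod (θ'.restrict S')).prod unitVolume).withDensity
      fun z ↦ growth z.1.1.2 * growth z.1.2.2 := by
  have hm : Measurable fun p : Vec d × Vec d ↦ growth p.2 := measurable_growth.comp measurable_snd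
  have hm2 : Measurable fun z : (Vec d × Vec d) × (Vec d × Vec d) ↦ growth z.1.2 * growth z.2.2 :=
    (hm.comp measurable_fst).mul (hm.comp measurable_snd)
  rw [restrict_withDensity hS, restrict_withDensity hS', prod_withDensity hm hm,
    prod_withDensity_left hm2]

/-- Weak convergence tests only bounded functions, whereas the residual grows linearly. The previous
theorem is therefore applied to the laws weighted by `growth`, finite by the first moments: the
weights cancel the damping in the hypotheses, and again in the limit up to constants irrelevant to
vanishing. -/
theorem ae_integral_testedResidual_eq_zero {θ θ' : Measure (Vec d × Vec d)}
    [IsFiniteMeasure θ] [IsFiniteMeasure θ'] (h1 : ∫⁻ p, ‖p.2‖ₑ ∂θ ≠ ∞) (h1' : ∫⁻ p, ‖p.2‖ₑ ∂θ' ≠ ∞)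
    (hac : θ.fst ≪ θ'.fst) {v : Vec d → Vec d → Vec d → ℝ → Vec d}
    (hint : ∀ ψ, IsTestFunction ψ → ∀ e, Integrable (fun z : ((Vec d × Vec d) × Vec d × Vec d) × ℝ ↦
      testedResidual (fun y τ ↦ v y z.1.1.1 z.1.2.1 τ) ψ e (z.1.1.2, z.1.2.2) z.2)
      ((θ.prod θ').prod unitVolume))
    (horth : ∀ ψ, IsTestFunction ψ → ∀ e, ∀ A, MeasurableSet A →
      ∫ z, testedResidual (fun y τ ↦ v y z.1.1.1 z.1.2.1 τ) ψ e (z.1.1.2, z.1.2.2) z.2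
        ∂((θ.restrict (A ×ˢ univ)).prod (θ'.restrict (A ×ˢ univ))).prod unitVolume = 0) :
    ∀ᵐ u ∂θ.fst, (∀ y, ∀ τ ∈ Ioo (0 : ℝ) 1, ContinuousAt
        (fun q : Vec d × Vec d × Vec d × ℝ ↦ v q.1 q.2.1 q.2.2.1 q.2.2.2) (y, u, u, τ)) →
      ∀ ψ, IsTestFunction ψ → ∀ e,
        ∫ x, (∫ τ in Icc (0 : ℝ) 1, testedResidual (fun y τ ↦ v y u u τ) ψ e x τ)
          ∂(θ.condKernel u).prod (θ'.condKernel u) = 0 := by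
  have := isFiniteMeasure_withDensity_growth h1
  have := isFiniteMeasure_withDensity_growth h1'
  have hgm : Measurable fun p : Vec d × Vec d ↦ growth p.2 := measurable_growth.comp measurable_snd
  have hg0 : ∀ x : Vec d, growth x ≠ 0 := fun x ↦ (zero_lt_one.trans_le (one_le_growth x)).ne'
  have hac1 : ∀ θ : Measure (Vec d × Vec d), θ.fst ≪ (θ.withDensity fun p ↦ growth p.2).fst :=
    fun θ ↦ (withDensity_absolutelyContinuous' hgm.aemeasurable (ae_of_all _ fun p ↦ hg0 _)).map
      measurable_fst
  have hac2 : (θ.withDensity fun p ↦ growth p.2).fst ≪ θ.fst :=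
    (withDensity_absolutelyContinuous _ _).map measurable_fst
  have hmul : ∀ z : ((Vec d × Vec d) × Vec d × Vec d) × ℝ, ∀ a : ℝ,
      (growth z.1.1.2 * growth z.1.2.2).toReal • (decay z.1.1.2 * decay z.1.2.2 * a) = a := by
    intro z a
    rw [ENNReal.toReal_mul, smul_eq_mul]
    linear_combination a * decay z.1.1.2 * (growth z.1.1.2).toReal * growth_toReal_mul_decay z.1.2.2
      + a * growth_toReal_mul_decay z.1.1.2
  have hgm2 : Measurable fun z : ((Vec d × Vec d) × Vec d × Vec d) × ℝ ↦
      growth z.1.1.2 * growth z.1.2.2 :=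
    (measurable_growth.comp (by fun_prop)).mul (measurable_growth.comp (by fun_prop))
  have hglt : ∀ z : ((Vec d × Vec d) × Vec d × Vec d) × ℝ, growth z.1.1.2 * growth z.1.2.2 < ∞ :=
    fun z ↦ ENNReal.mul_lt_top (growth_ne_top _).lt_top (growth_ne_top _).lt_top
  have key := ae_integral_testedResidual_diagonal_eq_zero
    (θ := θ.withDensity fun p ↦ growth p.2) (θ' := θ'.withDensity fun p ↦ growth p.2) (v := v)
    ((hac2.trans hac).trans (hac1 θ')) ?_ ?_
  · filter_upwards [(hac1 θ).ae_le key,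
      condKernel_withDensity_snd θ measurable_growth one_le_growth growth_ne_top,
      hac.ae_le (condKernel_withDensity_snd θ' measurable_growth one_le_growth growth_ne_top)]
      with u hu ⟨c, hc, hcκ⟩ ⟨c', hc', hcκ'⟩ hv ψ hψ e
    have hu' := hu hv ψ hψ e
    have hgi : Measurable fun x : Vec d ↦ (growth x)⁻¹ := measurable_growth.inv
    have hgi2 : Measurable fun z : Vec d × Vec d ↦ (growth z.1)⁻¹ * (growth z.2)⁻¹ :=
      (hgi.comp measurable_fst).mul (hgi.comp measurable_snd)
    rw [hcκ, hcκ', Measure.prod_smul_left, Measure.prod_smul_right, integral_smul_measure,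
      integral_smul_measure, prod_withDensity hgi hgi,
      integral_withDensity_eq_integral_toReal_smul hgi2
        (ae_of_all _ fun x ↦ ENNReal.mul_lt_top (ENNReal.inv_lt_top.2 (hg0 _).bot_lt)
          (ENNReal.inv_lt_top.2 (hg0 _).bot_lt))]
    simp only [ENNReal.toReal_mul, growth_inv_toReal, smul_eq_mul] at hu' ⊢
    rw [hu', mul_zero, mul_zero]
  · intro ψ hψ e
    have hre := withDensity_growth_prod θ θ' MeasurableSet.univ MeasurableSet.univ
    simp only [Measure.restrict_univ] at hre
    rw [hre, integrable_withDensity_iff_integrable_smul' hgm2 (ae_of_all _ hglt)]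
    refine (hint ψ hψ e).congr (ae_of_all _ fun z ↦ (hmul z _).symm)
  · intro ψ hψ e A hA
    rw [withDensity_growth_prod θ θ' (hA.prod MeasurableSet.univ) (hA.prod MeasurableSet.univ),
      integral_withDensity_eq_integral_toReal_smul hgm2 (ae_of_all _ hglt),
      ← horth ψ hψ e A hA]
    exact integral_congr_ae (ae_of_all _ fun z ↦ hmul z _)

end DiagonalLimit

/-! ### The field is the conditional mean velocity at every time. -/

section ConditionalMean

variable {d : ℕ} {b : Vec d → ℝ → Vec d} {ψ : Vec d × ℝ → ℝ}

lemma IsTestFunction.mul_time (hψ : IsTestFunction ψ) {F : ℝ → ℝ} (hF : Continuous F) :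
    IsTestFunction fun p ↦ F p.2 * ψ p where
  continuous := (hF.comp continuous_snd).mul hψ.continuous
  hasCompactSupport := hψ.hasCompactSupport.mul_left
  tsupport_subset :=
    (closure_mono (Function.support_mul_subset_right _ _)).trans hψ.tsupport_subset

lemma isTestFunction_bump {φ : Vec d → ℝ} (hφ : Continuous φ) (hφc : HasCompactSupport φ) {t : ℝ}
    (χ : ContDiffBump t) (hχ : Metric.closedBall t χ.rOut ⊆ Ioo 0 1) :
    IsTestFunction fun p : Vec d × ℝ ↦ χ p.2 * φ p.1 := by
  have hK : IsCompact (tsupport φ ×ˢ Metric.closedBall t χ.rOut) :=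
    hφc.isCompact.prod (isCompact_closedBall _ _)
  have hsub : Function.support (fun p : Vec d × ℝ ↦ χ p.2 * φ p.1) ⊆
      tsupport φ ×ˢ Metric.closedBall t χ.rOut := by
    intro p hp
    have hp' : χ p.2 * φ p.1 ≠ 0 := hp
    refine ⟨subset_tsupport _ (right_ne_zero_of_mul hp'), ?_⟩
    rw [← χ.tsupport_eq]
    exact subset_tsupport _ (left_ne_zero_of_mul hp')
  refine ⟨(χ.continuous.comp continuous_snd).mul (hφ.comp continuous_fst),
    HasCompactSupport.of_support_subset_isCompact hK hsub, ?_⟩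
  exact (closure_minimal hsub hK.isClosed).trans (prod_mono (subset_univ _) hχ)

variable {J : Measure (Vec d × Vec d)} [IsProbabilityMeasure J]

/-- The tested residual F(τ) is continuous in time, so F(τ)ψ is again a test function. Using it
gives ∫ F² = 0, whence F vanishes at every time and not only at almost every one. -/
lemma integral_testedResidual_eq_zero_of_time_average
    (hJ1 : Integrable (fun x ↦ x.1) J) (hJ2 : Integrable (fun x ↦ x.2) J)
    (hb : ContinuousOn (fun p : Vec d × ℝ ↦ b p.1 p.2) (univ ×ˢ Ioo 0 1)) {e : Vec d}
    (h : ∀ ψ, IsTestFunction ψ → ∫ x, (∫ τ in Icc (0 : ℝ) 1, testedResidual b ψ e x τ) ∂J = 0)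
    (hψ : IsTestFunction ψ) {t : ℝ} (ht : t ∈ Icc (0 : ℝ) 1) :
    ∫ x, testedResidual b ψ e x t ∂J = 0 := by
  have hdom : ∀ C : ℝ, Integrable (fun x : Vec d × Vec d ↦ C * (1 + ‖x.1‖ + ‖x.2‖)) J := fun C ↦
    (((integrable_const _).add hJ1.norm).add hJ2.norm).const_mul C
  have hF : Continuous fun τ ↦ ∫ x, testedResidual b ψ e x τ ∂J := by
    obtain ⟨C, -, hC⟩ := hψ.exists_bound_testedResidual hb e
    have hc := hψ.continuous_testedResidual hb e
    refine continuous_of_dominated (bound := fun x ↦ C * (1 + ‖x.1‖ + ‖x.2‖)) (fun τ ↦ ?_)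
      (fun τ ↦ ae_of_all _ fun x ↦ hC x τ) (hdom C) (ae_of_all _ fun x ↦ ?_)
    · exact (hc.comp (Continuous.prodMk_left τ)).aestronglyMeasurable
    · exact hc.comp (Continuous.prodMk_right x)
  set F : ℝ → ℝ := fun τ ↦ ∫ x, testedResidual b ψ e x τ ∂J with hFdef
  have hψ' := hψ.mul_time hF
  have hmul : ∀ x τ, testedResidual b (fun p ↦ F p.2 * ψ p) e x τ =
      F τ * testedResidual b ψ e x τ := fun x τ ↦ by rw [testedResidual, testedResidual, mul_assoc]
  have h0 := h _ hψ'
  obtain ⟨C, -, hC⟩ := hψ'.exists_bound_testedResidual hb e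
  rw [integral_integral_swap (f := fun x τ ↦ testedResidual b (fun p ↦ F p.2 * ψ p) e x τ)
    (μ := J) (ν := unitVolume) ?_] at h0
  · simp_rw [hmul, integral_const_mul] at h0
    have hsq := (setIntegral_eq_zero_iff_of_nonneg_ae (μ := volume) (s := Icc (0 : ℝ) 1)
      (f := fun τ ↦ F τ * F τ) (ae_of_all _ fun τ ↦ mul_self_nonneg _)
      (hF.mul hF).continuousOn.integrableOn_Icc).1 h0
    have := Measure.eqOn_Icc_of_ae_eq volume zero_ne_one hsq (hF.mul hF).continuousOn
      continuousOn_const ht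
    exact mul_self_eq_zero.1 this
  · refine Integrable.mono' ((hdom C).comp_fst unitVolume)
      (hψ'.continuous_testedResidual hb e).aestronglyMeasurable (ae_of_all _ fun z ↦ hC z.1 z.2)

lemma integral_smul_sub_eq {φ : Vec d → ℝ} (hφ : Continuous φ) (hφc : HasCompactSupport φ)
    (hJ1 : Integrable (fun x ↦ x.1) J) (hJ2 : Integrable (fun x ↦ x.2) J)
    (hb : ContinuousOn (fun p : Vec d × ℝ ↦ b p.1 p.2) (univ ×ˢ Ioo 0 1))
    (h : ∀ ψ, IsTestFunction ψ → ∀ e,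
      ∫ x, (∫ τ in Icc (0 : ℝ) 1, testedResidual b ψ e x τ) ∂J = 0) {t : ℝ} (ht : t ∈ Ioo (0 : ℝ) 1) :
    ∫ x, φ (interp t x) • (x.2 - x.1) ∂J = ∫ x, φ (interp t x) • b (interp t x) t ∂J := by
  obtain ⟨C, hC⟩ := hφc.exists_bound_of_continuous hφ
  have hbt : Continuous fun y ↦ b y t := by
    rw [← continuousOn_univ]
    exact hb.comp (f := fun y ↦ (y, t)) (by fun_prop) fun y _ ↦ ⟨mem_univ _, ht⟩
  have hφb : Continuous fun y ↦ φ y • b y t := hφ.smul hbt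
  obtain ⟨C', hC'⟩ := (hφc.smul_right (f' := fun y ↦ b y t)).exists_bound_of_continuous hφb
  have hi1 : Integrable (fun x ↦ φ (interp t x) • (x.2 - x.1)) J :=
    (hJ2.sub hJ1).bdd_smul C ((hφ.comp (continuous_interp t)).aestronglyMeasurable)
      (ae_of_all _ fun x ↦ hC _)
  have hi2 : Integrable (fun x ↦ φ (interp t x) • b (interp t x) t) J :=
    Integrable.of_bound (hφb.comp (continuous_interp t)).aestronglyMeasurable C'
      (ae_of_all _ fun x ↦ hC' _)
  rw [← sub_eq_zero, ← integral_sub hi1 hi2]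
  refine ext_inner_right ℝ fun e ↦ ?_
  obtain ⟨r, hr, hr'⟩ := Metric.nhds_basis_closedBall.mem_iff.1 (isOpen_Ioo.mem_nhds ht)
  -- A cutoff in time supported in (0, 1) and equal to 1 at t makes a test function out of φ.
  let χ : ContDiffBump t := ⟨r / 2, r, by positivity, by linarith⟩
  have hχ : χ t = 1 := χ.one_of_mem_closedBall (Metric.mem_closedBall_self χ.rIn_pos.le)
  have h0 := integral_testedResidual_eq_zero_of_time_average hJ1 hJ2 hb (e := e)
    (fun ψ hψ ↦ h ψ hψ e) (isTestFunction_bump hφ hφc χ hr') (Ioo_subset_Icc_self ht)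
  have hi : Integrable (fun x ↦ φ (interp t x) • (x.2 - x.1) - φ (interp t x) • b (interp t x) t) J :=
    hi1.sub hi2
  rw [inner_zero_left, real_inner_comm, ← integral_inner hi, ← h0]
  refine integral_congr_ae (ae_of_all _ fun x ↦ ?_)
  simp only [testedResidual, hχ, one_mul, ← smul_sub]
  rw [real_inner_comm, real_inner_smul_left]

/-- Two locally integrable functions of the position agree almost everywhere once they agree against
smooth compactly supported φ; `integral_smul_sub_eq` supplies exactly this. -/
theorem integral_velocityKernel_eq {μ ν : Measure (Vec d)} [IsProbabilityMeasure μ]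
    [IsProbabilityMeasure ν] (hμ : Integrable (fun x ↦ x) μ) (hν : Integrable (fun x ↦ x) ν)
    (hb : ContinuousOn (fun p : Vec d × ℝ ↦ b p.1 p.2) (univ ×ˢ Ioo 0 1))
    (h : ∀ ψ, IsTestFunction ψ → ∀ e,
      ∫ x, (∫ τ in Icc (0 : ℝ) 1, testedResidual b ψ e x τ) ∂μ.prod ν = 0) {t : ℝ}
    (ht : t ∈ Ioo (0 : ℝ) 1) :
    ∀ᵐ y ∂(μ.prod ν).map (interp t), ∫ v, v ∂velocityKernel μ ν t y = b y t := by
  have hJ1 : Integrable (fun x : Vec d × Vec d ↦ x.1) (μ.prod ν) := hμ.comp_fst ν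
  have hJ2 : Integrable (fun x : Vec d × Vec d ↦ x.2) (μ.prod ν) := hν.comp_snd μ
  have hbt : Continuous fun y ↦ b y t := by
    rw [← continuousOn_univ]
    exact hb.comp (f := fun y ↦ (y, t)) (by fun_prop) fun y _ ↦ ⟨mem_univ _, ht⟩
  have hdiff : AEMeasurable (fun p : Vec d × Vec d ↦ p.2 - p.1) (μ.prod ν) := by fun_prop
  have hpair : Measurable fun p : Vec d × Vec d ↦ (interp t p, p.2 - p.1) :=
    (measurable_interp t).prodMk (by fun_prop)
  have hcomp := compProd_map_condDistrib (mβ := inferInstance) (X := interp (d := d) t) hdiff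
  have : IsProbabilityMeasure ((μ.prod ν).map (interp t)) :=
    Measure.isProbabilityMeasure_map (measurable_interp t).aemeasurable
  have hi : Integrable (fun q : Vec d × Vec d ↦ q.2)
      ((μ.prod ν).map (interp t) ⊗ₘ velocityKernel μ ν t) := by
    rw [velocityKernel, hcomp, integrable_map_measure (by fun_prop) hpair.aemeasurable]
    exact hJ2.sub hJ1
  have him : Integrable (fun y ↦ ∫ v, v ∂velocityKernel μ ν t y) ((μ.prod ν).map (interp t)) := by
    rw [velocityKernel, hcomp] at hi
    exact hi.integral_condDistrib_map hdiff
  refine ae_eq_of_integral_contDiff_smul_eq him.locallyIntegrable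
    hbt.locallyIntegrable fun φ hφ hφc ↦ ?_
  obtain ⟨C, hC⟩ := hφc.exists_bound_of_continuous hφ.continuous
  have hiφ : Integrable (fun q : Vec d × Vec d ↦ φ q.1 • q.2)
      ((μ.prod ν).map (interp t) ⊗ₘ velocityKernel μ ν t) :=
    hi.bdd_smul C (hφ.continuous.comp continuous_fst).aestronglyMeasurable
      (ae_of_all _ fun x ↦ hC _)
  have e1 : ∫ y, φ y • ∫ v, v ∂velocityKernel μ ν t y ∂(μ.prod ν).map (interp t) =
      ∫ q, φ q.1 • q.2 ∂(μ.prod ν).map (interp t) ⊗ₘ velocityKernel μ ν t := by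
    rw [Measure.integral_compProd hiφ]
    exact integral_congr_ae (ae_of_all _ fun y ↦ (integral_smul _ _).symm)
  rw [e1, velocityKernel, hcomp, integral_map hpair.aemeasurable
    (by exact ((hφ.continuous.comp continuous_fst).smul continuous_snd).aestronglyMeasurable),
    integral_map (measurable_interp t).aemeasurable
      (by exact (hφ.continuous.smul hbt).aestronglyMeasurable)]
  exact integral_smul_sub_eq hφ.continuous hφc hJ1 hJ2 hb h ht

end ConditionalMean

/-! ### Algebra of the mask projections. -/

section Masks

variable {d : ℕ} (m : Mask d) (x y : Vec d)

lemma obs_apply (i : Fin d) : obs m x i = if m i then x i else 0 := rfl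

lemma mis_apply (i : Fin d) : mis m x i = if m i then 0 else x i := rfl

@[simp] lemma obs_obs : obs m (obs m x) = obs m x := by
  ext i; by_cases h : m i <;> simp [obs_apply, h]

@[simp] lemma mis_mis : mis m (mis m x) = mis m x := by
  ext i; by_cases h : m i <;> simp [mis_apply, h]

@[simp] lemma obs_mis : obs m (mis m x) = 0 := by
  ext i; by_cases h : m i <;> simp [mis_apply, obs_apply, h]

@[simp] lemma obs_add_mis : obs m x + mis m x = x := by
  ext i; by_cases h : m i <;> simp [mis_apply, obs_apply, h]

lemma mis_add : mis m (x + y) = mis m x + mis m y := by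
  ext i; by_cases h : m i <;> simp [mis_apply, h]

lemma mis_sub : mis m (x - y) = mis m x - mis m y := by
  ext i; by_cases h : m i <;> simp [mis_apply, h]

lemma mis_smul (c : ℝ) : mis m (c • x) = c • mis m x := by
  ext i; by_cases h : m i <;> simp [mis_apply, h]

lemma obs_add : obs m (x + y) = obs m x + obs m y := by
  ext i; by_cases h : m i <;> simp [obs_apply, h]

lemma obs_smul (c : ℝ) : obs m (c • x) = c • obs m x := by
  ext i; by_cases h : m i <;> simp [obs_apply, h]

lemma inner_mis_right : inner ℝ x (mis m y) = inner ℝ (mis m x) y := by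
  rw [PiLp.inner_apply, PiLp.inner_apply]
  refine Finset.sum_congr rfl fun i _ ↦ ?_
  by_cases h : m i <;> simp [mis_apply, h]

/-- `mis m` as a continuous linear map. -/
noncomputable def misL : Vec d →L[ℝ] Vec d :=
  LinearMap.toContinuousLinearMap
    { toFun := mis m, map_add' := mis_add m, map_smul' := fun c x ↦ mis_smul m x c }

/-- `obs m` as a continuous linear map. -/
noncomputable def obsL : Vec d →L[ℝ] Vec d :=
  LinearMap.toContinuousLinearMap
    { toFun := obs m, map_add' := obs_add m, map_smul' := fun c x ↦ obs_smul m x c }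

lemma continuous_mis : Continuous (mis m) := (misL m).continuous

lemma continuous_obs : Continuous (obs m) := (obsL m).continuous

lemma measurable_mis : Measurable fun p : Mask d × Vec d ↦ mis p.1 p.2 :=
  measurable_from_prod_countable_right fun m ↦ (continuous_mis m).measurable

lemma measurable_obs : Measurable fun p : Mask d × Vec d ↦ obs p.1 p.2 :=
  measurable_from_prod_countable_right fun m ↦ (continuous_obs m).measurable

end Masks

/-! ### First-order condition for the optimal velocity. -/

/-- Expanding the square gives 2εc ≤ ε²K for every ε, which forces the linear coefficient c to
vanish. -/
lemma integral_inner_eq_zero_of_forall_le {α E : Type*} [MeasurableSpace α]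
    [NormedAddCommGroup E] [InnerProductSpace ℝ E] {Q : Measure α} {a h : α → E}
    (ha : MemLp a 2 Q) (hh : MemLp h 2 Q)
    (hmin : ∀ ε : ℝ, ∫⁻ z, ‖a z‖ₑ ^ 2 ∂Q ≤ ∫⁻ z, ‖a z - ε • h z‖ₑ ^ 2 ∂Q) :
    ∫ z, inner ℝ (a z) (h z) ∂Q = 0 := by
  have hsq : ∀ {f : α → E}, MemLp f 2 Q →
      ∫⁻ z, ‖f z‖ₑ ^ 2 ∂Q = ENNReal.ofReal (∫ z, ‖f z‖ ^ 2 ∂Q) := by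
    intro f hf
    rw [ofReal_integral_eq_lintegral_ofReal (hf.integrable_norm_pow (p := 2) (by norm_num))
      (ae_of_all _ fun z ↦ by positivity)]
    refine lintegral_congr fun z ↦ ?_
    rw [ENNReal.ofReal_pow (norm_nonneg _), ofReal_norm]
  have ia : Integrable (fun z ↦ ‖a z‖ ^ 2) Q := ha.integrable_norm_pow (p := 2) (by norm_num)
  have ih : Integrable (fun z ↦ ‖h z‖ ^ 2) Q := hh.integrable_norm_pow (p := 2) (by norm_num)
  have iah : Integrable (fun z ↦ inner ℝ (a z) (h z)) Q := by
    refine (ia.add ih).mono' (ha.1.inner hh.1) (ae_of_all _ fun z ↦ ?_)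
    refine (norm_inner_le_norm _ _).trans ?_
    simp only [Pi.add_apply]
    nlinarith [sq_nonneg (‖a z‖ - ‖h z‖), sq_nonneg ‖a z‖, sq_nonneg ‖h z‖]
  set c := ∫ z, inner ℝ (a z) (h z) ∂Q with hc
  set K := ∫ z, ‖h z‖ ^ 2 ∂Q with hK
  have hK0 : 0 ≤ K := integral_nonneg fun z ↦ by positivity
  have hquad : ∀ ε : ℝ, 2 * ε * c ≤ ε ^ 2 * K := by
    intro ε
    have h1 := hmin ε
    have hae : MemLp (fun z ↦ a z - ε • h z) 2 Q := ha.sub (hh.const_smul ε)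
    rw [hsq ha, hsq hae, ENNReal.ofReal_le_ofReal_iff (integral_nonneg fun z ↦ by positivity)] at h1
    have i2 : Integrable (fun z ↦ ‖a z‖ ^ 2 - 2 * ε * inner ℝ (a z) (h z)) Q :=
      ia.sub (iah.const_mul _)
    have h2 : ∫ z, ‖a z - ε • h z‖ ^ 2 ∂Q =
        ∫ z, ‖a z‖ ^ 2 ∂Q - 2 * ε * c + ε ^ 2 * K := by
      rw [hc, hK, ← integral_const_mul, ← integral_const_mul,
        ← integral_sub ia (iah.const_mul _), ← integral_add i2 (ih.const_mul _)]
      refine integral_congr_ae (ae_of_all _ fun z ↦ ?_)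
      beta_reduce
      rw [norm_sub_sq_real, real_inner_smul_right, norm_smul, mul_pow, Real.norm_eq_abs, sq_abs]
      ring
    linarith
  by_contra hne
  -- The minimizing choice would be ε = c/K; adding 1 covers K = 0.
  have h1 := hquad (c / (K + 1))
  have hpos : 0 < c ^ 2 := by positivity
  have h2 : 2 * (c / (K + 1)) * c = 2 * c ^ 2 * (K + 1) / (K + 1) ^ 2 := by
    field_simp
  have h3 : (c / (K + 1)) ^ 2 * K = c ^ 2 * K / (K + 1) ^ 2 := by rw [div_pow]; ring
  rw [h2, h3, div_le_div_iff_of_pos_right (by positivity)] at h1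
  nlinarith

section Optimality

variable {d : ℕ} {Ω : Type*} [MeasurableSpace Ω] {P : Measure Ω} [IsProbabilityMeasure P]
  {X : Ω → Vec d} {M : Ω → Mask d} {v : Velocity d}

/-- The evaluation of a velocity field along the training data. -/
noncomputable def evalTraining (X : Ω → Vec d) (M : Ω → Mask d) (v : Velocity d)
    (z : (Ω × Ω) × ℝ) : Vec d :=
  v (mis (M z.1.1) (interp z.2 (X z.1.1, X z.1.2))) (obs (M z.1.1) (X z.1.1))
    (obs (M z.1.1) (X z.1.2)) (M z.1.1) z.2

/-- The training residual of a velocity field. -/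
noncomputable def trainingResidual (X : Ω → Vec d) (M : Ω → Mask d) (v : Velocity d)
    (z : (Ω × Ω) × ℝ) : Vec d :=
  X z.1.2 - X z.1.1 - evalTraining X M v z

lemma measurable_evalTraining (hX : Measurable X) (hM : Measurable M) (hv : v.IsMeasurable) :
    Measurable (evalTraining X M v) := by
  have hx0 : Measurable fun z : (Ω × Ω) × ℝ ↦ X z.1.1 := by fun_prop
  have hx1 : Measurable fun z : (Ω × Ω) × ℝ ↦ X z.1.2 := by fun_prop
  have hm : Measurable fun z : (Ω × Ω) × ℝ ↦ M z.1.1 := by fun_prop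
  have hi : Measurable fun z : (Ω × Ω) × ℝ ↦ interp z.2 (X z.1.1, X z.1.2) :=
    continuous_interp_time.measurable.comp ((hx0.prodMk hx1).prodMk measurable_snd)
  exact hv.comp ((measurable_mis.comp (hm.prodMk hi)).prodMk
    ((measurable_obs.comp (hm.prodMk hx0)).prodMk
      ((measurable_obs.comp (hm.prodMk hx1)).prodMk (hm.prodMk measurable_snd))))

lemma measurable_trainingResidual (hX : Measurable X) (hM : Measurable M) (hv : v.IsMeasurable) :
    Measurable (trainingResidual X M v) :=
  ((hX.comp (by fun_prop)).sub (hX.comp (by fun_prop))).sub (measurable_evalTraining hX hM hv)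

lemma objective_eq (hX : Measurable X) (hM : Measurable M) (hv : v.IsMeasurable) :
    objective P X M v = ∫⁻ z, ‖trainingResidual X M v z‖ₑ ^ 2 ∂(P.prod P).prod unitVolume := by
  have hr := measurable_trainingResidual hX hM hv
  rw [lintegral_prod_symm' _ (hr.enorm.pow_const 2), objective]
  refine lintegral_congr fun τ ↦ ?_
  rw [Measure.map_prod_map _ _ (hX.prodMk hM) hX, lintegral_map ?_ ((hX.prodMk hM).prodMap hX)]
  · rfl
  · have hm : Measurable fun p : (Vec d × Mask d) × Vec d ↦ p.1.2 := by fun_prop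
    have hx0 : Measurable fun p : (Vec d × Mask d) × Vec d ↦ p.1.1 := by fun_prop
    have hx1 : Measurable fun p : (Vec d × Mask d) × Vec d ↦ p.2 := by fun_prop
    have hi : Measurable fun p : (Vec d × Mask d) × Vec d ↦ (1 - τ) • p.1.1 + τ • p.2 := by
      fun_prop
    exact (((hx1.sub hx0).sub (hv.comp ((measurable_mis.comp (hm.prodMk hi)).prodMk
      ((measurable_obs.comp (hm.prodMk hx0)).prodMk
        ((measurable_obs.comp (hm.prodMk hx1)).prodMk (hm.prodMk
          measurable_const)))))).enorm).pow_const 2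

lemma memLp_two_of_lintegral {α : Type*} [MeasurableSpace α] {Q : Measure α} {f : α → Vec d}
    (hf : Measurable f) (h : ∫⁻ z, ‖f z‖ₑ ^ 2 ∂Q ≠ ∞) : MemLp f 2 Q := by
  refine ⟨hf.aestronglyMeasurable, ?_⟩
  rw [eLpNorm_lt_top_iff_lintegral_rpow_enorm_lt_top (by norm_num) (by norm_num)]
  simpa using h.lt_top

lemma MemLp.lintegral_enorm_sq_ne_top {α : Type*} [MeasurableSpace α] {Q : Measure α}
    {f : α → Vec d} (h : MemLp f 2 Q) : ∫⁻ z, ‖f z‖ₑ ^ 2 ∂Q ≠ ∞ := by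
  have := h.2
  rw [eLpNorm_lt_top_iff_lintegral_rpow_enorm_lt_top (by norm_num) (by norm_num)] at this
  simpa using this.ne

/-- The zero field has finite objective because X is square integrable, so the minimum is finite
too. -/
lemma memLp_trainingResidual (hX : Measurable X) (hM : Measurable M) (hX2 : MemLp X 2 P)
    (hv : IsOptimalVelocity P X M v) :
    MemLp (trainingResidual X M v) 2 ((P.prod P).prod unitVolume) := by
  refine memLp_two_of_lintegral (measurable_trainingResidual hX hM hv.1) ?_
  have h0 : Velocity.IsMeasurable (d := d) fun _ _ _ _ _ ↦ 0 := measurable_const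
  rw [← objective_eq hX hM hv.1]
  refine ne_top_of_le_ne_top ?_ (hv.2 _ h0)
  rw [objective_eq hX hM h0]
  have h1 : MemLp (fun z : (Ω × Ω) × ℝ ↦ X z.1.1) 2 ((P.prod P).prod unitVolume) :=
    (hX2.comp_fst P).comp_fst unitVolume
  have h2 : MemLp (fun z : (Ω × Ω) × ℝ ↦ X z.1.2) 2 ((P.prod P).prod unitVolume) :=
    (hX2.comp_snd P).comp_fst unitVolume
  have h3 : MemLp (trainingResidual X M fun _ _ _ _ _ ↦ 0) 2 ((P.prod P).prod unitVolume) := by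
    refine (h2.sub h1).congr_norm (measurable_trainingResidual hX hM h0).aestronglyMeasurable
      (ae_of_all _ fun z ↦ ?_)
    simp [trainingResidual, evalTraining]
  exact MemLp.lintegral_enorm_sq_ne_top h3

lemma integral_inner_trainingResidual_eq_zero (hX : Measurable X) (hM : Measurable M)
    (hX2 : MemLp X 2 P) (hv : IsOptimalVelocity P X M v) {h : Velocity d} (hh : h.IsMeasurable)
    {C : ℝ} (hC : ∀ y u w m τ, ‖h y u w m τ‖ ≤ C) :
    ∫ z, inner ℝ (trainingResidual X M v z) (evalTraining X M h z)
      ∂(P.prod P).prod unitVolume = 0 := by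
  refine integral_inner_eq_zero_of_forall_le (memLp_trainingResidual hX hM hX2 hv) ?_ fun ε ↦ ?_
  · exact MemLp.of_bound (measurable_evalTraining hX hM hh).aestronglyMeasurable C
      (ae_of_all _ fun z ↦ hC _ _ _ _ _)
  · have hvh : Velocity.IsMeasurable fun y u w m τ ↦ v y u w m τ + ε • h y u w m τ :=
      Measurable.add hv.1 (Measurable.const_smul hh ε)
    have := hv.2 _ hvh
    rw [objective_eq hX hM hv.1, objective_eq hX hM hvh] at this
    refine this.trans_eq (lintegral_congr fun z ↦ ?_)
    simp only [trainingResidual, evalTraining, sub_sub, add_assoc]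

end Optimality

/-! ### Orthogonality for data split by a fixed mask. -/

section SplitDefs

variable {d : ℕ} {Ω : Type*} {X : Ω → Vec d} {M : Ω → Mask d} {v : Velocity d}

/-- The observed and the missing part of the data. -/
noncomputable def split (X : Ω → Vec d) (m : Mask d) (ω : Ω) : Vec d × Vec d :=
  (obs m (X ω), mis m (X ω))

/-- The velocity field of the missing part under the mask `m`. -/
noncomputable def maskedField (v : Velocity d) (m : Mask d) (y u w : Vec d) (τ : ℝ) : Vec d :=
  mis m (v (mis m y) (obs m u) (obs m w) m τ)

lemma mis_interp (m : Mask d) (τ : ℝ) (p : Vec d × Vec d) :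
    mis m (interp τ p) = interp τ (mis m p.1, mis m p.2) := by
  rw [interp, interp, mis_add, mis_smul, mis_smul]

/-- The tested residual along the data split by the mask `m`. -/
noncomputable def splitResidual (X : Ω → Vec d) (m : Mask d) (v : Velocity d) (ψ : Vec d × ℝ → ℝ)
    (e : Vec d) (z : (Ω × Ω) × ℝ) : ℝ :=
  testedResidual (fun y τ ↦ maskedField v m y (obs m (X z.1.1)) (obs m (X z.1.2)) τ) ψ e
    (mis m (X z.1.1), mis m (X z.1.2)) z.2

/-- The projection onto missing coordinates is self-adjoint, so it can be moved from the residual to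
the test direction. -/
lemma splitResidual_eq {m : Mask d} {ψ : Vec d × ℝ → ℝ} {e : Vec d} {z : (Ω × Ω) × ℝ}
    (hz : M z.1.1 = m) :
    splitResidual X m v ψ e z = inner ℝ (trainingResidual X M v z)
      (ψ (mis m (interp z.2 (X z.1.1, X z.1.2)), z.2) • mis m e) := by
  have h1 : interp z.2 (mis m (X z.1.1), mis m (X z.1.2)) =
      mis m (interp z.2 (X z.1.1, X z.1.2)) := (mis_interp m z.2 (X z.1.1, X z.1.2)).symm
  rw [splitResidual, testedResidual, real_inner_smul_right, inner_mis_right, h1,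
    maskedField, trainingResidual, evalTraining, mis_sub, mis_sub, mis_mis, obs_obs, obs_obs, hz]

end SplitDefs

section Split

variable {d : ℕ} {Ω : Type*} [MeasurableSpace Ω] {P : Measure Ω} [IsProbabilityMeasure P]
  {X : Ω → Vec d} {M : Ω → Mask d} {v : Velocity d}

lemma measurable_split (hX : Measurable X) (m : Mask d) : Measurable (split X m) :=
  ((continuous_obs m).measurable.comp hX).prodMk ((continuous_mis m).measurable.comp hX)

lemma measurable_testedResidual_maskedField {ψ : Vec d × ℝ → ℝ} (hψ : IsTestFunction ψ) (m : Mask d)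
    (e : Vec d) (hv : v.IsMeasurable) :
    Measurable fun z : ((Vec d × Vec d) × Vec d × Vec d) × ℝ ↦
      testedResidual (fun y τ ↦ maskedField v m y z.1.1.1 z.1.2.1 τ) ψ e (z.1.1.2, z.1.2.2) z.2 := by
  have hi : Measurable fun z : ((Vec d × Vec d) × Vec d × Vec d) × ℝ ↦
      interp z.2 (z.1.1.2, z.1.2.2) :=
    (continuous_interp_time.comp (f := fun z : ((Vec d × Vec d) × Vec d × Vec d) × ℝ ↦
      ((z.1.1.2, z.1.2.2), z.2)) (by fun_prop)).measurable
  have ho := (continuous_obs m).measurable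
  have hs := (continuous_mis m).measurable
  have hb : Measurable fun z : ((Vec d × Vec d) × Vec d × Vec d) × ℝ ↦
      maskedField v m (interp z.2 (z.1.1.2, z.1.2.2)) z.1.1.1 z.1.2.1 z.2 :=
    hs.comp (hv.comp ((hs.comp hi).prodMk ((ho.comp (by fun_prop)).prodMk
      ((ho.comp (by fun_prop)).prodMk (measurable_const.prodMk measurable_snd)))))
  unfold testedResidual
  exact (hψ.continuous.measurable.comp (hi.prodMk measurable_snd)).mul
    (Measurable.inner ((by fun_prop : Measurable fun z : ((Vec d × Vec d) × Vec d × Vec d) × ℝ ↦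
      z.1.2.2 - z.1.1.2).sub hb) measurable_const)

lemma integrable_inner_trainingResidual (hX : Measurable X) (hM : Measurable M)
    (hX2 : MemLp X 2 P) (hv : IsOptimalVelocity P X M v) {h : (Ω × Ω) × ℝ → Vec d}
    (hh : Measurable h) {C : ℝ} (hC : ∀ z, ‖h z‖ ≤ C) :
    Integrable (fun z ↦ inner ℝ (trainingResidual X M v z) (h z)) ((P.prod P).prod unitVolume) := by
  have h1 : Integrable (trainingResidual X M v) ((P.prod P).prod unitVolume) :=
    (memLp_trainingResidual hX hM hX2 hv).integrable (by norm_num)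
  refine (h1.norm.mul_const C).mono' (h1.1.inner hh.aestronglyMeasurable) (ae_of_all _ fun z ↦ ?_)
  exact (norm_inner_le_norm _ _).trans (by gcongr; exact hC z)

lemma measurable_bump (hX : Measurable X) {ψ : Vec d × ℝ → ℝ} (hψ : IsTestFunction ψ) (m : Mask d)
    (e : Vec d) : Measurable fun z : (Ω × Ω) × ℝ ↦
      ψ (mis m (interp z.2 (X z.1.1, X z.1.2)), z.2) • mis m e := by
  have hi : Measurable fun z : (Ω × Ω) × ℝ ↦ interp z.2 (X z.1.1, X z.1.2) :=
    continuous_interp_time.measurable.comp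
      (((hX.comp (by fun_prop)).prodMk (hX.comp (by fun_prop))).prodMk measurable_snd)
  exact (hψ.continuous.measurable.comp (((continuous_mis m).measurable.comp hi).prodMk
    measurable_snd)).smul_const _

lemma map_split_prod (hX : Measurable X) (m : Mask d) (S : Set Ω) :
    ((((P.restrict S).map (split X m)).prod (P.map (split X m))).prod unitVolume) =
      (((P.restrict S).prod P).prod unitVolume).map
        fun z ↦ ((split X m z.1.1, split X m z.1.2), z.2) := by
  have hs := measurable_split hX m
  rw [Measure.map_prod_map _ _ hs hs]
  conv_lhs => rw [← Measure.map_id (μ := unitVolume)]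
  rw [Measure.map_prod_map _ _ (hs.prodMap hs) measurable_id]
  rfl

lemma measurable_split_prod (hX : Measurable X) (m : Mask d) :
    Measurable fun z : (Ω × Ω) × ℝ ↦ ((split X m z.1.1, split X m z.1.2), z.2) := by
  have hs := measurable_split hX m
  exact ((hs.comp (by fun_prop)).prodMk (hs.comp (by fun_prop))).prodMk measurable_snd

lemma integrable_testedResidual_split (hX : Measurable X) (hM : Measurable M)
    (hX2 : MemLp X 2 P) (hv : IsOptimalVelocity P X M v) (m : Mask d) {ψ : Vec d × ℝ → ℝ}
    (hψ : IsTestFunction ψ) (e : Vec d) :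
    Integrable (fun z : ((Vec d × Vec d) × Vec d × Vec d) × ℝ ↦
      testedResidual (fun y τ ↦ maskedField v m y z.1.1.1 z.1.2.1 τ) ψ e (z.1.1.2, z.1.2.2) z.2)
      ((((P.restrict (M ⁻¹' {m})).map (split X m)).prod (P.map (split X m))).prod unitVolume) := by
  have hSm : MeasurableSet (M ⁻¹' {m}) := hM (measurableSet_singleton m)
  rw [map_split_prod hX, integrable_map_measure
    (measurable_testedResidual_maskedField hψ m e hv.1).aestronglyMeasurable
    (measurable_split_prod hX m).aemeasurable]
  obtain ⟨C, hC⟩ := hψ.hasCompactSupport.exists_bound_of_continuous hψ.continuous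
  have hi := integrable_inner_trainingResidual hX hM hX2 hv (measurable_bump hX hψ m e)
    (C := C * ‖mis m e‖) fun z ↦ by
      rw [norm_smul]; gcongr; exact hC _
  have hle : ((P.restrict (M ⁻¹' {m})).prod P).prod unitVolume ≤ (P.prod P).prod unitVolume :=
    Measure.prod_mono (Measure.prod_mono Measure.restrict_le_self le_rfl) le_rfl
  refine (hi.mono_measure hle).congr ?_
  have : ∀ᵐ z ∂((P.restrict (M ⁻¹' {m})).prod P).prod unitVolume, M z.1.1 = m :=
    Measure.quasiMeasurePreserving_fst.ae (Measure.quasiMeasurePreserving_fst.ae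
      (ae_restrict_mem hSm))
  filter_upwards [this] with z hz
  exact (splitResidual_eq hz).symm

lemma integral_testedResidual_split_eq_zero (hX : Measurable X) (hM : Measurable M)
    (hX2 : MemLp X 2 P) (hv : IsOptimalVelocity P X M v) (m : Mask d) {ψ : Vec d × ℝ → ℝ}
    (hψ : IsTestFunction ψ) (e : Vec d) {A : Set (Vec d)} (hA : MeasurableSet A) :
    ∫ z, testedResidual (fun y τ ↦ maskedField v m y z.1.1.1 z.1.2.1 τ) ψ e (z.1.1.2, z.1.2.2) z.2
      ∂((((P.restrict (M ⁻¹' {m})).map (split X m)).restrict (A ×ˢ univ)).prod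
        ((P.map (split X m)).restrict (A ×ˢ univ))).prod unitVolume = 0 := by
  have hSm : MeasurableSet (M ⁻¹' {m}) := hM (measurableSet_singleton m)
  have ho := (continuous_obs m).measurable
  have hs := (continuous_mis m).measurable
  obtain ⟨C, hC⟩ := hψ.hasCompactSupport.exists_bound_of_continuous hψ.continuous
  classical
  -- The perturbation of v: active only for mask m and when both observed parts lie in A, which is
  -- possible because a velocity field may depend on both of them.
  let h : Velocity d := fun y u w m' τ ↦
    if m' = m ∧ u ∈ A ∧ w ∈ A then ψ (y, τ) • mis m e else 0
  have hh : h.IsMeasurable := by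
    refine Measurable.ite ?_ ?_ measurable_const
    · exact ((measurableSet_singleton m).preimage (by fun_prop)).inter
        ((hA.preimage (by fun_prop)).inter (hA.preimage (by fun_prop)))
    · exact (hψ.continuous.measurable.comp (by fun_prop)).smul_const _
  have hC' : ∀ y u w m' τ, ‖h y u w m' τ‖ ≤ C * ‖mis m e‖ := by
    intro y u w m' τ
    have hC0 : 0 ≤ C := (norm_nonneg _).trans (hC 0)
    simp only [h]
    split_ifs
    · rw [norm_smul]; gcongr; exact hC _
    · rw [norm_zero]; positivity
  have key := integral_inner_trainingResidual_eq_zero hX hM hX2 hv hh hC'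
  set S : Set Ω := (fun ω ↦ obs m (X ω)) ⁻¹' A with hS
  have hSA : MeasurableSet S := (ho.comp hX) hA
  have hpre : split X m ⁻¹' (A ×ˢ univ) = S := by
    ext ω; simp [split, hS]
  have hAu : MeasurableSet (A ×ˢ (univ : Set (Vec d))) := hA.prod MeasurableSet.univ
  have hsp := measurable_split hX m
  have hmeas : (((((P.restrict (M ⁻¹' {m})).map (split X m)).restrict (A ×ˢ univ)).prod
      ((P.map (split X m)).restrict (A ×ˢ univ))).prod unitVolume) =
      (((P.prod P).prod unitVolume).restrict (((S ∩ M ⁻¹' {m}) ×ˢ S) ×ˢ univ)).map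
        fun z ↦ ((split X m z.1.1, split X m z.1.2), z.2) := by
    have hvol : (((P.prod P).prod unitVolume).restrict (((S ∩ M ⁻¹' {m}) ×ˢ S) ×ˢ univ)) =
        ((P.restrict (S ∩ M ⁻¹' {m})).prod (P.restrict S)).prod unitVolume := by
      rw [← Measure.prod_restrict, ← Measure.prod_restrict, Measure.restrict_univ]
    rw [hvol, Measure.restrict_map hsp hAu, Measure.restrict_map hsp hAu, hpre,
      Measure.restrict_restrict hSA, Measure.map_prod_map _ _ hsp hsp]
    conv_lhs => rw [← Measure.map_id (μ := unitVolume)]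
    rw [Measure.map_prod_map _ _ (hsp.prodMap hsp) measurable_id]
    rfl
  rw [hmeas, integral_map (measurable_split_prod hX m).aemeasurable
    (measurable_testedResidual_maskedField hψ m e hv.1).aestronglyMeasurable,
    ← integral_indicator (((hSA.inter hSm).prod hSA).prod MeasurableSet.univ), ← key]
  refine integral_congr_ae (ae_of_all _ fun z ↦ ?_)
  by_cases hz : z ∈ ((S ∩ M ⁻¹' {m}) ×ˢ S) ×ˢ (univ : Set ℝ)
  · obtain ⟨⟨⟨hz1, hzm⟩, hz2⟩, -⟩ := hz
    have hzm' : M z.1.1 = m := hzm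
    have hz : z ∈ ((S ∩ M ⁻¹' {m}) ×ˢ S) ×ˢ (univ : Set ℝ) :=
      ⟨⟨⟨hz1, hzm⟩, hz2⟩, mem_univ _⟩
    rw [indicator_of_mem hz]
    have e1 : evalTraining X M h z = ψ (mis m (interp z.2 (X z.1.1, X z.1.2)), z.2) • mis m e := by
      simp only [evalTraining, h, hzm']
      exact if_pos ⟨trivial, hz1, hz2⟩
    simp only [e1]
    exact splitResidual_eq hzm'
  · rw [indicator_of_notMem hz]
    have e1 : evalTraining X M h z = 0 := by
      refine if_neg fun hc ↦ hz ?_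
      obtain ⟨h1, h2, h3⟩ := hc
      rw [h1] at h2 h3
      exact ⟨⟨⟨h2, h1⟩, h3⟩, mem_univ _⟩
    simp only [e1, inner_zero_right]

end Split

/-! ### Measurable form of closeness to the ODE, and its conditional version. -/

section Closeness

variable {d : ℕ} {b : Vec d → ℝ → Vec d} {q : ℕ → ℝ}

lemma continuous_chainPos (N : ℕ) (z : Vec d) (k : ℕ) :
    Continuous fun V : ℕ → Vec d ↦ chainPos N z V k := by
  unfold chainPos
  fun_prop

lemma continuous_chainDefect
    (hb : ContinuousOn (fun p : Vec d × ℝ ↦ b p.1 p.2) (univ ×ˢ Ioo 0 1)) (z : Vec d)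
    {N : ℕ} {t : ℝ} (ht : t ∈ Ioo (0 : ℝ) 1) (hN : 1 / (N : ℝ) ≤ 1 / 2) (hNt : 1 / (N : ℝ) ≤ t) :
    Continuous fun V : ℕ → Vec d ↦ chainDefect b N z V t := by
  unfold chainDefect
  refine continuous_finsetSum _ fun k _ ↦ ?_
  rcases eq_or_ne (cellTime N k t - cellTime N k (1 / 2)) 0 with h | h
  · simp only [h, zero_smul]; exact continuous_const
  · have hw := chainWeight_ne_zero (by norm_num) ht hN hNt h
    have hbt : Continuous fun y ↦ b y (k / N) := continuous_iff_continuousAt.2 fun y ↦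
      (continuousAt_field hb (p := (y, (k / N : ℝ))) hw).comp
        (f := fun y ↦ (y, (k / N : ℝ))) (by fun_prop)
    exact ((continuous_apply k).sub (hbt.comp (continuous_chainPos N z k))).const_smul
      (cellTime N k t - cellTime N k (1 / 2))

lemma isOpen_isApproxChain
    (hb : ContinuousOn (fun p : Vec d × ℝ ↦ b p.1 p.2) (univ ×ˢ Ioo 0 1)) (z : Vec d)
    (hq : ∀ i, q i ∈ Ioo (0 : ℝ) 1) (K : ℝ) {N : ℕ} (hN : 1 / (N : ℝ) ≤ 1 / 2) (n : ℕ) :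
    IsOpen {V : ℕ → Vec d | IsApproxChain b q K N n z V} := by
  unfold IsApproxChain
  simp only [ofPred_and, ofPred_forall]
  refine IsOpen.inter (isOpen_lt (by fun_prop) continuous_const) ?_
  refine (finite_lt_nat n).isOpen_biInter fun i _ ↦ isOpen_iInter_of_finite fun hi ↦ ?_
  exact isOpen_lt (continuous_chainDefect hb z (hq i) hN hi).norm continuous_const

/-- From some step on, the approximate chains with velocities among `D` started at `w.1` terminate
close to `w.2`. -/
def TerminatesClose (b : Vec d → ℝ → Vec d) (q : ℕ → ℝ) {ι : Type*} (D : ι → ℕ → Vec d) (ε K : ℝ)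
    (w : Vec d × Vec d) : Prop :=
  ∃ n₀, ∀ n ≥ n₀, ∀ j, IsApproxChain b q K (gridSize n) n w.1 (D j) →
    ‖chainPos (gridSize n) w.1 (D j) (gridSize n) - w.2‖ ≤ ε

/-- Being an approximate chain and ending farther than ε are both open conditions on the velocities,
so a counterexample could be moved into the dense family. This is why the inequalities in
`IsApproxChain` are strict. -/
lemma TerminatesClose.of_denseRange
    (hb : ContinuousOn (fun p : Vec d × ℝ ↦ b p.1 p.2) (univ ×ˢ Ioo 0 1))
    (hq : ∀ i, q i ∈ Ioo (0 : ℝ) 1) {ι : Type*} {D : ι → ℕ → Vec d} (hD : DenseRange D) {ε K : ℝ}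
    {w : Vec d × Vec d} (h : TerminatesClose b q D ε K w) : TerminatesClose b q id ε K w := by
  obtain ⟨n₀, hn₀⟩ := h
  refine ⟨n₀, fun n hn V hV ↦ ?_⟩
  by_contra hcon
  obtain ⟨j, hj1, hj2⟩ := hD.exists_mem_open
    ((isOpen_isApproxChain hb w.1 hq K (one_div_gridSize_le n) n).inter
      (isOpen_lt continuous_const
        ((continuous_chainPos (gridSize n) w.1 (gridSize n)).sub continuous_const).norm))
    ⟨V, hV, not_le.1 hcon⟩
  exact absurd (hn₀ n hn j hj1) (not_le.2 hj2)

lemma TerminatesClose.mono {ι : Type*} {D : ι → ℕ → Vec d} {ε ε' K K' : ℝ} {w : Vec d × Vec d}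
    (h : TerminatesClose b q D ε K w) (hε : ε ≤ ε') (hK0 : 0 ≤ K') (hK : K' ≤ K) :
    TerminatesClose b q D ε' K' w := by
  obtain ⟨n₀, hn₀⟩ := h
  refine ⟨n₀, fun n hn j hj ↦ (hn₀ n hn j ⟨hj.1.trans_le ?_, hj.2⟩).trans hε⟩
  gcongr

/-- Countability of the family of velocities makes the condition a countable combination of
measurable ones; a quantifier over all velocities would not give this. -/
lemma measurableSet_terminatesClose {b : Vec d → Vec d → ℝ → Vec d}
    (hb : Measurable fun p : Vec d × Vec d × ℝ ↦ b p.1 p.2.1 p.2.2) {ι : Type*} [Countable ι]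
    (D : ι → ℕ → Vec d) (ε K : ℝ) :
    MeasurableSet {p : Vec d × Vec d × Vec d | TerminatesClose (b p.1) q D ε K p.2} := by
  have hpos : ∀ N k j, Measurable fun p : Vec d × Vec d × Vec d ↦ chainPos N p.2.1 (D j) k := by
    intro N k j
    unfold chainPos
    fun_prop
  have hdef : ∀ N j t, Measurable fun p : Vec d × Vec d × Vec d ↦
      chainDefect (b p.1) N p.2.1 (D j) t := by
    intro N j t
    unfold chainDefect
    refine Finset.measurable_fun_sum _ fun k _ ↦ ?_
    exact (measurable_const.sub
      (hb.comp (measurable_fst.prodMk ((hpos N k j).prodMk measurable_const)))).const_smul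
        (cellTime N k t - cellTime N k (1 / 2))
  have happ : ∀ N n j, MeasurableSet {p : Vec d × Vec d × Vec d |
      IsApproxChain (b p.1) q K N n p.2.1 (D j)} := by
    intro N n j
    unfold IsApproxChain
    simp only [ofPred_and, ofPred_forall]
    refine MeasurableSet.inter (MeasurableSet.const _) ?_
    exact MeasurableSet.iInter fun i ↦ MeasurableSet.iInter fun _ ↦ MeasurableSet.iInter fun hi ↦
      measurableSet_lt (hdef N j _).norm measurable_const
  have hcl : ∀ n j, MeasurableSet {p : Vec d × Vec d × Vec d |
      ‖chainPos (gridSize n) p.2.1 (D j) (gridSize n) - p.2.2‖ ≤ ε} := fun n j ↦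
    measurableSet_le ((hpos _ _ _).sub (by fun_prop)).norm measurable_const
  unfold TerminatesClose
  simp only [ofPred_exists, ofPred_forall]
  refine MeasurableSet.iUnion fun n₀ ↦ MeasurableSet.iInter fun n ↦ MeasurableSet.iInter fun _ ↦
    MeasurableSet.iInter fun j ↦ ?_
  exact ((happ (gridSize n) n j).imp (hcl n j))

variable {Ω : Type*} [MeasurableSpace Ω] {Q : Measure Ω} [IsProbabilityMeasure Q]

/-- Uniqueness of ODE solutions is not visibly a measurable condition and so cannot be disintegrated
directly. Closeness along a dense sequence can, and for almost every u it then extends to all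
velocities by density. Countably many levels cover all ε and K by monotonicity. -/
lemma ae_condDistrib_terminatesClose {b : Vec d → Vec d → ℝ → Vec d}
    (hbm : Measurable fun p : Vec d × Vec d × ℝ ↦ b p.1 p.2.1 p.2.2) (hq : ∀ i, q i ∈ Ioo (0 : ℝ) 1)
    (hqd : Ioo (0 : ℝ) 1 ⊆ closure (range q)) {U : Ω → Vec d} {W : Ω → Vec d × Vec d}
    (hU : Measurable U) (hW : Measurable W)
    (hb : ∀ᵐ u ∂Q.map U, ContinuousOn (fun p : Vec d × ℝ ↦ b u p.1 p.2) (univ ×ˢ Ioo 0 1))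
    (hode : ∀ᵐ ω ∂Q, ∀ Z, IsODESolution (b (U ω)) (W ω).1 Z → Z 1 = (W ω).2) :
    ∀ᵐ u ∂Q.map U, ∀ ε > 0, ∀ K > 0, ∀ᵐ w ∂condDistrib W U Q u, TerminatesClose (b u) q id ε K w := by
  have hbU := ae_of_ae_map hU.aemeasurable hb
  set D := TopologicalSpace.denseSeq (ℕ → Vec d) with hD
  have h1 : ∀ k : ℕ, ∀ᵐ u ∂Q.map U, ∀ᵐ w ∂condDistrib W U Q u,
      TerminatesClose (b u) q D (1 / ((k : ℝ) + 1)) (k + 1) w := by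
    intro k
    have h2 : ∀ᵐ p ∂Q.map (fun ω ↦ (U ω, W ω)),
        TerminatesClose (b p.1) q D (1 / ((k : ℝ) + 1)) (k + 1) p.2 := by
      rw [ae_map_iff (hU.prodMk hW).aemeasurable (measurableSet_terminatesClose hbm D _ _)]
      filter_upwards [hbU, hode] with ω hω hsol
      obtain ⟨n₀, hn₀⟩ := chainPos_terminal_close hω hq hqd tendsto_gridSize gridSize_ne_zero hsol
        (K := (k : ℝ) + 1) (by positivity) (ε := 1 / ((k : ℝ) + 1)) (by positivity)
      exact ⟨n₀, fun n hn j hj ↦ (hn₀ n hn _ hj).le⟩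
    rw [← compProd_map_condDistrib hW.aemeasurable] at h2
    exact Measure.ae_ae_of_ae_compProd h2
  filter_upwards [ae_all_iff.2 h1, hb] with u hu hbu ε hε K hK
  obtain ⟨k₁, hk₁⟩ := exists_nat_one_div_lt hε
  obtain ⟨k₂, hk₂⟩ := exists_nat_ge K
  filter_upwards [hu (max k₁ k₂)] with w hw
  refine (hw.of_denseRange hbu hq (TopologicalSpace.denseRange_denseSeq _)).mono ?_ hK.le ?_
  · refine le_trans ?_ hk₁.le
    gcongr
    exact le_max_left _ _
  · have : (k₂ : ℝ) ≤ (max k₁ k₂ : ℕ) := by exact_mod_cast le_max_right _ _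
    linarith

end Closeness

/-! ### Moments of conditional laws. -/

section Moments

lemma memLp_cond {Ω E : Type*} [MeasurableSpace Ω] [NormedAddCommGroup E] {Q : Measure Ω}
    {f : Ω → E} (hf : MemLp f 2 Q) {s : Set Ω}
    (hs : Q s ≠ 0) : MemLp f 2 (Q[|s]) :=
  (hf.restrict s).smul_measure (ENNReal.inv_ne_top.2 hs)

variable {d : ℕ} {Ω : Type*} [MeasurableSpace Ω] {Q : Measure Ω} [IsProbabilityMeasure Q]

lemma ae_memLp_condDistrib {U Y : Ω → Vec d} (hU : Measurable U) (hY : Measurable Y)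
    (hY2 : MemLp Y 2 Q) : ∀ᵐ u ∂Q.map U, MemLp (fun x ↦ x) 2 (condDistrib Y U Q u) := by
  have hm : Measurable fun p : Vec d × Vec d ↦ ‖p.2‖ₑ ^ 2 := by fun_prop
  have h1 : ∫⁻ u, ∫⁻ x, ‖x‖ₑ ^ 2 ∂condDistrib Y U Q u ∂Q.map U ≠ ∞ := by
    have h2 := Measure.lintegral_compProd (μ := Q.map U) (κ := condDistrib Y U Q) hm
    rw [← h2, compProd_map_condDistrib hY.aemeasurable, lintegral_map hm (hU.prodMk hY)]
    exact MemLp.lintegral_enorm_sq_ne_top hY2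
  have h2 : Measurable fun u ↦ ∫⁻ x, ‖x‖ₑ ^ 2 ∂condDistrib Y U Q u :=
    hm.lintegral_kernel_prod_right'
  filter_upwards [ae_lt_top h2 h1] with u hu
  exact memLp_two_of_lintegral measurable_id hu.ne

lemma lintegral_enorm_sub_sq_ne_top {μ ν : Measure (Vec d)} [IsProbabilityMeasure μ]
    [IsProbabilityMeasure ν] (hμ : MemLp (fun x ↦ x) 2 μ) (hν : MemLp (fun x ↦ x) 2 ν) :
    ∫⁻ p, ‖p.2 - p.1‖ₑ ^ 2 ∂μ.prod ν ≠ ∞ :=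
  MemLp.lintegral_enorm_sq_ne_top (f := fun p : Vec d × Vec d ↦ p.2 - p.1)
    ((hν.comp_snd μ).sub (hμ.comp_fst ν))

lemma lintegral_enorm_ne_top {f : Ω → Vec d} (hf : MemLp f 2 Q) : ∫⁻ ω, ‖f ω‖ₑ ∂Q ≠ ∞ :=
  (hf.integrable (by norm_num)).2.ne

end Moments

/-! ### Solutions of the masked equation. -/

section Solutions

variable {d : ℕ}

lemma apply_eq_of_hasDerivAt {Z Z' : ℝ → Vec d} (hZ : ContinuousOn Z (Icc 0 1))
    (hd : ∀ τ ∈ Ioo (0 : ℝ) 1, HasDerivAt Z (Z' τ) τ) {i : Fin d}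
    (hi : ∀ τ ∈ Ioo (0 : ℝ) 1, Z' τ i = 0) {τ : ℝ} (hτ : τ ∈ Ioo (0 : ℝ) 1) : Z τ i = Z 0 i := by
  have hc : ContinuousOn (fun t ↦ Z t i) (Icc 0 τ) :=
    (EuclideanSpace.proj (𝕜 := ℝ) i).continuous.comp_continuousOn
      (hZ.mono (Icc_subset_Icc_right hτ.2.le))
  have hd' : ∀ t ∈ Ioo (0 : ℝ) τ, HasDerivAt (fun t ↦ Z t i) 0 t := by
    intro t ht
    have ht' : t ∈ Ioo (0 : ℝ) 1 := ⟨ht.1, ht.2.trans hτ.2⟩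
    rw [← hi t ht']
    exact (EuclideanSpace.proj (𝕜 := ℝ) i).hasFDerivAt.comp_hasDerivAt t (hd t ht')
  obtain ⟨c, -, h⟩ := exists_hasDerivAt_eq_slope (fun t ↦ Z t i) (fun _ ↦ 0) hτ.1 hc hd'
  have h' := (eq_div_iff (sub_pos.2 hτ.1).ne').1 h
  linarith

/-- The observed coordinates have zero velocity and start at 0, so they stay 0 and the projection of
the position inside `maskedField` is the identity along the solution. -/
lemma IsODESolution.isImputationSolution {v : Velocity d} {m : Mask d} {x z : Vec d}
    {Z : ℝ → Vec d} (hz : mis m z = z)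
    (hZ : IsODESolution (fun y τ ↦ maskedField v m y (obs m x) (obs m x) τ) z Z) :
    IsImputationSolution v m x z Z := by
  refine ⟨hZ.1, hZ.2.1, fun τ hτ ↦ ?_⟩
  have hpad : mis m (Z τ) = Z τ := by
    ext i
    by_cases hm : m i
    · have h1 := apply_eq_of_hasDerivAt hZ.1 hZ.2.2 (i := i)
        (fun τ _ ↦ by simp [maskedField, mis_apply, hm]) hτ
      have h2 : z i = 0 := by rw [← hz]; simp [mis_apply, hm]
      rw [h1, hZ.2.1, h2]
      simp [mis_apply, hm]
    · simp [mis_apply, hm]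
  have := hZ.2.2 τ hτ
  simp only [maskedField, obs_obs, hpad] at this
  exact this

lemma HasUniqueTerminalValue.eq_of_isODESolution {v : Velocity d} {m : Mask d} {x z z₁ : Vec d}
    (h : HasUniqueTerminalValue v m x z z₁) (hz : mis m z = z) {Z : ℝ → Vec d}
    (hZ : IsODESolution (fun y τ ↦ maskedField v m y (obs m x) (obs m x) τ) z Z) : Z 1 = z₁ := by
  obtain ⟨Z', -, h1, huniq⟩ := h
  rw [huniq Z (hZ.isImputationSolution hz) ⟨zero_le_one, le_rfl⟩, h1]

end Solutions

/-! ### The law of the seed. -/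

section Seed

lemma map_restrict_mask_eq {d : ℕ} {Ω : Type*} [MeasurableSpace Ω] {P : Measure Ω}
    {X Y : Ω → Vec d} {M : Ω → Mask d} (hX : Measurable X) (hM : Measurable M)
    (hY : Measurable Y) (m : Mask d) :
    (P.restrict (M ⁻¹' {m})).map (fun ω ↦ (obs m (X ω), Y ω)) =
      ((P.map fun ω ↦ ((obs (M ω) (X ω), M ω), Y ω)).restrict {p | p.1.2 = m}).map
        fun p ↦ (p.1.1, p.2) := by
  have hT : Measurable fun ω ↦ (obs (M ω) (X ω), M ω) :=
    (measurable_obs.comp (hM.prodMk hX)).prodMk hM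
  have hset : MeasurableSet {p : (Vec d × Mask d) × Vec d | p.1.2 = m} :=
    (measurableSet_singleton m).preimage (by fun_prop)
  rw [Measure.restrict_map (hT.prodMk hY) hset, Measure.map_map (by fun_prop) (hT.prodMk hY)]
  refine Measure.map_congr ?_
  filter_upwards [ae_restrict_mem (hM (measurableSet_singleton m))] with ω hω
  have : M ω = m := hω
  simp [this]

variable {d : ℕ} {Ω : Type*} [MeasurableSpace Ω] {P : Measure Ω} [IsProbabilityMeasure P]
  {X Z₀ : Ω → Vec d} {M : Ω → Mask d}

lemma IsInitialSeed.map_eq (hinit : IsInitialSeed P X M Z₀) (hX : Measurable X) (hM : Measurable M)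
    (hZ₀ : Measurable Z₀) :
    P.map (fun ω ↦ ((obs (M ω) (X ω), M ω), Z₀ ω)) =
      P.map fun ω ↦ ((obs (M ω) (X ω), M ω), mis (M ω) (X ω)) := by
  have hmis : Measurable fun ω ↦ mis (M ω) (X ω) := measurable_mis.comp (hM.prodMk hX)
  rw [← compProd_map_condDistrib (X := fun ω ↦ (obs (M ω) (X ω), M ω)) hZ₀.aemeasurable,
    ← compProd_map_condDistrib (X := fun ω ↦ (obs (M ω) (X ω), M ω)) hmis.aemeasurable]
  exact Measure.compProd_congr hinit

/-- Jointly with the observation, the seed has the law of the missing part, which is zero on the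
observed coordinates. -/
lemma IsInitialSeed.ae_mis_eq (hinit : IsInitialSeed P X M Z₀) (hX : Measurable X)
    (hM : Measurable M) (hZ₀ : Measurable Z₀) : ∀ᵐ ω ∂P, mis (M ω) (Z₀ ω) = Z₀ ω := by
  have hmis : Measurable fun ω ↦ mis (M ω) (X ω) := measurable_mis.comp (hM.prodMk hX)
  have hT : Measurable fun ω ↦ (obs (M ω) (X ω), M ω) :=
    (measurable_obs.comp (hM.prodMk hX)).prodMk hM
  have hset : MeasurableSet {p : (Vec d × Mask d) × Vec d | mis p.1.2 p.2 = p.2} :=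
    measurableSet_eq_fun (measurable_mis.comp
      (((measurable_snd.comp measurable_fst)).prodMk measurable_snd)) measurable_snd
  have h1 : ∀ᵐ p ∂P.map (fun ω ↦ ((obs (M ω) (X ω), M ω), mis (M ω) (X ω))),
      mis p.1.2 p.2 = p.2 := by
    rw [ae_map_iff (hT.prodMk hmis).aemeasurable hset]
    exact ae_of_all _ fun ω ↦ mis_mis _ _
  rw [← hinit.map_eq hX hM hZ₀, ae_map_iff (hT.prodMk hZ₀).aemeasurable hset] at h1
  exact h1

/-- The joint laws given M = m coincide, and the chosen conditional kernel depends on the joint law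
alone, so the equality holds at every point. -/
lemma IsInitialSeed.condDistrib_eq (hinit : IsInitialSeed P X M Z₀) (hX : Measurable X)
    (hM : Measurable M) (hZ₀ : Measurable Z₀) (m : Mask d) :
    condDistrib Z₀ (fun ω ↦ obs m (X ω)) (P[|M ⁻¹' {m}]) =
      condDistrib (fun ω ↦ mis m (X ω)) (fun ω ↦ obs m (X ω)) (P[|M ⁻¹' {m}]) := by
  have hmis : Measurable fun ω ↦ mis (M ω) (X ω) := measurable_mis.comp (hM.prodMk hX)
  have h1 : (P.restrict (M ⁻¹' {m})).map (fun ω ↦ (obs m (X ω), mis m (X ω))) =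
      (P.restrict (M ⁻¹' {m})).map fun ω ↦ (obs m (X ω), mis (M ω) (X ω)) := by
    refine Measure.map_congr ?_
    filter_upwards [ae_restrict_mem (hM (measurableSet_singleton m))] with ω hω
    have : M ω = m := hω
    simp [this]
  have h2 : (P[|M ⁻¹' {m}]).map (fun ω ↦ (obs m (X ω), Z₀ ω)) =
      (P[|M ⁻¹' {m}]).map fun ω ↦ (obs m (X ω), mis m (X ω)) := by
    rw [ProbabilityTheory.cond, Measure.map_smul, Measure.map_smul, h1,
      map_restrict_mask_eq hX hM hZ₀, map_restrict_mask_eq hX hM hmis, hinit.map_eq hX hM hZ₀]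
  rw [condDistrib, condDistrib]
  simp only [h2]

end Seed

/-! ### The conditional law of the endpoint. -/

section Terminal

variable {d : ℕ} {Ω : Type*} [MeasurableSpace Ω] {P : Measure Ω} [IsProbabilityMeasure P]
  {X Z₀ : Ω → Vec d} {M : Ω → Mask d} {v : Velocity d}

/-- The two endpoints have different conditional laws: the mask belongs to X₀ only, so X₀ is
conditioned on M = m whereas the independent X₁ is not. This asymmetry is what removes the selection
by the mask. -/
lemma ae_integral_testedResidual_condDistrib_eq_zero (hX : Measurable X) (hM : Measurable M)
    (hX2 : MemLp X 2 P) (hv : IsOptimalVelocity P X M v) {m : Mask d} (hm : P (M ⁻¹' {m}) ≠ 0) :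
    ∀ᵐ u ∂obsLaw P X M m, (∀ y, ∀ τ ∈ Ioo (0 : ℝ) 1, ContinuousAt
        (fun q : Vec d × Vec d × Vec d × ℝ ↦ maskedField v m q.1 q.2.1 q.2.2.1 q.2.2.2)
        (y, u, u, τ)) →
      ∀ ψ, IsTestFunction ψ → ∀ e,
        ∫ x, (∫ τ in Icc (0 : ℝ) 1, testedResidual (fun y τ ↦ maskedField v m y u u τ) ψ e x τ)
          ∂(condDistrib (fun ω ↦ mis m (X ω)) (fun ω ↦ obs m (X ω)) (P[|M ⁻¹' {m}]) u).prod
            (condDistrib (fun ω ↦ mis m (X ω)) (fun ω ↦ obs m (X ω)) P u) = 0 := by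
  have := cond_isProbabilityMeasure hm
  have hsp := measurable_split hX m
  have hmis : Measurable fun ω ↦ mis m (X ω) := (continuous_mis m).measurable.comp hX
  have hobs : Measurable fun ω ↦ obs m (X ω) := (continuous_obs m).measurable.comp hX
  have hmis2 : MemLp (fun ω ↦ mis m (X ω)) 2 P := (misL m).comp_memLp' hX2
  have hen : Measurable fun p : Vec d × Vec d ↦ ‖p.2‖ₑ := by fun_prop
  have hθ : (P[|M ⁻¹' {m}]).map (split X m) =
      (P (M ⁻¹' {m}))⁻¹ • (P.restrict (M ⁻¹' {m})).map (split X m) := by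
    rw [ProbabilityTheory.cond, Measure.map_smul]
  have key := ae_integral_testedResidual_eq_zero (θ := (P[|M ⁻¹' {m}]).map (split X m))
    (θ' := P.map (split X m)) (v := maskedField v m) ?_ ?_ ?_ ?_ ?_
  · have hfst : ((P[|M ⁻¹' {m}]).map (split X m)).fst = obsLaw P X M m :=
      Measure.fst_map_prodMk hmis
    rw [hfst] at key
    filter_upwards [key] with u hu
    rw [condDistrib, condDistrib]
    exact hu
  · rw [lintegral_map hen hsp]
    exact lintegral_enorm_ne_top (memLp_cond hmis2 hm)
  · rw [lintegral_map hen hsp]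
    exact lintegral_enorm_ne_top hmis2
  · exact (cond_absolutelyContinuous.map hsp).map measurable_fst
  · intro ψ hψ e
    rw [hθ, Measure.prod_smul_left, Measure.prod_smul_left]
    exact (integrable_testedResidual_split hX hM hX2 hv m hψ e).smul_measure
      (ENNReal.inv_ne_top.2 hm)
  · intro ψ hψ e A hA
    rw [hθ, Measure.restrict_smul, Measure.prod_smul_left, Measure.prod_smul_left,
      integral_smul_measure, integral_testedResidual_split_eq_zero hX hM hX2 hv m hψ e hA, smul_zero]

theorem condDistrib_terminal_ae_eq (hX : Measurable X) (hM : Measurable M) (hZ₀ : Measurable Z₀)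
    (hX2 : MemLp X 2 P) (hv : IsOptimalVelocity P X M v) {m : Mask d} (hm : P (M ⁻¹' {m}) ≠ 0)
    (hvc : v.IsContinuousOnDiagonal m (obsLaw P X M m)) (hinit : IsInitialSeed P X M Z₀)
    {G : Ω → Vec d} (hG : Measurable G)
    (hode : ∀ᵐ ω ∂P, HasUniqueTerminalValue v (M ω) (X ω) (Z₀ ω) (G ω)) :
    condDistrib G (fun ω ↦ obs m (X ω)) (P[|M ⁻¹' {m}]) =ᵐ[obsLaw P X M m]
      condDistrib (fun ω ↦ mis m (X ω)) (fun ω ↦ obs m (X ω)) P := by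
  have := cond_isProbabilityMeasure hm
  have hmis : Measurable fun ω ↦ mis m (X ω) := (continuous_mis m).measurable.comp hX
  have hobs : Measurable fun ω ↦ obs m (X ω) := (continuous_obs m).measurable.comp hX
  have hmis2 : MemLp (fun ω ↦ mis m (X ω)) 2 P := (misL m).comp_memLp' hX2
  have hac : obsLaw P X M m ≪ P.map fun ω ↦ obs m (X ω) := cond_absolutelyContinuous.map hobs
  have hcont : ∀ᵐ u ∂obsLaw P X M m, ∀ y, ∀ τ ∈ Ioo (0 : ℝ) 1, ContinuousAt
      (fun q : Vec d × Vec d × Vec d × ℝ ↦ maskedField v m q.1 q.2.1 q.2.2.1 q.2.2.2)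
      (y, u, u, τ) := by
    filter_upwards [hvc] with u hu y τ hτ
    exact (continuous_mis m).continuousAt.comp (hu y τ hτ)
  obtain ⟨q, hq, hqd⟩ := exists_dense_seq_Ioo
  have hbm : Measurable fun p : Vec d × Vec d × ℝ ↦ maskedField v m p.2.1 p.1 p.1 p.2.2 := by
    have ho := (continuous_obs m).measurable
    have hs := (continuous_mis m).measurable
    exact hs.comp (hv.1.comp ((hs.comp (by fun_prop)).prodMk ((ho.comp (by fun_prop)).prodMk
      ((ho.comp (by fun_prop)).prodMk (measurable_const.prodMk (by fun_prop))))))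
  have hode' : ∀ᵐ ω ∂P[|M ⁻¹' {m}], ∀ Z, IsODESolution
      (fun y τ ↦ maskedField v m y (obs m (X ω)) (obs m (X ω)) τ) (Z₀ ω) Z → Z 1 = G ω := by
    filter_upwards [cond_absolutelyContinuous.ae_le hode,
      cond_absolutelyContinuous.ae_le (hinit.ae_mis_eq hX hM hZ₀),
      ae_cond_mem (hM (measurableSet_singleton m))] with ω h1 h2 h3 Z hZ
    have h3' : M ω = m := h3
    rw [h3'] at h1 h2
    exact h1.eq_of_isODESolution h2 hZ
  have hclose := ae_condDistrib_terminatesClose (Q := P[|M ⁻¹' {m}])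
    (b := fun u y τ ↦ maskedField v m y u u τ) hbm hq hqd hobs (hZ₀.prodMk hG)
    (hcont.mono fun u hu ↦ continuousOn_diagonal hu) hode'
  have hfst := condDistrib_comp (mβ := inferInstance) (μ := P[|M ⁻¹' {m}]) (fun ω ↦ obs m (X ω))
    (hZ₀.prodMk hG).aemeasurable measurable_fst
  have hsnd := condDistrib_comp (mβ := inferInstance) (μ := P[|M ⁻¹' {m}]) (fun ω ↦ obs m (X ω))
    (hZ₀.prodMk hG).aemeasurable measurable_snd
  filter_upwards [hcont, ae_integral_testedResidual_condDistrib_eq_zero hX hM hX2 hv hm,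
    ae_memLp_condDistrib hobs hmis (memLp_cond hmis2 hm),
    hac.ae_le (ae_memLp_condDistrib hobs hmis hmis2), hclose, hfst, hsnd]
    with u hc horth hμ2 hν2 hcl h1 h2
  have hb := continuousOn_diagonal hc
  rw [Kernel.map_apply _ measurable_fst] at h1
  rw [Kernel.map_apply _ measurable_snd] at h2
  -- The base space consists of pairs (start, end), under the conditional law of (Z₀, Z₁) given the
  -- observed part u.
  refine Eq.trans h2 (map_terminal_eq
    (μ := condDistrib (fun ω ↦ mis m (X ω)) (fun ω ↦ obs m (X ω)) (P[|M ⁻¹' {m}]) u)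
    (z₀ := Prod.fst) (z₁ := Prod.snd)
    (lintegral_enorm_sub_sq_ne_top hμ2 hν2) hb
    (fun t ht ↦ integral_velocityKernel_eq (hμ2.integrable (by norm_num))
      (hν2.integrable (by norm_num)) hb (horth hc) ht) measurable_fst measurable_snd ?_ hq ?_)
  · rw [← h1, ← hinit.condDistrib_eq hX hM hZ₀ m]
    rfl
  · intro ε hε K hK
    filter_upwards [hcl (ε / 2) (by positivity) K hK] with w ⟨n₀, hn₀⟩
    exact ⟨n₀, fun n hn V hV ↦ (hn₀ n hn V hV).trans_lt (by linarith)⟩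

end Terminal

/-! ### Optimality for the Kullback-Leibler divergence. -/

lemma map_prodMk_eq_compProd_of_forall_restrict {Ω α β γ : Type*} [MeasurableSpace Ω]
    [MeasurableSpace α] [MeasurableSpace β] [MeasurableSpace γ] [Countable β]
    [MeasurableSingletonClass β] {Q : Measure Ω} [IsFiniteMeasure Q] {U : Ω → α} {N : Ω → β}
    {Y : Ω → γ} (hU : Measurable U) (hN : Measurable N) (hY : Measurable Y)
    (η : Kernel (α × β) γ) [IsMarkovKernel η]
    (h : ∀ m, (Q.restrict (N ⁻¹' {m})).map (fun ω ↦ (U ω, Y ω)) =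
      (Q.restrict (N ⁻¹' {m})).map U ⊗ₘ η.comap (fun u ↦ (u, m)) measurable_prodMk_right) :
    Q.map (fun ω ↦ ((U ω, N ω), Y ω)) = Q.map (fun ω ↦ (U ω, N ω)) ⊗ₘ η := by
  have hQ : Q = Measure.sum fun m ↦ Q.restrict (N ⁻¹' {m}) := by
    rw [← Measure.restrict_iUnion (fun m m' hmm ↦ ?_) fun m ↦ hN (measurableSet_singleton m)]
    · rw [← preimage_iUnion, iUnion_of_singleton, preimage_univ, Measure.restrict_univ]
    · exact Disjoint.preimage _ (disjoint_singleton.2 hmm)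
  ext s hs
  have hηs : Measurable fun p ↦ η p (Prod.mk p ⁻¹' s) := Kernel.measurable_kernel_prodMk_left hs
  have hUN : Measurable fun ω ↦ (U ω, N ω) := hU.prodMk hN
  rw [Measure.map_apply (hUN.prodMk hY) hs, Measure.compProd_apply hs, lintegral_map hηs hUN]
  conv_lhs => rw [hQ]
  conv_rhs => rw [hQ]
  rw [lintegral_sum_measure, Measure.sum_apply _ ((hUN.prodMk hY) hs)]
  congr 1 with m
  have hae : ∀ᵐ ω ∂Q.restrict (N ⁻¹' {m}), N ω = m :=
    ae_restrict_mem (hN (measurableSet_singleton m))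
  have hsm : MeasurableSet {p : α × γ | ((p.1, m), p.2) ∈ s} :=
    hs.preimage (((measurable_fst.prodMk measurable_const)).prodMk measurable_snd)
  have h1 : Q.restrict (N ⁻¹' {m}) ((fun ω ↦ ((U ω, N ω), Y ω)) ⁻¹' s) =
      (Q.restrict (N ⁻¹' {m})).map (fun ω ↦ (U ω, Y ω)) {p | ((p.1, m), p.2) ∈ s} := by
    rw [Measure.map_apply (hU.prodMk hY) hsm]
    refine measure_congr ?_
    filter_upwards [hae] with ω hω
    exact propext (by rw [← hω]; exact Iff.rfl)
  rw [h1, h m, Measure.compProd_apply hsm,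
    lintegral_map (Kernel.measurable_kernel_prodMk_left hsm) hU]
  refine lintegral_congr_ae ?_
  filter_upwards [hae] with ω hω
  rw [Kernel.comap_apply, hω]
  rfl

section Divergence

variable {d : ℕ} {Ω : Type*} [MeasurableSpace Ω] {P : Measure Ω} [IsProbabilityMeasure P]
  {X Z₀ : Ω → Vec d} {M : Ω → Mask d}

/-- The observed part of the data together with the mask. -/
noncomputable def observe (p : Vec d × Mask d) : Vec d × Mask d := (obs p.2 p.1, p.2)

/-- The combination of observed and missing parts. -/
noncomputable def recombine (p : (Vec d × Mask d) × Vec d) : Vec d × Mask d :=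
  (p.1.1 + mis p.1.2 p.2, p.1.2)

lemma measurable_observe : Measurable (observe (d := d)) :=
  (measurable_obs.comp (measurable_snd.prodMk measurable_fst)).prodMk measurable_snd

lemma measurable_recombine : Measurable (recombine (d := d)) :=
  ((measurable_fst.comp measurable_fst).add (measurable_mis.comp
    ((measurable_snd.comp measurable_fst).prodMk measurable_snd))).prodMk
    (measurable_snd.comp measurable_fst)

lemma measurable_imputed {g : Imputer d} (hX : Measurable X) (hM : Measurable M)
    (hZ₀ : Measurable Z₀) (hg : g.IsMeasurable) : Measurable (imputed X M Z₀ g) :=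
  (measurable_obs.comp (hM.prodMk hX)).add
    (measurable_mis.comp (hM.prodMk (hg.comp (hZ₀.prodMk (hX.prodMk hM)))))

lemma obs_imputed {Ω : Type*} (X Z₀ : Ω → Vec d) (M : Ω → Mask d) (g : Imputer d) (ω : Ω) :
    obs (M ω) (imputed X M Z₀ g ω) = obs (M ω) (X ω) := by
  rw [imputed, obs_add, obs_obs, obs_mis, add_zero]

/-- Imputation leaves the observed part unchanged, so data processing under `observe` gives a lower
bound that depends neither on the imputer nor on its seed. -/
lemma klDiv_observe_le_imputationKL {g : Imputer d} (hX : Measurable X) (hM : Measurable M)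
    (hZ₀ : Measurable Z₀) (hg : g.IsMeasurable) :
    InformationTheory.klDiv (P.map fun ω ↦ (obs (M ω) (X ω), M ω))
      (((P.map X).prod (P.map M)).map observe) ≤ imputationKL P X M Z₀ g := by
  have hI : Measurable fun ω ↦ (imputed X M Z₀ g ω, M ω) :=
    (measurable_imputed hX hM hZ₀ hg).prodMk hM
  have : IsProbabilityMeasure (P.map fun ω ↦ (imputed X M Z₀ g ω, M ω)) :=
    Measure.isProbabilityMeasure_map hI.aemeasurable
  have : IsProbabilityMeasure (P.map X) := Measure.isProbabilityMeasure_map hX.aemeasurable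
  have : IsProbabilityMeasure (P.map M) := Measure.isProbabilityMeasure_map hM.aemeasurable
  have h1 : P.map (fun ω ↦ (obs (M ω) (X ω), M ω)) =
      (P.map fun ω ↦ (imputed X M Z₀ g ω, M ω)).map observe := by
    rw [Measure.map_map measurable_observe hI]
    congr 1 with ω : 1
    simp only [Function.comp_apply, observe, obs_imputed]
  rw [h1]
  exact InformationTheory.klDiv_map_le _ _ measurable_observe

/-- The conditional law of the missing part given the observed part, without conditioning on the
mask. -/
noncomputable def missingKernel (P : Measure Ω) [IsFiniteMeasure P] (X : Ω → Vec d) :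
    Kernel (Vec d × Mask d) (Vec d) where
  toFun p := condDistrib (fun ω ↦ mis p.2 (X ω)) (fun ω ↦ obs p.2 (X ω)) P p.1
  measurable' := measurable_from_prod_countable_left fun m ↦
    (condDistrib (fun ω ↦ mis m (X ω)) (fun ω ↦ obs m (X ω)) P).measurable

instance : IsMarkovKernel (missingKernel P X) :=
  ⟨fun p ↦ inferInstanceAs (IsProbabilityMeasure
    (condDistrib (fun ω ↦ mis p.2 (X ω)) (fun ω ↦ obs p.2 (X ω)) P p.1))⟩

lemma missingKernel_comap (m : Mask d) :
    (missingKernel P X).comap (fun u ↦ (u, m)) measurable_prodMk_right =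
      condDistrib (fun ω ↦ mis m (X ω)) (fun ω ↦ obs m (X ω)) P := rfl

/-- Under the product law the mask is independent of the data, so given the observation the missing
part follows `missingKernel`. -/
lemma map_prod_eq_map_recombine (hX : Measurable X) (hM : Measurable M) :
    (P.map X).prod (P.map M) =
      ((((P.map X).prod (P.map M)).map observe) ⊗ₘ missingKernel P X).map recombine := by
  have : IsProbabilityMeasure (P.map X) := Measure.isProbabilityMeasure_map hX.aemeasurable
  have : IsProbabilityMeasure (P.map M) := Measure.isProbabilityMeasure_map hM.aemeasurable
  have hob : Measurable fun p : Vec d × Mask d ↦ obs p.2 p.1 :=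
    measurable_obs.comp (measurable_snd.prodMk measurable_fst)
  have hmi : Measurable fun p : Vec d × Mask d ↦ mis p.2 p.1 :=
    measurable_mis.comp (measurable_snd.prodMk measurable_fst)
  have key := map_prodMk_eq_compProd_of_forall_restrict (Q := (P.map X).prod (P.map M))
    hob measurable_snd hmi (missingKernel P X) fun m ↦ ?_
  · have h2 : ((P.map X).prod (P.map M)).map observe =
      ((P.map X).prod (P.map M)).map fun p ↦ (obs p.2 p.1, p.2) := rfl
    rw [h2, ← key, Measure.map_map measurable_recombine ((hob.prodMk measurable_snd).prodMk hmi)]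
    conv_lhs => rw [← Measure.map_id (μ := (P.map X).prod (P.map M))]
    congr 1 with p : 1
    simp [recombine]
  · have hmm : MeasurableSet ({m} : Set (Mask d)) := measurableSet_singleton m
    have hpre : (Prod.snd : Vec d × Mask d → Mask d) ⁻¹' {m} = univ ×ˢ {m} := by
      ext p; simp
    have hmis : Measurable fun ω ↦ mis m (X ω) := (continuous_mis m).measurable.comp hX
    have hR : ((P.map X).prod (P.map M)).restrict (Prod.snd ⁻¹' {m}) =
        (P.map M) {m} • P.map fun ω ↦ (X ω, m) := by
      rw [hpre, ← Measure.prod_restrict, Measure.restrict_univ, Measure.restrict_singleton,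
        Measure.prod_smul_right, Measure.prod_dirac, Measure.map_map measurable_prodMk_right hX]
      rfl
    rw [missingKernel_comap, hR, Measure.map_smul, Measure.map_smul,
      Measure.map_map hob (hX.prodMk measurable_const),
      Measure.map_map (hob.prodMk hmi) (hX.prodMk measurable_const),
      Measure.compProd_smul_left]
    congr 1
    exact (compProd_map_condDistrib (X := fun ω ↦ obs m (X ω)) hmis.aemeasurable).symm

lemma map_imputed_eq_map_recombine {g : Imputer d} (hX : Measurable X) (hM : Measurable M)
    (hZ₀ : Measurable Z₀) (hg : g.IsMeasurable)
    (h : ∀ m : Mask d, P (M ⁻¹' {m}) ≠ 0 →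
      condDistrib (fun ω ↦ g (Z₀ ω) (X ω) (M ω)) (fun ω ↦ obs m (X ω)) (P[|M ⁻¹' {m}])
        =ᵐ[obsLaw P X M m] condDistrib (fun ω ↦ mis m (X ω)) (fun ω ↦ obs m (X ω)) P) :
    P.map (fun ω ↦ (imputed X M Z₀ g ω, M ω)) =
      ((P.map fun ω ↦ (obs (M ω) (X ω), M ω)) ⊗ₘ missingKernel P X).map recombine := by
  have hob : Measurable fun ω ↦ obs (M ω) (X ω) := measurable_obs.comp (hM.prodMk hX)
  have hG : Measurable fun ω ↦ g (Z₀ ω) (X ω) (M ω) := hg.comp (hZ₀.prodMk (hX.prodMk hM))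
  rw [← map_prodMk_eq_compProd_of_forall_restrict hob hM hG (missingKernel P X) fun m ↦ ?_,
    Measure.map_map measurable_recombine ((hob.prodMk hM).prodMk hG)]
  · rfl
  · rcases eq_or_ne (P (M ⁻¹' {m})) 0 with h0 | h0
    · rw [Measure.restrict_eq_zero.2 h0, Measure.map_zero, Measure.map_zero,
        Measure.compProd_zero_left]
    · have hobs : Measurable fun ω ↦ obs m (X ω) := (continuous_obs m).measurable.comp hX
      have hae : ∀ᵐ ω ∂P.restrict (M ⁻¹' {m}), M ω = m :=
        ae_restrict_mem (hM (measurableSet_singleton m))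
      have e1 : (P.restrict (M ⁻¹' {m})).map (fun ω ↦ obs (M ω) (X ω)) =
          (P.restrict (M ⁻¹' {m})).map fun ω ↦ obs m (X ω) := by
        refine Measure.map_congr ?_
        filter_upwards [hae] with ω hω using by rw [hω]
      have e2 : (P.restrict (M ⁻¹' {m})).map
            (fun ω ↦ (obs (M ω) (X ω), g (Z₀ ω) (X ω) (M ω))) =
          (P.restrict (M ⁻¹' {m})).map fun ω ↦ (obs m (X ω), g (Z₀ ω) (X ω) (M ω)) := by
        refine Measure.map_congr ?_
        filter_upwards [hae] with ω hω using by rw [hω]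
      have hPm : P.restrict (M ⁻¹' {m}) = P (M ⁻¹' {m}) • P[|M ⁻¹' {m}] := by
        rw [ProbabilityTheory.cond, smul_smul, ENNReal.mul_inv_cancel h0 (measure_ne_top _ _),
          one_smul]
      rw [missingKernel_comap, e1, e2, hPm, Measure.map_smul, Measure.map_smul,
        Measure.compProd_smul_left]
      congr 1
      rw [← compProd_map_condDistrib (X := fun ω ↦ obs m (X ω)) hG.aemeasurable]
      exact Measure.compProd_congr (h m h0)

/-- Both laws are images under `recombine` of an observed law extended by the same kernel. The
common kernel adds nothing to the divergence and `recombine` cannot increase it, so the lower bound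
is attained. -/
theorem isOptimalImputer_of_condDistrib_eq {g : Imputer d} (hX : Measurable X) (hM : Measurable M)
    (hZ₀ : Measurable Z₀) (hg : g.IsMeasurable)
    (h : ∀ m : Mask d, P (M ⁻¹' {m}) ≠ 0 →
      condDistrib (fun ω ↦ g (Z₀ ω) (X ω) (M ω)) (fun ω ↦ obs m (X ω)) (P[|M ⁻¹' {m}])
        =ᵐ[obsLaw P X M m] condDistrib (fun ω ↦ mis m (X ω)) (fun ω ↦ obs m (X ω)) P) :
    IsOptimalImputer P X M Z₀ g := by
  refine ⟨hg, fun Z₀' g' hZ₀' hg' ↦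
    le_trans ?_ (klDiv_observe_le_imputationKL hX hM hZ₀' hg')⟩
  have : IsProbabilityMeasure (P.map X) := Measure.isProbabilityMeasure_map hX.aemeasurable
  have : IsProbabilityMeasure (P.map M) := Measure.isProbabilityMeasure_map hM.aemeasurable
  rw [imputationKL, map_imputed_eq_map_recombine hX hM hZ₀ hg h]
  conv_lhs => rw [map_prod_eq_map_recombine hX hM]
  refine (InformationTheory.klDiv_map_le _ _ measurable_recombine).trans_eq ?_
  exact InformationTheory.klDiv_compProd_left _ _ _

end Divergence

end MIRI


theorem theorem1 {d : ℕ} {Ω : Type*} [MeasurableSpace Ω]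
    (P : MeasureTheory.Measure Ω) [MeasureTheory.IsProbabilityMeasure P]
    -- the previous imputation `X = X^{(t-1)}`, the mask `M` and the seed `Z₀`
    (X : Ω → MIRI.Vec d) (M : Ω → MIRI.Mask d) (Z₀ : Ω → MIRI.Vec d)
    (hX : Measurable X) (hM : Measurable M) (hZ₀ : Measurable Z₀)
    (hX2 : MeasureTheory.MemLp X 2 P)
    -- the optimal velocity field, in its continuous version
    (v : MIRI.Velocity d) (hv : MIRI.IsOptimalVelocity P X M v)
    (hvc : ∀ m : MIRI.Mask d, P (M ⁻¹' {m}) ≠ 0 →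
      v.IsContinuousOnDiagonal m (MIRI.obsLaw P X M m))
    -- the imputation ODE is well posed from `Z₀`, and `g` is its terminal map
    (hinit : MIRI.IsInitialSeed P X M Z₀)
    (g : MIRI.Imputer d) (hg : g.IsMeasurable)
    (hode : ∀ᵐ ω ∂P,
      MIRI.HasUniqueTerminalValue v (M ω) (X ω) (Z₀ ω) (g (Z₀ ω) (X ω) (M ω))) :
    -- given `M = m` and the observed part, `Z₁` has the law of `X_{1-m}` given `X_m`
    (∀ m : MIRI.Mask d, P (M ⁻¹' {m}) ≠ 0 →
      ProbabilityTheory.condDistrib (fun ω => g (Z₀ ω) (X ω) (M ω)) (fun ω => MIRI.obs m (X ω))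
          (ProbabilityTheory.cond P (M ⁻¹' {m}))
        =ᵐ[MIRI.obsLaw P X M m]
      ProbabilityTheory.condDistrib (fun ω => MIRI.mis m (X ω)) (fun ω => MIRI.obs m (X ω)) P) ∧
    -- and `g` is an optimal imputer
    MIRI.IsOptimalImputer P X M Z₀ g := by
  have h : ∀ m : MIRI.Mask d, P (M ⁻¹' {m}) ≠ 0 → _ := fun m hm ↦
    MIRI.condDistrib_terminal_ae_eq hX hM hZ₀ hX2 hv hm (hvc m hm) hinit
      (G := fun ω ↦ g (Z₀ ω) (X ω) (M ω)) (hg.comp (hZ₀.prodMk (hX.prodMk hM))) hode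
  exact ⟨h, MIRI.isOptimalImputer_of_condDistrib_eq hX hM hZ₀ hg h⟩
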